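/- **Setting.** Agents $i=1,\dots,n$ have differentiable local objectives $f_i:\mathbb R^p\to\mathbb R$ with $L$-Lipschitz gradients ($L>0$). Let $f=\frac1n\sum_i f_i$ be bounded below, $f^*=\inf f$, and let $f$ satisfy the PL condition $2\mu(f(x)-f^*)\le\|\nabla f(x)\|^2$ for all $x$, with $\mu>0$; put $\kappa=L/\mu$. The agents communicate over a connected undirected graph with a nonnegative, symmetric, stochastic, positive semidefinite mixing matrix $W=[w_{ij}]$ for which, for $i\ne j$, $w_{ij}>0$ if and only if $\{i,j\}$ is an edge. Let $\lambda=\|W-\mathbf 1\mathbf 1^\top/n\|_2$, $\eta_w=1/(1+\sqrt{1-\lambda^2})$, $\tilde\rho_w=\sqrt{\eta_w}$, $c_0=14$, $\Pi=I-\mathbf 1\mathbf 1^\top/n$. Bold letters denote the $n\times p$ matrices whose rows belong to the agents, bars denote averages over the agents, and $\|\cdot\|$ is the Frobenius norm for matrices. **Method (LMT).** Given a deterministic $\mathbf x_0=\mathbf x_0^{(l)}$, $\mathbf z_0=\mathbf c_0=\mathbf c_{-1}=\mathbf 0$, an integer $Q\ge1$, step sizes $\eta_a,\eta_s>0$ and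 $\beta<1$, round $t\ge 0$ is: $\mathbf x_t^0=\mathbf x_t$ and $x_{i,t}^{\ell+1}=x_{i,t}^\ell-\eta_a(g_{i,t}^\ell+c_{i,t})$ for $0\le\ell<Q$, where $g_{i,t}^\ell=g_i(x_{i,t}^\ell;\xi_{i,t}^\ell)$; then $\mathbf r_t=\frac{1}{\eta_aQ}(\mathbf x_t-\mathbf x_t^Q)-\mathbf c_t$, $\mathbf z_{t+1}=\beta\mathbf z_t+(1-\beta)\mathbf r_t$, $\mathbf y_t=\mathbf z_{t+1}+\mathbf c_t$, $\mathbf y_t^{(l)}=\mathbf z_{t+1}+\mathbf c_{t-1}$, $\mathbf c_{t+1}=\mathbf c_t-\mathbf y_t+(1+\eta_w)W\mathbf y_t-\eta_w\mathbf y_t^{(l)}$, $\mathbf x_{t+1}=(1+\eta_w)W(\mathbf x_t-Q\eta_s\eta_a\mathbf y_t)-\eta_w(\mathbf x_t^{(l)}-Q\eta_s\eta_a\mathbf y_t)$, $\mathbf x_{t+1}^{(l)}=\mathbf x_t-Q\eta_s\eta_a\mathbf y_t$. Conditionally on all samples drawn before local step $\ell$ of round $t$, each $g_{i,t}^\ell$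 has mean $\nabla f_i(x_{i,t}^\ell)$ and $\mathbb E\|g_{i,t}^\ell-\nabla f_i(x_{i,t}^\ell)\|^2\le\sigma^2$, and the stochastic gradients of different agents are independent. **Quantities.** Put $\hat\eta=\eta_a\eta_sQ$, $\Delta_f=f(\bar x_0)-f^*$, $\nabla F(\mathbf 1\bar x_0^\top)=(\nabla f_1(\bar x_0),\dots,\nabla f_n(\bar x_0))^\top$, $\mathcal R_0^x=c_0\tilde\rho_w\|\Pi\mathbf x_0\|^2$, $\mathcal R_0^y=c_0\tilde\rho_w\,\mathbb E\|\Pi\mathbf y_0\|^2$, and (recall $\mathbf z_0=\mathbf 0$) $$\tilde{\mathcal L}_0=\Delta_f+\tfrac{11\hat\eta L^2}{n(1-\tilde\rho_w)}\mathcal R_0^x+\tfrac{21\hat\eta\eta_a^2Q^2L^2}{n(1-\tilde\rho_w)}\mathcal R_0^y+\tfrac{6(1+63c_0)\hat\eta\eta_a^2Q^2L^2}{n(1-\beta)}\|\nabla F(\mathbf 1\bar x_0^\top)\|^2,$$ $$\tilde{\mathcal H}_0=\mathcal R_0^x+\eta_a^2Q^2\mathcal R_0^y+32c_0\eta_a^2Q^2\|\nabla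 F(\mathbf 1\bar x_0^\top)\|^2 .$$ **Theorem.** Suppose $\eta_a\le\dfrac{1}{15\sqrt{2(1+63c_0)}\,Q\max\{L,\mu\}}$, $\eta_s\le\dfrac{1-\beta}{\sqrt{15c_0}}$ and $\beta\ge\tilde\rho_w$. Then all $f(x_{i,t})$ are integrable and, for every $t\ge0$, $$\frac1n\sum_{i=1}^n\mathbb E[f(x_{i,t})-f^*]\le\Big(\frac{4+\beta}{5}\Big)^t\frac{L\,\tilde{\mathcal H}_0}{2n}+3\Big(1-\frac{\hat\eta\mu}{3}\Big)^t\tilde{\mathcal L}_0+\frac{4\hat\eta L\sigma^2}{n\mu Q}+\frac{220\hat\eta^2L^2\sigma^2}{n\mu Q(1-\beta)}+\frac{520(1+63c_0)\eta_a^2QL^2\sigma^2}{\mu},$$ where $$\tilde{\mathcal H}_0\le2c_0\tilde\rho_w\|\Pi\mathbf x_0\|^2+\frac1{L^2}\Big(2\|\nabla F(\mathbf 1\bar x_0^\top)\|^2+\frac{8(1-\beta)n\sigma^2}{Q}+nL(1-\beta)\Delta_f\Big).$$ In particular, if in addition $T\ge1$, $\beta=\tilde\rho_w$, $\eta_a=O(1/(Q\mu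 T))$ and $\eta_s=O(1-\tilde\rho_w)$, then $$\frac1n\sum_{i=1}^n\mathbb E[f(x_{i,T})-f^*]=O\Big(\frac{\kappa\sigma^2}{n\mu QT}+\frac{\kappa^2\sigma^2}{\mu QT^2}+L\,\frac{\tilde{\mathcal H}_0}{n}\exp\Big(-\frac{T\sqrt{1-\lambda}}{5}\Big)+\tilde{\mathcal L}_0\exp\Big(-\frac{T\hat\eta\mu}{3}\Big)\Big),$$ where the constant in this last $O(\cdot)$ depends only on the constants in the orders of $\eta_a$ and $\eta_s$. -/

import Mathlib

open MeasureTheory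
open scoped BigOperators Matrix

namespace LMT

/-- The decision space `ℝ^p` with its Euclidean norm. -/
abbrev Vec (p : ℕ) : Type := EuclideanSpace ℝ (Fin p)

/-- A stacked variable: one vector of `ℝ^p` per agent (the rows of an `n × p` matrix). -/
abbrev Stack (n p : ℕ) : Type := Fin n → Vec p

/-- The average over the agents. -/
noncomputable def avg {n p : ℕ} (a : Stack n p) : Vec p := (n : ℝ)⁻¹ • ∑ i, a i

/-- The squared Frobenius norm `‖a‖²` of a stacked variable. -/
noncomputable def frobSq {n p : ℕ} (a : Stack n p) : ℝ := ∑ i, ‖a i‖ ^ 2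

/-- `Π a`, where `Π = I - 𝟏𝟏ᵀ / n`. -/
noncomputable def proj {n p : ℕ} (a : Stack n p) : Stack n p := fun i => a i - avg a

/-- `W a`, the product of an `n × n` matrix with a stacked variable. -/
noncomputable def mix {n p : ℕ} (W : Matrix (Fin n) (Fin n) ℝ) (a : Stack n p) : Stack n p :=
  fun i => ∑ j, W i j • a j

/-- The spectral norm `λ` of `W - 𝟏𝟏ᵀ / n`. -/
noncomputable def specNorm {n : ℕ} (W : Matrix (Fin n) (Fin n) ℝ) : ℝ :=
  ‖Matrix.toEuclideanCLM (n := Fin n) (𝕜 := ℝ) (W - Matrix.of fun _ _ => (n : ℝ)⁻¹)‖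

/-- The Chebyshev parameter `η_w = 1 / (1 + √(1 - λ²))`. -/
noncomputable def etaW {n : ℕ} (W : Matrix (Fin n) (Fin n) ℝ) : ℝ :=
  1 / (1 + Real.sqrt (1 - specNorm W ^ 2))

/-- `ρ̃_w = √η_w`. -/
noncomputable def rhoW {n : ℕ} (W : Matrix (Fin n) (Fin n) ℝ) : ℝ := Real.sqrt (etaW W)

/-- The numerical constant `c₀ = 14`. -/
def c0 : ℝ := 14

/-- The data of a run of Local Momentum Tracking: the problem, the network, the stochastic
gradient oracle, the starting points and the parameters of the method. Here `ξ i t ℓ` is the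
sample that agent `i` draws at local step `ℓ` of communication round `t`. -/
structure Setup (Ω Ξ : Type*) where
  /-- number of agents -/
  n : ℕ
  /-- dimension of the decision variable -/
  p : ℕ
  /-- number of local updates per communication round -/
  Q : ℕ
  /-- local objective functions -/
  f : Fin n → Vec p → ℝ
  /-- stochastic gradient oracles -/
  g : Fin n → Vec p → Ξ → Vec p
  /-- samples -/
  ξ : Fin n → ℕ → ℕ → Ω → Ξ
  /-- communication graph -/
  G : SimpleGraph (Fin n)
  /-- mixing matrix -/
  W : Matrix (Fin n) (Fin n) ℝ
  /-- starting points -/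
  x₀ : Stack n p
  /-- local step size `η_a` -/
  ηa : ℝ
  /-- outer step size `η_s` -/
  ηs : ℝ
  /-- momentum parameter -/
  β : ℝ

/-- The variables that are carried from one communication round to the next:
`x_t`, `x_t^{(l)}`, `z_t`, `c_t` and `c_{t-1}`. -/
structure State (n p : ℕ) where
  x : Stack n p
  xl : Stack n p
  z : Stack n p
  c : Stack n p
  cPrev : Stack n p

namespace Setup

variable {Ω Ξ : Type*} (S : Setup Ω Ξ)

/-- The global objective `f = (1/n) ∑ f_i`. -/
noncomputable def obj (x : Vec S.p) : ℝ := (S.n : ℝ)⁻¹ * ∑ i, S.f i x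

/-- `f^* = inf f`. -/
noncomputable def fStar : ℝ := ⨅ x, S.obj x

/-- `η̂ = η_a η_s Q`. -/
noncomputable def etaHat : ℝ := S.ηa * S.ηs * S.Q

/-! ### The algorithm -/

/-- Local updates: `x^{ℓ+1}_i = x^ℓ_i - η_a (g_i(x^ℓ_i; s ℓ i) + c_i)`, started at `x`. -/
noncomputable def localSteps (s : ℕ → Fin S.n → Ξ) (x c : Stack S.n S.p) : ℕ → Stack S.n S.p
  | 0 => x
  | ℓ + 1 => fun i =>
      localSteps s x c ℓ i - S.ηa • (S.g i (localSteps s x c ℓ i) (s ℓ i) + c i)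

/-- The updated momentum `z_{t+1} = β z_t + (1 - β) r_t`,
with `r_t = (x_t - x_t^Q) / (η_a Q) - c_t`. -/
noncomputable def zNext (s : ℕ → Fin S.n → Ξ) (u : State S.n S.p) : Stack S.n S.p := fun i =>
  S.β • u.z i +
    (1 - S.β) • ((1 / (S.ηa * S.Q)) • (u.x i - S.localSteps s u.x u.c S.Q i) - u.c i)

/-- The tracking variable `y_t = z_{t+1} + c_t`. -/
noncomputable def yVar (s : ℕ → Fin S.n → Ξ) (u : State S.n S.p) : Stack S.n S.p :=
  S.zNext s u + u.c

/-- The auxiliary variable `y_t^{(l)} = z_{t+1} + c_{t-1}`. -/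
noncomputable def ylVar (s : ℕ → Fin S.n → Ξ) (u : State S.n S.p) : Stack S.n S.p :=
  S.zNext s u + u.cPrev

/-- One communication round, with samples `s ℓ i`. -/
noncomputable def round (s : ℕ → Fin S.n → Ξ) (u : State S.n S.p) : State S.n S.p where
  x := (1 + etaW S.W) • mix S.W (u.x - (S.Q * S.ηs * S.ηa) • S.yVar s u) -
    etaW S.W • (u.xl - (S.Q * S.ηs * S.ηa) • S.yVar s u)
  xl := u.x - (S.Q * S.ηs * S.ηa) • S.yVar s u
  z := S.zNext s u
  c := u.c - S.yVar s u + (1 + etaW S.W) • mix S.W (S.yVar s u) - etaW S.W • S.ylVar s u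
  cPrev := u.c

/-- Initialization: `x_0 = x_0^{(l)}` given, `z_0 = 0`, `c_0 = c_{-1} = 0`. -/
def init : State S.n S.p where
  x := S.x₀
  xl := S.x₀
  z := 0
  c := 0
  cPrev := 0

/-- The samples used in round `t`, as a function of the local step and the agent. -/
def samples (t : ℕ) (ω : Ω) : ℕ → Fin S.n → Ξ := fun ℓ i => S.ξ i t ℓ ω

/-- The state at the beginning of communication round `t`. -/
noncomputable def state (ω : Ω) : ℕ → State S.n S.p
  | 0 => S.init
  | t + 1 => S.round (S.samples t ω) (state ω t)

/-- The iterates `x_{i,t}`. -/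
noncomputable def iter (t : ℕ) (i : Fin S.n) (ω : Ω) : Vec S.p := (S.state ω t).x i

/-- The local iterates `x_{i,t}^ℓ`. -/
noncomputable def localIter (t ℓ : ℕ) (i : Fin S.n) (ω : Ω) : Vec S.p :=
  S.localSteps (S.samples t ω) (S.state ω t).x (S.state ω t).c ℓ i

/-- The stochastic gradients `g_{i,t}^ℓ = g_i(x_{i,t}^ℓ; ξ_{i,t}^ℓ)`. -/
noncomputable def stochGrad (t ℓ : ℕ) (i : Fin S.n) (ω : Ω) : Vec S.p :=
  S.g i (S.localIter t ℓ i ω) (S.ξ i t ℓ ω)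

/-! ### The assumptions -/

/-- The history `F_t^ℓ`: the σ-algebra generated by the samples that all agents have drawn
before local step `ℓ` of round `t`. -/
abbrev history [MeasurableSpace Ξ] (t ℓ : ℕ) : MeasurableSpace Ω :=
  ⨆ (i : Fin S.n) (t' : ℕ) (ℓ' : ℕ) (_ : ℓ' < S.Q) (_ : t' < t ∨ (t' = t ∧ ℓ' < ℓ)),
    MeasurableSpace.comap (S.ξ i t' ℓ') inferInstance

end Setup

/-- Conditional independence of two random variables given a σ-algebra `m`. -/
def CondIndepGiven {Ω E : Type*} [mΩ : MeasurableSpace Ω] [MeasurableSpace E]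
    (P : Measure Ω) (m : MeasurableSpace Ω) (X Y : Ω → E) : Prop :=
  ∀ A B : Set E, MeasurableSet A → MeasurableSet B →
    P[(X ⁻¹' A ∩ Y ⁻¹' B).indicator (fun _ => (1 : ℝ)) | m] =ᵐ[P]
      P[(X ⁻¹' A).indicator (fun _ => (1 : ℝ)) | m] *
        P[(Y ⁻¹' B).indicator (fun _ => (1 : ℝ)) | m]

/-- The stochastic gradients are unbiased with variance at most `σ²`, conditionally on the past,
and are independent across agents, conditionally on the past. (The past determines the points
`x_{i,t}^ℓ` at which they are evaluated.) -/
structure Setup.OracleAssumption {Ω Ξ : Type*} [MeasurableSpace Ω] [MeasurableSpace Ξ]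
    (S : Setup Ω Ξ) (P : Measure Ω) (σ : ℝ) : Prop where
  measurable_oracle : ∀ i, Measurable (Function.uncurry (S.g i))
  measurable_sample : ∀ i t ℓ, Measurable (S.ξ i t ℓ)
  unbiased : ∀ i t, ∀ ℓ < S.Q,
    P[S.stochGrad t ℓ i | S.history t ℓ] =ᵐ[P] fun ω => gradient (S.f i) (S.localIter t ℓ i ω)
  integrable_sq : ∀ i t, ∀ ℓ < S.Q,
    Integrable (fun ω => ‖S.stochGrad t ℓ i ω - gradient (S.f i) (S.localIter t ℓ i ω)‖ ^ 2) P
  variance : ∀ i t, ∀ ℓ < S.Q,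
    P[fun ω => ‖S.stochGrad t ℓ i ω - gradient (S.f i) (S.localIter t ℓ i ω)‖ ^ 2 |
      S.history t ℓ] ≤ᵐ[P] fun _ => σ ^ 2
  indep : ∀ i j, i ≠ j → ∀ t, ∀ ℓ < S.Q,
    CondIndepGiven P (S.history t ℓ) (S.stochGrad t ℓ i) (S.stochGrad t ℓ j)

/-- Each `f_i` is differentiable with `L`-Lipschitz gradient, and `f` is bounded from below. -/
structure Setup.SmoothAssumption {Ω Ξ : Type*} (S : Setup Ω Ξ) (L : ℝ) : Prop where
  differentiable : ∀ i, Differentiable ℝ (S.f i)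
  lipschitz : ∀ i x x', ‖gradient (S.f i) x - gradient (S.f i) x'‖ ≤ L * ‖x - x'‖
  bddBelow : BddBelow (Set.range S.obj)

/-- The graph is connected and undirected, its edges are the pairs with a positive weight, and
`W` is nonnegative, stochastic, symmetric and positive semidefinite. -/
structure Setup.NetworkAssumption {Ω Ξ : Type*} (S : Setup Ω Ξ) : Prop where
  connected : S.G.Connected
  adj_iff : ∀ i j, i ≠ j → (S.G.Adj i j ↔ 0 < S.W i j ∧ 0 < S.W j i)
  eq_zero : ∀ i j, i ≠ j → ¬ S.G.Adj i j → S.W i j = 0 ∧ S.W j i = 0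
  nonneg : ∀ i j, 0 ≤ S.W i j
  stochastic : ∀ i, ∑ j, S.W i j = 1
  symmetric : S.Wᵀ = S.W
  posSemidef : S.W.PosSemidef

/-- The Polyak-Łojasiewicz condition with modulus `μ`. -/
def Setup.PLAssumption {Ω Ξ : Type*} (S : Setup Ω Ξ) (μ : ℝ) : Prop :=
  ∀ x, 2 * μ * (S.obj x - S.fStar) ≤ ‖gradient S.obj x‖ ^ 2

/-- The assumptions of the theorem on the problem, the oracle, the network and the parameters.
The condition on `η_a` reads `η_a ≤ 1 / (15 √(2 (1 + 63 c₀)) Q max(L, μ))`. -/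
structure Setup.Assumptions {Ω Ξ : Type*} [MeasurableSpace Ω] [MeasurableSpace Ξ]
    (S : Setup Ω Ξ) (P : Measure Ω) (σ L μ : ℝ) : Prop where
  sigma_nonneg : 0 ≤ σ
  L_pos : 0 < L
  mu_pos : 0 < μ
  Q_pos : 0 < S.Q
  oracle : S.OracleAssumption P σ
  smooth : S.SmoothAssumption L
  network : S.NetworkAssumption
  pl : S.PLAssumption μ
  etaA_pos : 0 < S.ηa
  etaA_le_mu : S.ηa ≤ 1 / (15 * Real.sqrt (2 * (1 + 63 * c0)) * S.Q * μ)
  etaA_le_L : S.ηa ≤ 1 / (15 * Real.sqrt (2 * (1 + 63 * c0)) * S.Q * L)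
  etaS_pos : 0 < S.ηs
  etaS_le : S.ηs ≤ (1 - S.β) / Real.sqrt (15 * c0)
  beta_ge : rhoW S.W ≤ S.β
  beta_lt_one : S.β < 1

/-! ### The quantities in the bounds -/

section Quantities

variable {Ω Ξ : Type*} [MeasurableSpace Ω] (S : Setup Ω Ξ) (P : Measure Ω)

/-- The average optimality gap `(1/n) ∑ E[f(x_{i,t}) - f^*]`. -/
noncomputable def Setup.gap (t : ℕ) : ℝ :=
  (S.n : ℝ)⁻¹ * ∑ i, ∫ ω, (S.obj (S.iter t i ω) - S.fStar) ∂P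

/-- `∇F(𝟏 x̄_0ᵀ)`: the local gradients at the average starting point. -/
noncomputable def Setup.gradF0 : Stack S.n S.p := fun i => gradient (S.f i) (avg S.x₀)

/-- `Δ_f = f(x̄_0) - f^*`. -/
noncomputable def Setup.DeltaF : ℝ := S.obj (avg S.x₀) - S.fStar

/-- `R_0^x = c₀ ρ̃_w ‖Π x_0‖²`. -/
noncomputable def Setup.Rx0 : ℝ := c0 * rhoW S.W * frobSq (proj S.x₀)

/-- `R_0^y = c₀ ρ̃_w E‖Π y_0‖²`. -/
noncomputable def Setup.Ry0 : ℝ :=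
  c0 * rhoW S.W * ∫ ω, frobSq (proj (S.yVar (S.samples 0 ω) S.init)) ∂P

/-- The initial value `E[L̃_0]` of the first Lyapunov function (with `d̄_0 = x̄_0`). -/
noncomputable def Setup.L0 (L : ℝ) : ℝ :=
  S.obj (avg S.x₀) - S.fStar
    + 4 * S.etaHat ^ 3 * L ^ 2 / (1 - S.β) ^ 3 * ‖avg S.init.z‖ ^ 2
    + 11 * S.etaHat * L ^ 2 / (S.n * (1 - rhoW S.W)) * S.Rx0
    + 21 * S.etaHat * S.ηa ^ 2 * S.Q ^ 2 * L ^ 2 / (S.n * (1 - rhoW S.W)) * S.Ry0 P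
    + 6 * (1 + 63 * c0) * S.etaHat * S.ηa ^ 2 * S.Q ^ 2 * L ^ 2 / (S.n * (1 - S.β))
        * frobSq (S.init.z - S.gradF0)

/-- The initial value `E[H̃_0]` of the second Lyapunov function. -/
noncomputable def Setup.H0 : ℝ :=
  S.Rx0 + S.ηa ^ 2 * S.Q ^ 2 * S.Ry0 P
    + 32 * c0 * S.ηa ^ 2 * S.Q ^ 2 * frobSq (S.init.z - S.gradF0)
    + S.etaHat ^ 2 * S.n / (1 - S.β) ^ 2 * ‖avg S.init.z‖ ^ 2

end Quantities

end LMT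

/-! Averaging over the agents removes the network. As `W` is symmetric and stochastic, the
corrections `c` have mean zero and `x̄` moves by `-η̂ z̄_{t+1}`, where `z̄` is an exponential
average of stochastic gradients. The shifted point `d̄ = x̄ - η̂β/(1-β) z̄` absorbs the momentum: it
makes plain stochastic gradient steps (`dBar_succ`), so the descent lemma applies to `f(d̄)`. The
errors there are `‖z̄‖²`, which measures `d̄ - x̄`, and the drift of the local iterates away from
`x̄`.

The network errors are those of `x` and of `c + z`. With their delayed copies, both follow one
recursion, accelerated gossip `a' = (1+η_w) W (a+v) - η_w (b+v)`, `b' = a+v`, driven by `-η̂ y_t`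
and by the momentum increment respectively. In an eigenbasis of `W - 𝟏𝟏ᵀ/n` a mode `w` is governed
by `z² - (1+η_w) w z + η_w`, whose roots are conjugate of modulus `√η_w = ρ̃_w`. The squared modulus
of the corresponding eigencoordinate is a quadratic form that one step multiplies by exactly `η_w`.
Suitably normalised, it dominates the consensus error and is at most twice that error when both
copies agree, uniformly in the mode (`chebyshev_mode_bound`). Separating the forcing costs one
factor `ρ̃_w`, which leaves a contraction by `ρ̃_w` (`frobSq_proj_le_gossipBound`).

The gradient noise is orthogonal to the past, and conditional independence makes it uncorrelated
across agents (`integral_inner_eq_zero_of_condIndepGiven`). Hence the noise averaged over `n` agents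
and `Q` steps has second moment at most `σ²/(nQ)`.

What remains is a system of scalar recursions for the expected gap at `d̄`, the consensus and
tracking errors, the deviation of `z` from the local gradients, and `‖z̄‖²`. A weighted sum of the
last four contracts up to small multiples of `‖∇f(d̄)‖²` and of the variance (`netEnergy_step`).
Added to the gap, it gives a Lyapunov function that PL contracts by `1 - (2/3)η̂μ`
(`lyapunov_step`). A second weighting, which sees the objective only through a small forcing,
contracts at the network rate `1 - (7/10)(1-β)`. The gap at the agents is bounded by both
(`gap_le`). If `μ > L`, smoothness and PL force `f` to be constant and there is nothing to prove. -/

namespace LMT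

/-! ### Smoothness: descent lemma and its consequences for the global objective. -/

section Smooth

variable {E : Type*} [NormedAddCommGroup E] [InnerProductSpace ℝ E] [CompleteSpace E]

/-- The descent lemma for functions with Lipschitz gradient. -/
theorem descent_lemma {f : E → ℝ} {L : ℝ} (hf : Differentiable ℝ f)
    (hL : ∀ x y, ‖gradient f x - gradient f y‖ ≤ L * ‖x - y‖) (x v : E) :
    f (x + v) ≤ f x + inner ℝ (gradient f x) v + L / 2 * ‖v‖ ^ 2 := by
  have hline : ∀ t : ℝ, HasDerivAt (fun t : ℝ => x + t • v) v t := fun t => by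
    simpa using ((hasDerivAt_id t).smul_const v).const_add x
  have hder : ∀ t : ℝ, HasDerivAt
      (fun t : ℝ => f (x + t • v) - t * inner ℝ (gradient f x) v - L / 2 * ‖v‖ ^ 2 * t ^ 2)
      (inner ℝ (gradient f (x + t • v)) v - inner ℝ (gradient f x) v
        - L / 2 * ‖v‖ ^ 2 * (2 * t)) t := fun t => by
    have h1 := (hf (x + t • v)).hasFDerivAt.comp_hasDerivAt t (hline t)
    rw [← inner_gradient_left] at h1
    have h2 := (hasDerivAt_id t).mul_const (inner ℝ (gradient f x) v)
    have h3 := ((hasDerivAt_id t).pow 2).const_mul (L / 2 * ‖v‖ ^ 2)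
    exact ((h1.sub h2).sub h3).congr_deriv (by simp)
  -- Subtracting the quadratic model along the segment leaves a function of `t` whose derivative is
  -- nonpositive by the Lipschitz bound; compare `t = 0` with `t = 1`.
  have hanti : AntitoneOn
      (fun t : ℝ => f (x + t • v) - t * inner ℝ (gradient f x) v - L / 2 * ‖v‖ ^ 2 * t ^ 2)
      (Set.Icc 0 1) := by
    refine antitoneOn_of_deriv_nonpos (convex_Icc 0 1)
      (fun t _ => (hder t).continuousAt.continuousWithinAt)
      (fun t _ => (hder t).differentiableAt.differentiableWithinAt) fun t ht => ?_
    rw [interior_Icc] at ht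
    rw [(hder t).deriv, ← inner_sub_left]
    have h1 := real_inner_le_norm (gradient f (x + t • v) - gradient f x) v
    have h2 := hL (x + t • v) x
    rw [add_sub_cancel_left, norm_smul, Real.norm_eq_abs, abs_of_pos ht.1] at h2
    nlinarith [norm_nonneg v]
  have h := hanti (Set.left_mem_Icc.2 zero_le_one) (Set.right_mem_Icc.2 zero_le_one) zero_le_one
  simp only [one_smul, zero_smul, add_zero] at h
  linarith

/-- The gradient of a smooth function is bounded by the distance to a lower bound. -/
theorem norm_gradient_sq_le {f : E → ℝ} {L m : ℝ} (hL0 : 0 < L) (hf : Differentiable ℝ f)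
    (hL : ∀ x y, ‖gradient f x - gradient f y‖ ≤ L * ‖x - y‖) (hm : ∀ x, m ≤ f x) (x : E) :
    ‖gradient f x‖ ^ 2 ≤ 2 * L * (f x - m) := by
  -- The gradient step of length `1/L` minimises the quadratic upper model, and its value still lies
  -- above the lower bound `m`.
  have h := descent_lemma hf hL x (-(1 / L) • gradient f x)
  have h2 := hm (x + -(1 / L) • gradient f x)
  rw [inner_smul_right, real_inner_self_eq_norm_sq, norm_smul, mul_pow, norm_neg, Real.norm_eq_abs,
    sq_abs] at h
  have h3 : m ≤ f x - 1 / (2 * L) * ‖gradient f x‖ ^ 2 := by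
    refine (h2.trans h).trans (le_of_eq ?_)
    field_simp
    ring
  rw [show 2 * L * (f x - m) = ‖gradient f x‖ ^ 2
    + 2 * L * (f x - 1 / (2 * L) * ‖gradient f x‖ ^ 2 - m) by field_simp; ring]
  have : 0 ≤ f x - 1 / (2 * L) * ‖gradient f x‖ ^ 2 - m := by linarith
  nlinarith

end Smooth

namespace Setup

variable {Ω Ξ : Type*} {S : Setup Ω Ξ} {L : ℝ}

theorem hasGradientAt_obj (h : S.SmoothAssumption L) (x : Vec S.p) :
    HasGradientAt S.obj (avg fun i => gradient (S.f i) x) x := by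
  have h1 : HasFDerivAt S.obj ((S.n : ℝ)⁻¹ • ∑ i, fderiv ℝ (S.f i) x) x :=
    (HasFDerivAt.fun_sum (u := Finset.univ) fun i _ =>
      (h.differentiable i x).hasFDerivAt).const_mul ((S.n : ℝ)⁻¹)
  have h2 : InnerProductSpace.toDual ℝ (Vec S.p) (avg fun i => gradient (S.f i) x)
      = (S.n : ℝ)⁻¹ • ∑ i, fderiv ℝ (S.f i) x := by
    simp only [avg, map_smul, map_sum, toDual_gradient]
  rw [hasGradientAt_iff_hasFDerivAt, h2]
  exact h1

theorem gradient_obj (h : S.SmoothAssumption L) (x : Vec S.p) :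
    gradient S.obj x = avg fun i => gradient (S.f i) x := (hasGradientAt_obj h x).gradient

theorem differentiable_obj (h : S.SmoothAssumption L) : Differentiable ℝ S.obj :=
  fun x => (hasGradientAt_obj h x).differentiableAt

theorem lipschitz_gradient_obj (h : S.SmoothAssumption L) (hn : 0 < S.n) (x y : Vec S.p) :
    ‖gradient S.obj x - gradient S.obj y‖ ≤ L * ‖x - y‖ := by
  have hn' : (0 : ℝ) < S.n := Nat.cast_pos.2 hn
  rw [gradient_obj h, gradient_obj h, avg, avg, ← smul_sub, ← Finset.sum_sub_distrib, norm_smul,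
    Real.norm_eq_abs, abs_of_pos (inv_pos.2 hn'), inv_mul_le_iff₀ hn']
  refine (norm_sum_le _ _).trans ((Finset.sum_le_sum fun i _ => h.lipschitz i x y).trans ?_)
  simp

theorem fStar_le (h : S.SmoothAssumption L) (x : Vec S.p) : S.fStar ≤ S.obj x :=
  ciInf_le h.bddBelow x

theorem norm_gradient_obj_sq_le (h : S.SmoothAssumption L) (hL : 0 < L) (hn : 0 < S.n)
    (x : Vec S.p) : ‖gradient S.obj x‖ ^ 2 ≤ 2 * L * (S.obj x - S.fStar) :=
  norm_gradient_sq_le hL (differentiable_obj h) (lipschitz_gradient_obj h hn) (fStar_le h) x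

/-- The average objective value is controlled by the value at the average and the consensus
error. -/
theorem avg_obj_le (h : S.SmoothAssumption L) (hn : 0 < S.n) (a : Stack S.n S.p) :
    (S.n : ℝ)⁻¹ * ∑ i, S.obj (a i) ≤ S.obj (avg a) + L / 2 * ((S.n : ℝ)⁻¹ * frobSq (proj a)) := by
  have hn' : (0 : ℝ) < S.n := Nat.cast_pos.2 hn
  have h1 : ∀ i, S.obj (a i) ≤ S.obj (avg a) + inner ℝ (gradient S.obj (avg a)) (proj a i)
      + L / 2 * ‖proj a i‖ ^ 2 := fun i => by
    have := descent_lemma (differentiable_obj h) (lipschitz_gradient_obj h hn) (avg a) (proj a i)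
    simpa [proj] using this
  -- Deviations from the mean sum to zero, so the first-order terms cancel and only the quadratic
  -- one survives.
  have h2 : ∑ i, proj a i = 0 := by
    simp only [proj, Finset.sum_sub_distrib, Finset.sum_const, Finset.card_univ, Fintype.card_fin,
      avg]
    rw [← Nat.cast_smul_eq_nsmul ℝ, smul_smul, mul_inv_cancel₀ hn'.ne', one_smul, sub_self]
  have h3 := Finset.sum_le_sum fun i (_ : i ∈ Finset.univ) => h1 i
  rw [Finset.sum_add_distrib, Finset.sum_add_distrib, ← inner_sum, h2, inner_zero_right,
    ← Finset.mul_sum, Finset.sum_const, Finset.card_univ, Fintype.card_fin, nsmul_eq_mul] at h3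
  rw [inv_mul_le_iff₀ hn']
  refine h3.trans (le_of_eq ?_)
  rw [frobSq]
  field_simp
  ring

end Setup


/-! ### Linear algebra of stacked variables. -/

section Stack

variable {n p : ℕ}

theorem avg_add (a b : Stack n p) : avg (a + b) = avg a + avg b := by
  simp [avg, Finset.sum_add_distrib]

theorem avg_sub (a b : Stack n p) : avg (a - b) = avg a - avg b := by
  simp [avg, Finset.sum_sub_distrib, smul_sub]

theorem avg_smul (r : ℝ) (a : Stack n p) : avg (r • a) = r • avg a := by
  simp only [avg, Pi.smul_apply, ← Finset.smul_sum]
  exact smul_comm _ _ _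

theorem avg_zero : avg (0 : Stack n p) = 0 := by simp [avg]

theorem card_smul_avg (hn : 0 < n) (a : Stack n p) : (n : ℝ) • avg a = ∑ i, a i := by
  rw [avg, smul_smul, mul_inv_cancel₀ (Nat.cast_pos.2 hn).ne', one_smul]

theorem proj_add (a b : Stack n p) : proj (a + b) = proj a + proj b := by
  funext i; simp only [proj, avg_add, Pi.add_apply]; abel

theorem proj_sub (a b : Stack n p) : proj (a - b) = proj a - proj b := by
  funext i; simp only [proj, avg_sub, Pi.sub_apply]; abel

theorem proj_smul (r : ℝ) (a : Stack n p) : proj (r • a) = r • proj a := by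
  funext i; simp only [proj, avg_smul, Pi.smul_apply, smul_sub]

theorem proj_zero : proj (0 : Stack n p) = 0 := by
  funext i; simp [proj, avg_zero]

theorem frobSq_nonneg (a : Stack n p) : 0 ≤ frobSq a :=
  Finset.sum_nonneg fun _ _ => sq_nonneg _

theorem frobSq_smul (r : ℝ) (a : Stack n p) : frobSq (r • a) = r ^ 2 * frobSq a := by
  simp [frobSq, norm_smul, mul_pow, Finset.mul_sum]

theorem frobSq_add_le (a b : Stack n p) : frobSq (a + b) ≤ 2 * frobSq a + 2 * frobSq b := by
  simp only [frobSq, Finset.mul_sum, ← Finset.sum_add_distrib, Pi.add_apply]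
  refine Finset.sum_le_sum fun i _ => ?_
  have := parallelogram_law_with_norm ℝ (a i) (b i)
  nlinarith [mul_self_nonneg ‖a i - b i‖]

theorem frobSq_proj (hn : 0 < n) (a : Stack n p) :
    frobSq (proj a) = frobSq a - n * ‖avg a‖ ^ 2 := by
  have h : ∀ i, ‖proj a i‖ ^ 2 = ‖a i‖ ^ 2 - 2 * inner ℝ (a i) (avg a) + ‖avg a‖ ^ 2 :=
    fun i => norm_sub_sq_real _ _
  simp only [frobSq, h, Finset.sum_add_distrib, Finset.sum_sub_distrib, ← Finset.mul_sum,
    ← sum_inner, ← card_smul_avg hn a, inner_smul_left, real_inner_self_eq_norm_sq]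
  simp
  ring

theorem frobSq_proj_le (hn : 0 < n) (a : Stack n p) : frobSq (proj a) ≤ frobSq a := by
  rw [frobSq_proj hn]
  nlinarith [sq_nonneg ‖avg a‖, (Nat.cast_pos (α := ℝ)).2 hn]

theorem card_mul_norm_avg_sq_le (hn : 0 < n) (a : Stack n p) : n * ‖avg a‖ ^ 2 ≤ frobSq a := by
  linarith [frobSq_proj hn a, frobSq_nonneg (proj a)]

theorem mix_add (W : Matrix (Fin n) (Fin n) ℝ) (a b : Stack n p) :
    mix W (a + b) = mix W a + mix W b := by
  funext i; simp [mix, Finset.sum_add_distrib]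

theorem mix_sub (W : Matrix (Fin n) (Fin n) ℝ) (a b : Stack n p) :
    mix W (a - b) = mix W a - mix W b := by
  funext i; simp [mix, Finset.sum_sub_distrib, smul_sub]

theorem mix_smul (W : Matrix (Fin n) (Fin n) ℝ) (r : ℝ) (a : Stack n p) :
    mix W (r • a) = r • mix W a := by
  funext i
  simp only [mix, Pi.smul_apply, Finset.smul_sum]
  exact Finset.sum_congr rfl fun j _ => smul_comm _ _ _

theorem mix_mix (A B : Matrix (Fin n) (Fin n) ℝ) (a : Stack n p) :
    mix A (mix B a) = mix (A * B) a := by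
  funext i
  simp only [mix, Finset.smul_sum, Matrix.mul_apply, Finset.sum_smul, smul_smul]
  exact Finset.sum_comm

/-- Orthogonal matrices preserve the Frobenius norm. -/
theorem frobSq_mix_of_orthogonal {U : Matrix (Fin n) (Fin n) ℝ} (hU : Uᵀ * U = 1)
    (a : Stack n p) : frobSq (mix U a) = frobSq a := by
  have h1 : ∀ i j, ∑ m, U m i * U m j = if i = j then 1 else 0 := fun i j => by
    have := congrFun (congrFun hU i) j
    simpa [Matrix.mul_apply, Matrix.one_apply] using this
  have h2 : ∀ m, ‖mix U a m‖ ^ 2 = ∑ i, ∑ j, (U m i * U m j) * inner ℝ (a i) (a j) := fun m => by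
    rw [← real_inner_self_eq_norm_sq, mix, sum_inner]
    refine Finset.sum_congr rfl fun i _ => ?_
    rw [inner_sum]
    refine Finset.sum_congr rfl fun j _ => ?_
    rw [inner_smul_left, inner_smul_right, conj_trivial]
    ring
  simp only [frobSq, h2]
  rw [Finset.sum_comm]
  refine Finset.sum_congr rfl fun i _ => ?_
  rw [Finset.sum_comm]
  simp only [← Finset.sum_mul, h1]
  simp

end Stack

/-! ### Accelerated gossip on a single mode. -/

section Energy

variable {E : Type*} [NormedAddCommGroup E] [InnerProductSpace ℝ E]

/-- Convexity of the squared norm. -/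
theorem norm_add_sq_le_div {E : Type*} [SeminormedAddCommGroup E] {s : ℝ} (h0 : 0 < s)
    (h1 : s < 1) (x y : E) :
    ‖x + y‖ ^ 2 ≤ ‖x‖ ^ 2 / s + ‖y‖ ^ 2 / (1 - s) := by
  have h1' : 0 < 1 - s := sub_pos.2 h1
  rw [div_add_div _ _ h0.ne' h1'.ne', le_div_iff₀ (mul_pos h0 h1')]
  have h2 := sq_nonneg ((1 - s) * ‖x‖ - s * ‖y‖)
  have h3 := norm_add_le x y
  have h4 : ‖x + y‖ ^ 2 ≤ (‖x‖ + ‖y‖) ^ 2 := pow_le_pow_left₀ (norm_nonneg _) h3 2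
  nlinarith [mul_le_mul_of_nonneg_right h4 (mul_pos h0 h1').le]

/-- The quadratic form that the companion matrix of `z² - 2τz + η` scales by `η`. -/
noncomputable def modeEnergy (η τ : ℝ) (a b : E) : ℝ :=
  η / (η - τ ^ 2) * (‖a - τ • b‖ ^ 2 + (η - τ ^ 2) * ‖b‖ ^ 2)

variable {η τ : ℝ}

/-- Up to its prefactor the form is `‖a‖² - 2τ⟨a,b⟩ + η‖b‖²`, in the scalar case `|a - zb|²` for a
root `z` of the characteristic polynomial. One step multiplies this eigencoordinate by a root, and
`|z|² = η`. -/
theorem modeEnergy_step (a b : E) :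
    modeEnergy η τ ((2 * τ) • a - η • b) a = η * modeEnergy η τ a b := by
  have h : (2 * τ) • a - η • b - τ • a = τ • a - η • b := by
    rw [two_mul, add_smul]; abel
  simp only [modeEnergy, h, norm_sub_sq_real, norm_smul, inner_smul_left, inner_smul_right,
    mul_pow, Real.norm_eq_abs, sq_abs, conj_trivial]
  ring

/-- After multiplication by `η - τ²` the difference of the two sides is the square `‖τa - ηb‖²`. The
prefactor `η/(η-τ²)` is chosen for this. -/
theorem norm_sq_le_modeEnergy (hτ : 0 < η - τ ^ 2) (a b : E) :
    ‖a‖ ^ 2 ≤ modeEnergy η τ a b := by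
  have h : 0 ≤ ‖τ • a - η • b‖ ^ 2 := sq_nonneg _
  rw [modeEnergy, div_mul_eq_mul_div, le_div_iff₀ hτ]
  simp only [norm_sub_sq_real, norm_smul, inner_smul_left, inner_smul_right,
    mul_pow, Real.norm_eq_abs, sq_abs, conj_trivial] at h ⊢
  nlinarith

/-- On the diagonal the energy is `η(1+η-2τ)/(η-τ²)` times `‖u‖²`, so `h2` says precisely that this
ratio is at most 2. -/
theorem modeEnergy_self_le (hτ : 0 < η - τ ^ 2)
    (h2 : η * (1 + η - 2 * τ) ≤ 2 * (η - τ ^ 2)) (u : E) :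
    modeEnergy η τ u u ≤ 2 * ‖u‖ ^ 2 := by
  rw [modeEnergy, div_mul_eq_mul_div, div_le_iff₀ hτ]
  simp only [norm_sub_sq_real, norm_smul, inner_smul_right,
    mul_pow, Real.norm_eq_abs, sq_abs, real_inner_self_eq_norm_sq]
  nlinarith [sq_nonneg ‖u‖]

theorem modeEnergy_add_le (hη : 0 ≤ η) (hτ : 0 < η - τ ^ 2) {s : ℝ} (h0 : 0 < s) (h1 : s < 1)
    (a b a' b' : E) :
    modeEnergy η τ (a + a') (b + b') ≤ modeEnergy η τ a b / s + modeEnergy η τ a' b' / (1 - s) := by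
  have e1 : a + a' - τ • (b + b') = (a - τ • b) + (a' - τ • b') := by rw [smul_add]; abel
  have i1 := norm_add_sq_le_div h0 h1 (a - τ • b) (a' - τ • b')
  have i2 := mul_le_mul_of_nonneg_left (norm_add_sq_le_div h0 h1 b b') hτ.le
  have i3 := mul_le_mul_of_nonneg_left (add_le_add i1 i2) (div_nonneg hη hτ.le)
  simp only [modeEnergy, e1]
  refine i3.trans (le_of_eq ?_)
  ring

end Energy

/-- The modes of the accelerated gossip matrix are uniformly bounded. -/
theorem chebyshev_mode_bound {lam w : ℝ} (hlam : lam < 1) (hw0 : 0 ≤ w) (hw : w ≤ lam) :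
    let η := 1 / (1 + Real.sqrt (1 - lam ^ 2))
    let τ := (1 + η) * w / 2
    0 < η - τ ^ 2 ∧ η * (1 + η - 2 * τ) ≤ 2 * (η - τ ^ 2) := by
  intro η τ
  have hl0 : 0 ≤ lam := hw0.trans hw
  set s := Real.sqrt (1 - lam ^ 2) with hs
  have hs0 : 0 ≤ s := Real.sqrt_nonneg _
  have hs2 : s ^ 2 = 1 - lam ^ 2 := Real.sq_sqrt (by nlinarith)
  have hs1 : s ≤ 1 := by nlinarith [sq_nonneg lam]
  have hη : η = 1 / (1 + s) := rfl
  have hη0 : 0 < η := by rw [hη]; positivity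
  have hηs : η * (1 + s) = 1 := by rw [hη]; field_simp
  have hlam' : lam ≤ 1 - s ^ 2 / 2 := by nlinarith [sq_nonneg (lam - 1)]
  set u := (2 + s) * w with hu
  have hu0 : 0 ≤ u := by positivity
  have huU : u ≤ 2 + s - s ^ 2 := by
    have : u ≤ (2 + s) * (1 - s ^ 2 / 2) := by rw [hu]; gcongr; linarith
    nlinarith [pow_nonneg hs0 3]
  -- After multiplication by `(1+s)²` and with `u = (2+s)w`, the inequality `key` becomes this one.
  -- It is concave in `u`, so it suffices to look at `u = 0` and at the upper bound `2+s-s²`, where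
  -- the value is `s²(1/2 + s(1-s/2))`.
  have hg : 0 ≤ s + u - u ^ 2 / 2 := by
    have hU : 0 ≤ s + (2 + s - s ^ 2) - (2 + s - s ^ 2) ^ 2 / 2 := by
      have : s + (2 + s - s ^ 2) - (2 + s - s ^ 2) ^ 2 / 2
          = s ^ 2 * (1 / 2 + s * (1 - s / 2)) := by ring
      rw [this]
      have : 0 ≤ 1 - s / 2 := by linarith
      positivity
    rcases le_total 2 (u + (2 + s - s ^ 2)) with h | h
    · nlinarith [mul_nonneg (sub_nonneg.2 huU) (sub_nonneg.2 h)]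
    · nlinarith
  have hτ : τ * (2 * (1 + s)) = u := by
    have : (1 + η) * (1 + s) = 2 + s := by linear_combination hηs
    rw [hu, ← this]
    simp only [τ]
    ring
  have hs1' : (0 : ℝ) < (1 + s) ^ 2 := by positivity
  have key : η * (1 + η - 2 * τ) ≤ 2 * (η - τ ^ 2) := by
    refine le_of_mul_le_mul_right ?_ hs1'
    have e1 : 2 * (η - τ ^ 2) * (1 + s) ^ 2 = 2 * (1 + s) - u ^ 2 / 2 := by
      rw [← hτ]; linear_combination 2 * (1 + s) * hηs
    have e2 : η * (1 + η - 2 * τ) * (1 + s) ^ 2 = 2 + s - u := by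
      rw [← hτ]
      linear_combination (η * (1 + s) + 1 - 2 * τ * (1 + s) + (1 + s)) * hηs
    rw [e1, e2]
    linarith
  refine ⟨?_, key⟩
  -- Non-real roots come for free from `key`: its left side is `η(1+η)(1-w) > 0`.
  have hw1 : w < 1 := hw.trans_lt hlam
  have : 0 < η * (1 + η - 2 * τ) := by
    have : 1 + η - 2 * τ = (1 + η) * (1 - w) := by simp only [τ]; ring
    rw [this]
    have := sub_pos.2 hw1
    positivity
  linarith

/-! ### From single modes to the network: diagonalisation and the gossip energy. -/

section Gossip

variable {n p : ℕ} {W : Matrix (Fin n) (Fin n) ℝ}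

theorem avg_mix (hsym : Wᵀ = W) (hst : ∀ i, ∑ j, W i j = 1) (a : Stack n p) :
    avg (mix W a) = avg a := by
  have hcol : ∀ j, ∑ i, W i j = 1 := fun j => by
    rw [← hst j]
    exact Finset.sum_congr rfl fun i _ => congrFun (congrFun hsym j) i
  simp only [avg, mix]
  rw [Finset.sum_comm]
  simp only [← Finset.sum_smul, hcol, one_smul]

/-- `W` fixes constant stacks and preserves averages, and `𝟏𝟏ᵀ/n` kills mean-zero stacks. -/
theorem proj_mix (hsym : Wᵀ = W) (hst : ∀ i, ∑ j, W i j = 1) (hn : 0 < n) (a : Stack n p) :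
    proj (mix W a) = mix (W - Matrix.of fun _ _ => (n : ℝ)⁻¹) (proj a) := by
  have hn' : (n : ℝ) ≠ 0 := (Nat.cast_pos.2 hn).ne'
  funext i
  have h : ∑ _j : Fin n, (n : ℝ)⁻¹ = 1 := by simp [hn']
  change mix W a i - avg (mix W a) = ∑ j, (W i j - (n : ℝ)⁻¹) • (a j - avg a)
  simp only [sub_smul, smul_sub, Finset.sum_sub_distrib, ← Finset.sum_smul, hst, h,
    ← Finset.smul_sum, one_smul, avg_mix hsym hst, sub_self, sub_zero]
  rfl

/-- With `J = 𝟏𝟏ᵀ/n`, the identities `WJ = JW = J = J²` give `W - J = (1-J) W (1-J)`, a congruence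
of a positive semidefinite matrix. -/
theorem posSemidef_sub_avg (hsym : Wᵀ = W) (hst : ∀ i, ∑ j, W i j = 1) (hn : 0 < n)
    (hW : W.PosSemidef) : (W - Matrix.of fun _ _ => (n : ℝ)⁻¹).PosSemidef := by
  have hn' : (n : ℝ) ≠ 0 := (Nat.cast_pos.2 hn).ne'
  set J : Matrix (Fin n) (Fin n) ℝ := Matrix.of fun _ _ => (n : ℝ)⁻¹ with hJ
  have hWJ : W * J = J := by
    ext i j
    simp [hJ, Matrix.mul_apply, ← Finset.sum_mul, hst]
  have hJJ : J * J = J := by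
    ext i j
    simp [hJ, Matrix.mul_apply, hn']
  have hJt : Jᵀ = J := by ext i j; simp [hJ]
  have hJW : J * W = J := by
    have := congrArg Matrix.transpose hWJ
    rwa [Matrix.transpose_mul, hsym, hJt] at this
  have h := hW.conjTranspose_mul_mul_same (1 - J)
  have e : (1 - J)ᴴ = 1 - J := by
    rw [Matrix.conjTranspose_sub, Matrix.conjTranspose_one,
      Matrix.conjTranspose_eq_transpose_of_trivial,
      hJt]
  rw [e, Matrix.sub_mul, Matrix.one_mul, hJW, Matrix.mul_sub, Matrix.mul_one, Matrix.sub_mul, hWJ,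
    hJJ, sub_self, sub_zero] at h
  exact h

/-- `U` is the transposed matrix of eigenvectors; the upper bound on `w m` is the operator norm
tested on a unit eigenvector. Nonnegativity and the bound by the norm are what
`chebyshev_mode_bound` asks of each mode. -/
theorem exists_orthogonal_diagonalization {M : Matrix (Fin n) (Fin n) ℝ} (hM : M.PosSemidef) :
    ∃ (U : Matrix (Fin n) (Fin n) ℝ) (w : Fin n → ℝ), Uᵀ * U = 1 ∧
      U * M = Matrix.diagonal w * U ∧
      ∀ m, 0 ≤ w m ∧ w m ≤ ‖Matrix.toEuclideanCLM (n := Fin n) (𝕜 := ℝ) M‖ := by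
  have hH := hM.isHermitian
  set V : Matrix (Fin n) (Fin n) ℝ := ↑hH.eigenvectorUnitary
  have hVt : star V = Vᵀ := by
    rw [Matrix.star_eq_conjTranspose, Matrix.conjTranspose_eq_transpose_of_trivial]
  have hV : V * Vᵀ = 1 := by rw [← hVt]; exact Unitary.coe_mul_star_self _
  refine ⟨Vᵀ, hH.eigenvalues, by rw [Matrix.transpose_transpose, hV], ?_, fun m => ⟨?_, ?_⟩⟩
  · have h := hH.conjStarAlgAut_star_eigenvectorUnitary
    rw [Unitary.conjStarAlgAut_star_apply] at h
    have h2 := congrArg (· * Vᵀ) h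
    simp only [Matrix.mul_assoc] at h2
    change star V * (M * (V * Vᵀ)) = _ at h2
    rw [hV, Matrix.mul_one, hVt] at h2
    exact h2
  · exact hM.eigenvalues_nonneg m
  · have h := hH.mulVec_eigenvectorBasis m
    have h2 : Matrix.toEuclideanCLM (n := Fin n) (𝕜 := ℝ) M (hH.eigenvectorBasis m)
        = hH.eigenvalues m • hH.eigenvectorBasis m := by
      apply (WithLp.equiv 2 _).injective
      exact h
    have h3 := (Matrix.toEuclideanCLM (n := Fin n) (𝕜 := ℝ) M).le_opNorm (hH.eigenvectorBasis m)
    rw [h2, norm_smul, hH.eigenvectorBasis.orthonormal.1 m, mul_one, mul_one] at h3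
    exact (le_abs_self _).trans h3

/-- A convex energy that controls the consensus error and contracts under one step of accelerated
gossip. -/
theorem exists_gossip_energy (p : ℕ) (hsym : Wᵀ = W) (hst : ∀ i, ∑ j, W i j = 1) (hn : 0 < n)
    (hW : W.PosSemidef) (hlam : specNorm W < 1) :
    ∃ Φ : Stack n p → Stack n p → ℝ, (∀ a b, frobSq (proj a) ≤ Φ a b) ∧
      (∀ u, Φ u u ≤ 2 * frobSq (proj u)) ∧
      (∀ a b, Φ ((1 + etaW W) • mix W a - etaW W • b) a = etaW W * Φ a b) ∧
      ∀ s : ℝ, 0 < s → s < 1 → ∀ a b a' b',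
        Φ (a + a') (b + b') ≤ Φ a b / s + Φ a' b' / (1 - s) := by
  obtain ⟨U, w, hU, hUM, hw⟩ := exists_orthogonal_diagonalization
    (posSemidef_sub_avg hsym hst hn hW)
  have hproj : ∀ a : Stack n p,
      proj (mix W a) = mix (W - Matrix.of fun _ _ => (n : ℝ)⁻¹) (proj a) :=
    proj_mix hsym hst hn
  set M := W - Matrix.of fun _ _ => (n : ℝ)⁻¹
  set η := etaW W with hη
  have hη0 : 0 ≤ η := by rw [hη, etaW]; positivity
  have hb : ∀ m, 0 < η - ((1 + η) * w m / 2) ^ 2 ∧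
      η * (1 + η - 2 * ((1 + η) * w m / 2)) ≤ 2 * (η - ((1 + η) * w m / 2) ^ 2) := fun m =>
    chebyshev_mode_bound hlam (hw m).1 (hw m).2
  have hmode : ∀ (a : Stack n p) m, mix U (mix M a) m = w m • mix U a m := fun a m => by
    rw [mix_mix, hUM, ← mix_mix]
    simp [mix, Matrix.diagonal_apply, ite_smul]
  -- The energy is summed over the eigencoordinates of the mean-free parts. A mode with eigenvalue
  -- `w` has `τ = (1+η)w/2`, half the trace of its companion matrix.
  refine ⟨fun a b => ∑ m, modeEnergy η ((1 + η) * w m / 2) (mix U (proj a) m) (mix U (proj b) m),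
    fun a b => ?_, fun u => ?_, fun a b => ?_, fun s h0 h1 a b a' b' => ?_⟩
  · rw [← frobSq_mix_of_orthogonal hU]
    exact Finset.sum_le_sum fun m _ => norm_sq_le_modeEnergy (hb m).1 _ _
  · rw [← frobSq_mix_of_orthogonal hU, frobSq, Finset.mul_sum]
    exact Finset.sum_le_sum fun m _ => modeEnergy_self_le (hb m).1 (hb m).2 _
  · rw [Finset.mul_sum]
    refine Finset.sum_congr rfl fun m _ => ?_
    rw [← modeEnergy_step, proj_sub, proj_smul, proj_smul, hproj, mix_sub, mix_smul,
      mix_smul]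
    simp only [Pi.sub_apply, Pi.smul_apply, hmode, smul_smul]
    rw [show 2 * ((1 + η) * w m / 2) = (1 + η) * w m by ring]
  · rw [Finset.sum_div, Finset.sum_div, ← Finset.sum_add_distrib]
    refine Finset.sum_le_sum fun m _ => ?_
    rw [proj_add, proj_add, mix_add, mix_add]
    exact modeEnergy_add_le hη0 (hb m).1 h0 h1 _ _ _ _

end Gossip


/-! ### Adaptedness and square integrability of the iterates. -/

/-- Square integrable random vectors that are measurable with respect to a sub-σ-algebra. -/
structure AdaptedL2 {Ω E : Type*} [NormedAddCommGroup E] (m : MeasurableSpace Ω)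
    {mΩ : MeasurableSpace Ω} (P : Measure Ω) (X : Ω → E) : Prop where
  stronglyMeasurable : StronglyMeasurable[m] X
  memLp : MemLp X 2 P

namespace AdaptedL2

variable {Ω E F : Type*} [NormedAddCommGroup E] [NormedAddCommGroup F] {m m' : MeasurableSpace Ω}
  {mΩ : MeasurableSpace Ω} {P : Measure Ω} {X Y : Ω → E}

theorem mono (h : AdaptedL2 m P X) (hm : m ≤ m') : AdaptedL2 m' P X :=
  ⟨h.1.mono hm, h.2⟩

theorem add (hX : AdaptedL2 m P X) (hY : AdaptedL2 m P Y) :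
    AdaptedL2 m P fun ω => X ω + Y ω := ⟨hX.1.add hY.1, hX.2.add hY.2⟩

theorem sub (hX : AdaptedL2 m P X) (hY : AdaptedL2 m P Y) :
    AdaptedL2 m P fun ω => X ω - Y ω := ⟨hX.1.sub hY.1, hX.2.sub hY.2⟩

theorem const_smul [NormedSpace ℝ E] (hX : AdaptedL2 m P X) (r : ℝ) :
    AdaptedL2 m P fun ω => r • X ω := ⟨hX.1.const_smul r, hX.2.const_smul r⟩

theorem const [IsFiniteMeasure P] (c : E) : AdaptedL2 m P fun _ : Ω => c :=
  ⟨stronglyMeasurable_const, memLp_const c⟩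

theorem sum {ι : Type*} {s : Finset ι} {X : ι → Ω → E} (h : ∀ i ∈ s, AdaptedL2 m P (X i)) :
    AdaptedL2 m P fun ω => ∑ i ∈ s, X i ω :=
  ⟨Finset.stronglyMeasurable_fun_sum s fun i hi => (h i hi).1,
    memLp_finsetSum s fun i hi => (h i hi).2⟩

/-- A Lipschitz map has linear growth, `‖G x‖ ≤ ‖G 0‖ + L‖x‖`. This is how gradients along the
iterates inherit square integrability. -/
theorem comp_lipschitz [IsFiniteMeasure P] {G : E → F} {L : ℝ}
    (hG : ∀ x y, ‖G x - G y‖ ≤ L * ‖x - y‖) (hX : AdaptedL2 m P X) (hm : m ≤ mΩ) :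
    AdaptedL2 m P fun ω => G (X ω) := by
  have hc : Continuous G := by
    refine (LipschitzWith.of_dist_le' (K := L) fun x y => ?_).continuous
    simpa [dist_eq_norm] using hG x y
  have hsm := hc.comp_stronglyMeasurable hX.1
  refine ⟨hsm, ((memLp_const (G 0)).norm.add (hX.2.norm.const_mul L)).mono
    (hsm.mono hm).aestronglyMeasurable (Filter.Eventually.of_forall fun ω => ?_)⟩
  have h1 := hG (X ω) 0
  have h2 := norm_sub_norm_le (G (X ω)) (G 0)
  rw [sub_zero] at h1
  simp only [Pi.add_apply]
  exact le_trans (by linarith) (le_abs_self _)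

end AdaptedL2

namespace Setup

set_option linter.unusedSectionVars false

variable {Ω Ξ : Type*} [mΩ : MeasurableSpace Ω] [MeasurableSpace Ξ] {S : Setup Ω Ξ}
  {P : Measure Ω} {σ L : ℝ}

theorem history_le (ho : S.OracleAssumption P σ) (t ℓ : ℕ) : S.history t ℓ ≤ mΩ :=
  iSup_le fun i => iSup_le fun t' => iSup_le fun ℓ' => iSup_le fun _ => iSup_le fun _ =>
    (ho.measurable_sample i t' ℓ').comap_le

theorem history_mono {t ℓ t₁ ℓ₁ : ℕ}
    (h : ∀ t' ℓ', ℓ' < S.Q → t' < t ∨ (t' = t ∧ ℓ' < ℓ) → t' < t₁ ∨ (t' = t₁ ∧ ℓ' < ℓ₁)) :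
    S.history t ℓ ≤ S.history t₁ ℓ₁ := by
  refine iSup_mono fun i => iSup_mono fun t' => iSup_mono fun ℓ' => iSup_mono fun hQ => ?_
  exact iSup_mono' fun h1 => ⟨h t' ℓ' hQ h1, le_rfl⟩

theorem history_mono_step (t : ℕ) {ℓ ℓ₁ : ℕ} (h : ℓ ≤ ℓ₁) : S.history t ℓ ≤ S.history t ℓ₁ :=
  history_mono fun _ _ _ h1 => by omega

theorem history_le_succ (t ℓ : ℕ) : S.history t ℓ ≤ S.history (t + 1) 0 :=
  history_mono fun _ _ _ h1 => by omega

theorem measurable_sample_history (i : Fin S.n) (t : ℕ) {ℓ : ℕ} (h : ℓ < S.Q) :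
    Measurable[S.history t (ℓ + 1)] (S.ξ i t ℓ) := by
  refine measurable_iff_comap_le.2 ?_
  exact le_iSup_of_le i <| le_iSup_of_le t <| le_iSup_of_le ℓ <| le_iSup_of_le h <|
    le_iSup_of_le (Or.inr ⟨rfl, ℓ.lt_succ_self⟩) le_rfl

/-- The deviation of a stochastic gradient from the gradient. -/
noncomputable def noise (S : Setup Ω Ξ) (t ℓ : ℕ) (i : Fin S.n) (ω : Ω) : Vec S.p :=
  S.stochGrad t ℓ i ω - gradient (S.f i) (S.localIter t ℓ i ω)

variable [IsProbabilityMeasure P]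

theorem stronglyMeasurable_stochGrad (ho : S.OracleAssumption P σ) {t ℓ : ℕ} {i : Fin S.n}
    (hℓ : ℓ < S.Q) (hX : AdaptedL2 (S.history t ℓ) P (S.localIter t ℓ i)) :
    StronglyMeasurable[S.history t (ℓ + 1)] (S.stochGrad t ℓ i) := by
  have h1 : Measurable[S.history t (ℓ + 1)] (S.localIter t ℓ i) :=
    (hX.1.mono (history_mono_step t ℓ.le_succ)).measurable
  have h2 : Measurable[S.history t (ℓ + 1)] (S.stochGrad t ℓ i) :=
    (ho.measurable_oracle i).comp (h1.prodMk (measurable_sample_history i t hℓ))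
  exact h2.stronglyMeasurable

theorem adaptedL2_gradient (ho : S.OracleAssumption P σ) (hs : S.SmoothAssumption L) {t ℓ : ℕ}
    {i : Fin S.n} {X : Ω → Vec S.p} (hX : AdaptedL2 (S.history t ℓ) P X) :
    AdaptedL2 (S.history t ℓ) P fun ω => gradient (S.f i) (X ω) :=
  hX.comp_lipschitz (hs.lipschitz i) (history_le ho t ℓ)

theorem adaptedL2_noise_of (ho : S.OracleAssumption P σ) (hs : S.SmoothAssumption L) {t ℓ : ℕ}
    {i : Fin S.n} (hℓ : ℓ < S.Q) (hX : AdaptedL2 (S.history t ℓ) P (S.localIter t ℓ i)) :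
    AdaptedL2 (S.history t (ℓ + 1)) P (S.noise t ℓ i) := by
  have h1 := stronglyMeasurable_stochGrad ho hℓ hX
  have h2 := (adaptedL2_gradient (i := i) ho hs hX).mono (history_mono_step t ℓ.le_succ)
  refine ⟨h1.sub h2.1, ?_⟩
  exact (memLp_two_iff_integrable_sq_norm
    ((h1.sub h2.1).mono (history_le ho _ _)).aestronglyMeasurable).2 (ho.integrable_sq i t ℓ hℓ)

theorem adaptedL2_stochGrad_of (ho : S.OracleAssumption P σ) (hs : S.SmoothAssumption L) {t ℓ : ℕ}
    {i : Fin S.n} (hℓ : ℓ < S.Q) (hX : AdaptedL2 (S.history t ℓ) P (S.localIter t ℓ i)) :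
    AdaptedL2 (S.history t (ℓ + 1)) P (S.stochGrad t ℓ i) := by
  have h1 := (adaptedL2_noise_of ho hs hℓ hX).add
    ((adaptedL2_gradient (i := i) ho hs hX).mono (history_mono_step t ℓ.le_succ))
  simpa [noise] using h1

theorem adaptedL2_localIter_of (ho : S.OracleAssumption P σ) (hs : S.SmoothAssumption L) {t : ℕ}
    {i : Fin S.n} (hx : AdaptedL2 (S.history t 0) P fun ω => (S.state ω t).x i)
    (hc : AdaptedL2 (S.history t 0) P fun ω => (S.state ω t).c i) :
    ∀ ℓ ≤ S.Q, AdaptedL2 (S.history t ℓ) P (S.localIter t ℓ i)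
  | 0, _ => hx
  | ℓ + 1, h => by
    have ih := adaptedL2_localIter_of ho hs hx hc ℓ (Nat.le_of_succ_le h)
    exact (ih.mono (history_mono_step t ℓ.le_succ)).sub
      (((adaptedL2_stochGrad_of ho hs h ih).add
        (hc.mono (history_mono_step t (ℓ + 1).zero_le))).const_smul
        S.ηa)

/-- The state at the beginning of a round is square integrable and determined by the past. -/
theorem adaptedL2_state (ho : S.OracleAssumption P σ) (hs : S.SmoothAssumption L) (t : ℕ) :
    (∀ i, AdaptedL2 (S.history t 0) P fun ω => (S.state ω t).x i) ∧
    (∀ i, AdaptedL2 (S.history t 0) P fun ω => (S.state ω t).xl i) ∧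
    (∀ i, AdaptedL2 (S.history t 0) P fun ω => (S.state ω t).z i) ∧
    (∀ i, AdaptedL2 (S.history t 0) P fun ω => (S.state ω t).c i) ∧
    ∀ i, AdaptedL2 (S.history t 0) P fun ω => (S.state ω t).cPrev i := by
  induction t with
  | zero =>
    exact ⟨fun i => .const _, fun i => .const _, fun i => .const _, fun i => .const _,
      fun i => .const _⟩
  | succ t ih =>
    obtain ⟨hx, hxl, hz, hc, hcp⟩ := ih
    have hm : S.history t 0 ≤ S.history (t + 1) 0 := history_le_succ t 0
    have hloc : ∀ i, AdaptedL2 (S.history (t + 1) 0) P (S.localIter t S.Q i) := fun i =>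
      (adaptedL2_localIter_of ho hs (hx i) (hc i) S.Q le_rfl).mono (history_le_succ t _)
    have hz' : ∀ i, AdaptedL2 (S.history (t + 1) 0) P fun ω => (S.state ω (t + 1)).z i := fun i =>
      (((hz i).mono hm).const_smul S.β).add ((((((hx i).mono hm).sub (hloc i)).const_smul
        (1 / (S.ηa * S.Q))).sub ((hc i).mono hm)).const_smul (1 - S.β))
    have hy : ∀ i, AdaptedL2 (S.history (t + 1) 0) P
        fun ω => S.yVar (S.samples t ω) (S.state ω t) i := fun i => (hz' i).add ((hc i).mono hm)
    have hyl : ∀ i, AdaptedL2 (S.history (t + 1) 0) P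
        fun ω => S.ylVar (S.samples t ω) (S.state ω t) i := fun i =>
      (hz' i).add ((hcp i).mono hm)
    refine ⟨fun i => ?_, fun i => ?_, hz', fun i => ?_, fun i => (hc i).mono hm⟩
    · exact ((AdaptedL2.sum fun j _ => (((hx j).mono hm).sub ((hy j).const_smul
        (S.Q * S.ηs * S.ηa))).const_smul (S.W i j)).const_smul (1 + etaW S.W)).sub
        ((((hxl i).mono hm).sub ((hy i).const_smul (S.Q * S.ηs * S.ηa))).const_smul (etaW S.W))
    · exact ((hx i).mono hm).sub ((hy i).const_smul (S.Q * S.ηs * S.ηa))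
    · exact ((((hc i).mono hm).sub (hy i)).add ((AdaptedL2.sum fun j _ =>
        (hy j).const_smul (S.W i j)).const_smul (1 + etaW S.W))).sub
        ((hyl i).const_smul (etaW S.W))

theorem adaptedL2_localIter (ho : S.OracleAssumption P σ) (hs : S.SmoothAssumption L) (t : ℕ)
    (i : Fin S.n) {ℓ : ℕ} (hℓ : ℓ ≤ S.Q) : AdaptedL2 (S.history t ℓ) P (S.localIter t ℓ i) :=
  adaptedL2_localIter_of ho hs ((adaptedL2_state ho hs t).1 i)
    ((adaptedL2_state ho hs t).2.2.2.1 i) ℓ hℓ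

theorem adaptedL2_noise (ho : S.OracleAssumption P σ) (hs : S.SmoothAssumption L) (t : ℕ)
    (i : Fin S.n) {ℓ : ℕ} (hℓ : ℓ < S.Q) : AdaptedL2 (S.history t (ℓ + 1)) P (S.noise t ℓ i) :=
  adaptedL2_noise_of ho hs hℓ (adaptedL2_localIter ho hs t i hℓ.le)

theorem adaptedL2_stochGrad (ho : S.OracleAssumption P σ) (hs : S.SmoothAssumption L) (t : ℕ)
    (i : Fin S.n) {ℓ : ℕ} (hℓ : ℓ < S.Q) : AdaptedL2 (S.history t (ℓ + 1)) P (S.stochGrad t ℓ i) :=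
  adaptedL2_stochGrad_of ho hs hℓ (adaptedL2_localIter ho hs t i hℓ.le)

end Setup


/-! ### Orthogonality from conditional expectations and conditional independence. -/

section Orthogonality

set_option linter.unusedSectionVars false

variable {Ω E : Type*} [NormedAddCommGroup E] [InnerProductSpace ℝ E] {m mΩ : MeasurableSpace Ω}
  {P : Measure Ω}

/-- The second moment `E‖X‖²`. -/
noncomputable def secondMoment (P : Measure Ω) (X : Ω → E) : ℝ := ∫ ω, ‖X ω‖ ^ 2 ∂P

theorem integrable_norm_sq {X : Ω → E} (hX : MemLp X 2 P) : Integrable (fun ω => ‖X ω‖ ^ 2) P :=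
  (memLp_two_iff_integrable_sq_norm hX.1).1 hX

theorem integrable_inner {X Y : Ω → E} (hX : MemLp X 2 P) (hY : MemLp Y 2 P) :
    Integrable (fun ω => inner ℝ (X ω) (Y ω)) P :=
  (hX.norm.integrable_mul hY.norm).mono' (hX.1.inner hY.1)
    (Filter.Eventually.of_forall fun ω => norm_inner_le_norm (X ω) (Y ω))

theorem secondMoment_nonneg (X : Ω → E) : 0 ≤ secondMoment P X :=
  integral_nonneg fun _ => sq_nonneg _

theorem secondMoment_add_of_orthogonal {X Y : Ω → E} (hX : MemLp X 2 P) (hY : MemLp Y 2 P)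
    (h : ∫ ω, inner ℝ (X ω) (Y ω) ∂P = 0) :
    secondMoment P (fun ω => X ω + Y ω) = secondMoment P X + secondMoment P Y := by
  simp only [secondMoment, norm_add_sq_real]
  have hXY : Integrable (fun ω => ‖X ω‖ ^ 2 + 2 * inner ℝ (X ω) (Y ω)) P :=
    (integrable_norm_sq hX).add ((integrable_inner hX hY).const_mul 2)
  rw [integral_add hXY (integrable_norm_sq hY), integral_add (integrable_norm_sq hX)
    ((integrable_inner hX hY).const_mul 2), integral_const_mul, h]
  ring

theorem secondMoment_sum_of_orthogonal {ι : Type*} (s : Finset ι) {X : ι → Ω → E}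
    (hX : ∀ i ∈ s, MemLp (X i) 2 P)
    (h : ∀ i ∈ s, ∀ j ∈ s, i ≠ j → ∫ ω, inner ℝ (X i ω) (X j ω) ∂P = 0) :
    secondMoment P (fun ω => ∑ i ∈ s, X i ω) = ∑ i ∈ s, secondMoment P (X i) := by
  classical
  induction s using Finset.induction_on with
  | empty => simp [secondMoment]
  | insert a s ha ih =>
    have hX' : ∀ i ∈ s, MemLp (X i) 2 P := fun i hi => hX i (Finset.mem_insert_of_mem hi)
    have h0 : ∫ ω, inner ℝ (X a ω) (∑ i ∈ s, X i ω) ∂P = 0 := by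
      simp only [inner_sum]
      rw [integral_finsetSum s fun i hi =>
        integrable_inner (hX a (Finset.mem_insert_self a s)) (hX' i hi)]
      exact Finset.sum_eq_zero fun i hi => h a (Finset.mem_insert_self a s) i
        (Finset.mem_insert_of_mem hi) (fun e => ha (e ▸ hi))
    simp only [Finset.sum_insert ha]
    rw [secondMoment_add_of_orthogonal (hX a (Finset.mem_insert_self a s))
      (memLp_finsetSum s hX') h0, ih hX' fun i hi j hj => h i (Finset.mem_insert_of_mem hi) j
        (Finset.mem_insert_of_mem hj)]

variable [CompleteSpace E]

/-- A random vector with vanishing conditional expectation is orthogonal to the past. -/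
theorem integral_bilin_eq_zero {F G : Type*} [NormedAddCommGroup F] [NormedSpace ℝ F]
    [NormedAddCommGroup G] [NormedSpace ℝ G] [CompleteSpace G] [IsFiniteMeasure P]
    (B : F →L[ℝ] E →L[ℝ] G) (hm : m ≤ mΩ) {X : Ω → F} {N : Ω → E}
    (hX : StronglyMeasurable[m] X) (hN : Integrable N P) (h : P[N | m] =ᵐ[P] 0)
    (hXN : Integrable (fun ω => B (X ω) (N ω)) P) : ∫ ω, B (X ω) (N ω) ∂P = 0 := by
  rw [← integral_condExp hm]
  refine integral_eq_zero_of_ae ?_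
  filter_upwards [condExp_bilin_of_stronglyMeasurable_left B hX hXN hN, h] with ω h1 h2
  rw [h1, h2]
  simp

theorem integral_inner_eq_zero [IsFiniteMeasure P] (hm : m ≤ mΩ)
    {X N : Ω → E} (hX : AdaptedL2 m P X) (hN : MemLp N 2 P) (h : P[N | m] =ᵐ[P] 0) :
    ∫ ω, inner ℝ (X ω) (N ω) ∂P = 0 :=
  integral_bilin_eq_zero (innerSL ℝ) hm hX.1 (hN.integrable one_le_two) h (integrable_inner hX.2 hN)

theorem integral_smul_eq_zero [IsFiniteMeasure P] (hm : m ≤ mΩ)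
    {u : Ω → ℝ} {N : Ω → E} (hu : StronglyMeasurable[m] u) (hu2 : MemLp u 2 P) (hN : MemLp N 2 P)
    (h : P[N | m] =ᵐ[P] 0) : ∫ ω, u ω • N ω ∂P = 0 :=
  integral_bilin_eq_zero (ContinuousLinearMap.lsmul ℝ ℝ) hm hu (hN.integrable one_le_two) h
    (memLp_one_iff_integrable.1 (hN.smul hu2))

theorem integral_smul_eq_zero' [IsFiniteMeasure P] (hm : m ≤ mΩ)
    {u : Ω → ℝ} {X : Ω → E} (hX : StronglyMeasurable[m] X) (hX2 : MemLp X 2 P) (hu2 : MemLp u 2 P)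
    (h : P[u | m] =ᵐ[P] 0) : ∫ ω, u ω • X ω ∂P = 0 :=
  integral_bilin_eq_zero (ContinuousLinearMap.lsmul ℝ ℝ).flip hm hX (hu2.integrable one_le_two) h
    (memLp_one_iff_integrable.1 (hX2.smul hu2))

theorem condExp_eq_zero_of_setIntegral {F : Type*} [NormedAddCommGroup F] [NormedSpace ℝ F]
    [CompleteSpace F] [IsFiniteMeasure P] (hm : m ≤ mΩ) {N : Ω → F}
    (hN : Integrable N P) (h : ∀ s, MeasurableSet[m] s → ∫ ω in s, N ω ∂P = 0) :
    P[N | m] =ᵐ[P] 0 :=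
  (ae_eq_condExp_of_forall_setIntegral_eq (g := 0) hm hN (fun _ _ _ => integrableOn_zero)
    (fun s hs _ => by simp [h s hs]) (by fun_prop)).symm

theorem condExp_sub_self {F : Type*} [NormedAddCommGroup F] [NormedSpace ℝ F]
    [CompleteSpace F] [IsFiniteMeasure P] (hm : m ≤ mΩ) {X X' : Ω → F}
    (hX : Integrable X P) (hX' : StronglyMeasurable[m] X') (hX'i : Integrable X' P)
    (h : P[X | m] =ᵐ[P] X') : P[fun ω => X ω - X' ω | m] =ᵐ[P] 0 := by
  have h1 := condExp_sub hX hX'i m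
  rw [condExp_of_stronglyMeasurable hm hX' hX'i] at h1
  filter_upwards [h1, h] with ω h1 h2
  change P[X - X' | m] ω = 0
  rw [h1, Pi.sub_apply, h2, sub_self]

/-- If `X` and `Y` are conditionally independent given `m`, then `X - E[X | m]` is orthogonal to
`Y - Y'` for every `m`-measurable `Y'`. -/
theorem integral_inner_eq_zero_of_condIndepGiven [MeasurableSpace E] [BorelSpace E]
    [SecondCountableTopology E] [IsProbabilityMeasure P] (hm : m ≤ mΩ)
    {X Y X' Y' : Ω → E} (h : CondIndepGiven P m X Y) (hX : Measurable X) (hY : Measurable Y)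
    (hX2 : MemLp X 2 P) (hY2 : MemLp Y 2 P) (hX' : AdaptedL2 m P X') (hY' : AdaptedL2 m P Y')
    (hXX' : P[X | m] =ᵐ[P] X') :
    ∫ ω, inner ℝ (X ω - X' ω) (Y ω - Y' ω) ∂P = 0 := by
  have hXc := condExp_sub_self hm (hX2.integrable one_le_two) hX'.1
    (hX'.2.integrable one_le_two) hXX'
  have hXd : MemLp (fun ω => X ω - X' ω) 2 P := hX2.sub hX'.2
  have hind : ∀ s, MeasurableSet s → MemLp (s.indicator fun _ : Ω => (1 : ℝ)) 2 P := fun s hs =>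
    (memLp_const (1 : ℝ)).indicator hs
  have hmul : ∀ s t : Set Ω, ∀ ω, (s ∩ t).indicator (fun _ => (1 : ℝ)) ω
      = s.indicator (fun _ => (1 : ℝ)) ω * t.indicator (fun _ => (1 : ℝ)) ω := fun s t ω => by
    by_cases h1 : ω ∈ s <;> by_cases h2 : ω ∈ t <;> simp [h1, h2]
  -- The goal is `E[X - X' | σ(Y)] = 0`. With `b = 1_{Y ∈ B}` and `b' = E[b | m]`, write `b(X - X')
  -- = (b-b')X - (b-b')X' + b'(X - X')`; each term integrates to zero, for a different reason.
  have hset : ∀ B, MeasurableSet B → ∫ ω in Y ⁻¹' B, (X ω - X' ω) ∂P = 0 := fun B hB => by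
    have hYB := hY hB
    set b : Ω → ℝ := (Y ⁻¹' B).indicator fun _ => (1 : ℝ) with hb
    set b' : Ω → ℝ := P[b | m] with hb'
    have hb2 : MemLp b 2 P := hind _ hYB
    have hb'2 : MemLp b' 2 P := hb2.condExp one_le_two
    have hbc : P[fun ω => b ω - b' ω | m] =ᵐ[P] 0 :=
      condExp_sub_self hm (hb2.integrable one_le_two) stronglyMeasurable_condExp
        (hb'2.integrable one_le_two) .rfl
    have hbb : MemLp (fun ω => b ω - b' ω) 2 P := hb2.sub hb'2
    -- This is where independence enters: with `a = 1_{X ∈ A}`, both `E[ab]` (conditional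
    -- independence) and `E[ab']` (`b'` is `m`-measurable) equal `E[E[a|m] b']`.
    have hbX : P[fun ω => b ω - b' ω | MeasurableSpace.comap X inferInstance] =ᵐ[P] 0 := by
      refine condExp_eq_zero_of_setIntegral (N := fun ω => b ω - b' ω) hX.comap_le
        (hbb.integrable one_le_two) ?_
      rintro _ ⟨A, hA, rfl⟩
      have hXA := hX hA
      set a : Ω → ℝ := (X ⁻¹' A).indicator fun _ => (1 : ℝ) with ha
      have ha2 : MemLp a 2 P := hind _ hXA
      have iab : Integrable (fun ω => a ω * b ω) P := ha2.integrable_mul hb2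
      have iab' : Integrable (fun ω => a ω * b' ω) P := ha2.integrable_mul hb'2
      have e1 : ∫ ω in X ⁻¹' A, (b ω - b' ω) ∂P = ∫ ω, a ω * b ω ∂P - ∫ ω, a ω * b' ω ∂P := by
        rw [← integral_indicator hXA, ← integral_sub iab iab']
        refine integral_congr_ae (Filter.Eventually.of_forall fun ω => ?_)
        by_cases h1 : ω ∈ X ⁻¹' A <;> simp [ha, h1]
      have e2 : ∫ ω, a ω * b ω ∂P = ∫ ω, P[a | m] ω * b' ω ∂P := by
        rw [← integral_condExp hm]
        refine integral_congr_ae ?_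
        have h1 := h A B hA hB
        have h2 : (X ⁻¹' A ∩ Y ⁻¹' B).indicator (fun _ => (1 : ℝ)) = fun ω => a ω * b ω :=
          funext fun ω => hmul _ _ ω
        rw [h2] at h1
        exact h1
      have e3 : ∫ ω, a ω * b' ω ∂P = ∫ ω, P[a | m] ω * b' ω ∂P := by
        rw [← integral_condExp hm]
        exact integral_congr_ae (condExp_mul_of_stronglyMeasurable_right
          stronglyMeasurable_condExp iab' (ha2.integrable one_le_two))
      rw [e1, e2, e3, sub_self]
    have i1 : ∫ ω, (b ω - b' ω) • X ω ∂P = 0 :=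
      integral_smul_eq_zero' (u := fun ω => b ω - b' ω) hX.comap_le
        (Measurable.stronglyMeasurable (comap_measurable X)) hX2
        hbb hbX
    have i2 : ∫ ω, (b ω - b' ω) • X' ω ∂P = 0 :=
      integral_smul_eq_zero' (u := fun ω => b ω - b' ω) hm hX'.1 hX'.2 hbb hbc
    have i3 : ∫ ω, b' ω • (X ω - X' ω) ∂P = 0 :=
      integral_smul_eq_zero hm stronglyMeasurable_condExp hb'2 hXd hXc
    have j1 : Integrable (fun ω => (b ω - b' ω) • X ω) P :=
      memLp_one_iff_integrable.1 (hX2.smul hbb)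
    have j2 : Integrable (fun ω => (b ω - b' ω) • X' ω) P :=
      memLp_one_iff_integrable.1 (hX'.2.smul hbb)
    have j3 : Integrable (fun ω => b' ω • (X ω - X' ω)) P :=
      memLp_one_iff_integrable.1 (hXd.smul hb'2)
    have e : ∫ ω in Y ⁻¹' B, (X ω - X' ω) ∂P
        = ∫ ω, ((b ω - b' ω) • X ω - (b ω - b' ω) • X' ω + b' ω • (X ω - X' ω)) ∂P := by
      rw [← integral_indicator hYB]
      refine integral_congr_ae (Filter.Eventually.of_forall fun ω => ?_)
      have : (b ω - b' ω) • X ω - (b ω - b' ω) • X' ω + b' ω • (X ω - X' ω)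
          = b ω • (X ω - X' ω) := by module
      simp only [this]
      by_cases h1 : ω ∈ Y ⁻¹' B <;> simp [hb, h1]
    have j12 : Integrable (fun ω => (b ω - b' ω) • X ω - (b ω - b' ω) • X' ω) P := j1.sub j2
    rw [e, integral_add j12 j3, integral_sub j1 j2, i1, i2, i3]
    simp
  have hXcY : P[fun ω => X ω - X' ω | MeasurableSpace.comap Y inferInstance] =ᵐ[P] 0 := by
    refine condExp_eq_zero_of_setIntegral (N := fun ω => X ω - X' ω) hY.comap_le
      (hXd.integrable one_le_two) ?_
    rintro _ ⟨B, hB, rfl⟩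
    exact hset B hB
  -- `X - X'` is orthogonal to `Y` by the preceding step, and to `Y'` because `Y'` is
  -- `m`-measurable.
  have k1 := integral_inner_eq_zero (N := fun ω => X ω - X' ω) hY.comap_le
    (X := Y) ⟨Measurable.stronglyMeasurable (comap_measurable Y), hY2⟩ hXd hXcY
  have k2 := integral_inner_eq_zero hm hY' hXd hXc
  simp only [fun ω => real_inner_comm (Y ω - Y' ω) (X ω - X' ω), inner_sub_left (Y _)]
  rw [integral_sub (integrable_inner hY2 hXd) (integrable_inner hY'.2 hXd), k1, k2, sub_zero]

end Orthogonality

/-! ### Second moments of the gradient noise. -/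

namespace Setup

set_option linter.unusedSectionVars false

variable {Ω Ξ : Type*} [mΩ : MeasurableSpace Ω] [MeasurableSpace Ξ] {S : Setup Ω Ξ}
  {P : Measure Ω} [IsProbabilityMeasure P] {σ L : ℝ}

theorem memLp_noise (ho : S.OracleAssumption P σ) (hs : S.SmoothAssumption L) (t : ℕ)
    (i : Fin S.n) {ℓ : ℕ} (hℓ : ℓ < S.Q) : MemLp (S.noise t ℓ i) 2 P :=
  (adaptedL2_noise ho hs t i hℓ).2

theorem condExp_noise (ho : S.OracleAssumption P σ) (hs : S.SmoothAssumption L) (t : ℕ)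
    (i : Fin S.n) {ℓ : ℕ} (hℓ : ℓ < S.Q) : P[S.noise t ℓ i | S.history t ℓ] =ᵐ[P] 0 := by
  have hg := adaptedL2_gradient (i := i) ho hs (adaptedL2_localIter ho hs t i hℓ.le)
  exact condExp_sub_self (history_le ho t ℓ)
    ((adaptedL2_stochGrad ho hs t i hℓ).2.integrable one_le_two) hg.1
    (hg.2.integrable one_le_two) (ho.unbiased i t ℓ hℓ)

theorem integral_inner_noise (ho : S.OracleAssumption P σ) (hs : S.SmoothAssumption L) (t : ℕ)
    (i : Fin S.n) {ℓ : ℕ} (hℓ : ℓ < S.Q) {X : Ω → Vec S.p} (hX : AdaptedL2 (S.history t ℓ) P X) :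
    ∫ ω, inner ℝ (X ω) (S.noise t ℓ i ω) ∂P = 0 :=
  integral_inner_eq_zero (history_le ho t ℓ) hX (memLp_noise ho hs t i hℓ)
    (condExp_noise ho hs t i hℓ)

theorem secondMoment_noise_le (ho : S.OracleAssumption P σ) (t : ℕ)
    (i : Fin S.n) {ℓ : ℕ} (hℓ : ℓ < S.Q) : secondMoment P (S.noise t ℓ i) ≤ σ ^ 2 := by
  have h := integral_mono_ae integrable_condExp (integrable_const (σ ^ 2)) (ho.variance i t ℓ hℓ)
  rw [integral_condExp (history_le ho t ℓ)] at h
  simpa [secondMoment, noise] using h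

/-- At different local steps the earlier noise belongs to the history of the later one, whose
conditional mean vanishes. At the same step the agents differ, and conditional independence applies.
-/
theorem integral_inner_noise_noise (ho : S.OracleAssumption P σ) (hs : S.SmoothAssumption L)
    (t : ℕ) {i j : Fin S.n} {ℓ ℓ' : ℕ} (hℓ : ℓ < S.Q) (hℓ' : ℓ' < S.Q) (h : (ℓ, i) ≠ (ℓ', j)) :
    ∫ ω, inner ℝ (S.noise t ℓ i ω) (S.noise t ℓ' j ω) ∂P = 0 := by
  rcases lt_trichotomy ℓ ℓ' with hlt | rfl | hlt
  · exact integral_inner_noise ho hs t j hℓ'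
      ((adaptedL2_noise ho hs t i hℓ).mono (history_mono_step t hlt))
  · have hij : i ≠ j := fun e => h (by rw [e])
    have hi := adaptedL2_stochGrad ho hs t i hℓ
    have hj := adaptedL2_stochGrad ho hs t j hℓ
    exact integral_inner_eq_zero_of_condIndepGiven (history_le ho t ℓ) (ho.indep i j hij t ℓ hℓ)
      (hi.1.mono (history_le ho t _)).measurable (hj.1.mono (history_le ho t _)).measurable
      hi.2 hj.2
      (adaptedL2_gradient ho hs (adaptedL2_localIter ho hs t i hℓ.le))
      (adaptedL2_gradient ho hs (adaptedL2_localIter ho hs t j hℓ.le))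
      (ho.unbiased i t ℓ hℓ)
  · simp only [real_inner_comm (S.noise t ℓ' j _)]
    exact integral_inner_noise ho hs t i hℓ
      ((adaptedL2_noise ho hs t j hℓ').mono (history_mono_step t hlt))

theorem secondMoment_sum_noise_le (ho : S.OracleAssumption P σ) (hs : S.SmoothAssumption L)
    (t : ℕ) (i : Fin S.n) {ℓ : ℕ} (hℓ : ℓ ≤ S.Q) :
    secondMoment P (fun ω => ∑ k ∈ Finset.range ℓ, S.noise t k i ω) ≤ ℓ * σ ^ 2 := by
  have hlt : ∀ k ∈ Finset.range ℓ, k < S.Q := fun k hk => (Finset.mem_range.1 hk).trans_le hℓ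
  rw [secondMoment_sum_of_orthogonal _ (fun k hk => memLp_noise ho hs t i (hlt k hk))
    fun k hk k' hk' hne => integral_inner_noise_noise ho hs t (hlt k hk) (hlt k' hk')
      (by simp [hne])]
  refine (Finset.sum_le_sum fun k hk => secondMoment_noise_le ho t i (hlt k hk)).trans ?_
  simp

/-- All `nQ` noises of a round are pairwise orthogonal, so their second moments add. This linear
growth is the source of the factor `1/n` in the leading variance term of the theorem. -/
theorem secondMoment_sum_sum_noise_le (ho : S.OracleAssumption P σ) (hs : S.SmoothAssumption L)
    (t : ℕ) : secondMoment P (fun ω => ∑ i, ∑ k ∈ Finset.range S.Q, S.noise t k i ω)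
      ≤ S.n * S.Q * σ ^ 2 := by
  have hlt : ∀ x ∈ (Finset.univ : Finset (Fin S.n)) ×ˢ Finset.range S.Q, x.2 < S.Q := fun x hx =>
    Finset.mem_range.1 (Finset.mem_product.1 hx).2
  have e : (fun ω => ∑ i, ∑ k ∈ Finset.range S.Q, S.noise t k i ω)
      = fun ω => ∑ x ∈ (Finset.univ : Finset (Fin S.n)) ×ˢ Finset.range S.Q,
        S.noise t x.2 x.1 ω := funext fun ω =>
      (Finset.sum_product _ _ fun x : Fin S.n × ℕ => S.noise t x.2 x.1 ω).symm
  rw [e, secondMoment_sum_of_orthogonal _ (fun x hx => memLp_noise ho hs t x.1 (hlt x hx))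
    fun x hx y hy hne => integral_inner_noise_noise ho hs t (hlt x hx) (hlt y hy)
      (fun e => hne (Prod.ext (Prod.ext_iff.1 e).2 (Prod.ext_iff.1 e).1))]
  refine (Finset.sum_le_sum fun x hx => secondMoment_noise_le ho t x.1 (hlt x hx)).trans ?_
  simp

end Setup


/-! ### Calculus of second moments. -/

section SecondMoment

set_option linter.unusedSectionVars false

variable {Ω E : Type*} [NormedAddCommGroup E] [InnerProductSpace ℝ E] {mΩ : MeasurableSpace Ω}
  {P : Measure Ω}

theorem secondMoment_smul (r : ℝ) (X : Ω → E) :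
    secondMoment P (fun ω => r • X ω) = r ^ 2 * secondMoment P X := by
  simp only [secondMoment, norm_smul, mul_pow, Real.norm_eq_abs, sq_abs]
  exact integral_const_mul _ _

theorem secondMoment_sub_comm (X Y : Ω → E) :
    secondMoment P (fun ω => X ω - Y ω) = secondMoment P (fun ω => Y ω - X ω) := by
  simp only [secondMoment, norm_sub_rev]

theorem secondMoment_mono {F : Type*} [NormedAddCommGroup F] [InnerProductSpace ℝ F] {X : Ω → E}
    {Y : Ω → F} {C : ℝ} (hX : MemLp X 2 P) (hY : MemLp Y 2 P)
    (h : ∀ ω, ‖X ω‖ ≤ C * ‖Y ω‖) : secondMoment P X ≤ C ^ 2 * secondMoment P Y := by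
  rw [secondMoment, secondMoment, ← integral_const_mul]
  refine integral_mono (integrable_norm_sq hX) ((integrable_norm_sq hY).const_mul _) fun ω => ?_
  simp only
  rw [← mul_pow]
  exact pow_le_pow_left₀ (norm_nonneg _) (h ω) 2

theorem secondMoment_add_le {X Y : Ω → E} (hX : MemLp X 2 P) (hY : MemLp Y 2 P) {c : ℝ}
    (hc : 0 < c) : secondMoment P (fun ω => X ω + Y ω)
      ≤ (1 + c) * secondMoment P X + (1 + 1 / c) * secondMoment P Y := by
  simp only [secondMoment]
  rw [← integral_const_mul, ← integral_const_mul, ← integral_add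
    ((integrable_norm_sq hX).const_mul _) ((integrable_norm_sq hY).const_mul _)]
  refine integral_mono (integrable_norm_sq (hX.add hY)) (((integrable_norm_sq hX).const_mul _).add
    ((integrable_norm_sq hY).const_mul _)) fun ω => ?_
  have h := norm_add_sq_le_div (s := 1 / (1 + c)) (by positivity)
    (by rw [div_lt_one (by positivity)]; linarith) (X ω) (Y ω)
  refine h.trans (le_of_eq ?_)
  have : (1 : ℝ) - 1 / (1 + c) = c / (1 + c) := by field_simp; ring
  rw [this]
  field_simp
  ring

theorem secondMoment_add_le_two {X Y : Ω → E} (hX : MemLp X 2 P) (hY : MemLp Y 2 P) :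
    secondMoment P (fun ω => X ω + Y ω) ≤ 2 * secondMoment P X + 2 * secondMoment P Y := by
  have := secondMoment_add_le hX hY one_pos
  norm_num at this
  exact this

theorem secondMoment_sum_le {ι : Type*} (s : Finset ι) {X : ι → Ω → E}
    (hX : ∀ i ∈ s, MemLp (X i) 2 P) : secondMoment P (fun ω => ∑ i ∈ s, X i ω)
      ≤ s.card * ∑ i ∈ s, secondMoment P (X i) := by
  simp only [secondMoment]
  rw [← integral_finsetSum s fun i hi => integrable_norm_sq (hX i hi), ← integral_const_mul]
  refine integral_mono (integrable_norm_sq (memLp_finsetSum s hX))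
    ((integrable_finsetSum s fun i hi => integrable_norm_sq (hX i hi)).const_mul _) fun ω => ?_
  have h1 := pow_le_pow_left₀ (norm_nonneg _) (norm_sum_le s fun i => X i ω) 2
  exact h1.trans sq_sum_le_card_mul_sum_sq

theorem secondMoment_add_le_three {X Y Z : Ω → E} (hX : MemLp X 2 P) (hY : MemLp Y 2 P)
    (hZ : MemLp Z 2 P) : secondMoment P (fun ω => X ω + Y ω + Z ω)
      ≤ 3 * (secondMoment P X + secondMoment P Y + secondMoment P Z) := by
  have h := secondMoment_sum_le (P := P) Finset.univ (X := ![X, Y, Z]) (by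
    intro i _; fin_cases i; exacts [hX, hY, hZ])
  simpa [Fin.sum_univ_three] using h

end SecondMoment

/-! ### Consensus error under forced accelerated gossip. -/

section GossipBound

/-- The solution of `A (t + 1) = ρ A t + c w t`. -/
def gossipBound (ρ c A₀ : ℝ) (w : ℕ → ℝ) : ℕ → ℝ
  | 0 => A₀
  | t + 1 => ρ * gossipBound ρ c A₀ w t + c * w t

variable {Ω : Type*} {mΩ : MeasurableSpace Ω} {P : Measure Ω} [IsProbabilityMeasure P] {ρ c A₀ : ℝ}

theorem integrable_gossipBound {w : ℕ → Ω → ℝ} (hw : ∀ t, Integrable (w t) P) (t : ℕ) :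
    Integrable (fun ω => gossipBound ρ c A₀ (fun s => w s ω) t) P := by
  induction t with
  | zero => exact integrable_const _
  | succ t ih => exact (ih.const_mul ρ).add ((hw t).const_mul c)

theorem integral_gossipBound {w : ℕ → Ω → ℝ} (hw : ∀ t, Integrable (w t) P) (t : ℕ) :
    ∫ ω, gossipBound ρ c A₀ (fun s => w s ω) t ∂P
      = gossipBound ρ c A₀ (fun s => ∫ ω, w s ω ∂P) t := by
  induction t with
  | zero => simp [gossipBound]
  | succ t ih =>
    simp only [gossipBound]
    rw [integral_add ((integrable_gossipBound hw t).const_mul ρ) ((hw t).const_mul c),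
      integral_const_mul, integral_const_mul, ih]

variable {n p : ℕ} {W : Matrix (Fin n) (Fin n) ℝ}

theorem rhoW_sq : rhoW W ^ 2 = etaW W := by
  rw [rhoW, Real.sq_sqrt]
  rw [etaW]
  positivity

theorem rhoW_pos : 0 < rhoW W := by
  rw [rhoW, etaW]
  positivity

/-- For `λ ≥ 1` the real square root of `1 - λ² ≤ 0` is 0 by convention, so `η_w = 1` and `ρ̃_w =
1`. -/
theorem specNorm_lt_one (h : rhoW W < 1) : specNorm W < 1 := by
  by_contra! h1
  have h2 : Real.sqrt (1 - specNorm W ^ 2) = 0 := Real.sqrt_eq_zero_of_nonpos (by nlinarith)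
  simp [rhoW, etaW, h2] at h

/-- The consensus error of a sequence driven by accelerated gossip. -/
theorem frobSq_proj_le_gossipBound (hsym : Wᵀ = W) (hst : ∀ i, ∑ j, W i j = 1) (hn : 0 < n)
    (hW : W.PosSemidef) (hρ : rhoW W < 1) {a b v : ℕ → Stack n p} (h0 : b 0 = a 0)
    (ha : ∀ t, a (t + 1) = (1 + etaW W) • mix W (a t + v t) - etaW W • (b t + v t))
    (hb : ∀ t, b (t + 1) = a t + v t) (t : ℕ) :
    frobSq (proj (a t)) ≤ gossipBound (rhoW W) (2 / (1 - rhoW W)) (2 * frobSq (proj (a 0)))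
      (fun s => frobSq (proj (v s))) t := by
  obtain ⟨Φ, h1, h2, h3, h4⟩ := exists_gossip_energy p hsym hst hn hW (specNorm_lt_one hρ)
  have hρ0 : 0 < rhoW W := rhoW_pos
  refine (h1 (a t) (b t)).trans ?_
  induction t with
  | zero => rw [h0]; exact h2 _
  | succ t ih =>
    rw [ha, hb, h3]
    -- The weight `s = ρ̃_w` divides the contraction factor: `η_w / ρ̃_w = ρ̃_w`. The forcing enters
    -- both copies equally, so the bound on the diagonal of `Φ` applies to it.
    have h5 := h4 (rhoW W) hρ0 hρ (a t) (b t) (v t) (v t)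
    have h6 : 0 < 1 - rhoW W := sub_pos.2 hρ
    have h7 : etaW W * (Φ (a t) (b t) / rhoW W + Φ (v t) (v t) / (1 - rhoW W))
        = rhoW W * Φ (a t) (b t) + rhoW W ^ 2 * (Φ (v t) (v t) / (1 - rhoW W)) := by
      rw [← rhoW_sq]; field_simp
    have h8 : 0 ≤ etaW W := by rw [← rhoW_sq]; positivity
    refine (mul_le_mul_of_nonneg_left h5 h8).trans ?_
    rw [h7]
    simp only [gossipBound]
    refine add_le_add (mul_le_mul_of_nonneg_left ih hρ0.le) ?_
    have h9 := h2 (v t)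
    have h10 := frobSq_nonneg (proj (v t))
    have h11 : rhoW W ^ 2 ≤ 1 := by nlinarith
    calc rhoW W ^ 2 * (Φ (v t) (v t) / (1 - rhoW W))
        ≤ rhoW W ^ 2 * (2 * frobSq (proj (v t)) / (1 - rhoW W)) := by gcongr
      _ ≤ 1 * (2 * frobSq (proj (v t)) / (1 - rhoW W)) := by gcongr
      _ = 2 / (1 - rhoW W) * frobSq (proj (v t)) := by ring

end GossipBound

/-! ### Dynamics of the averages and of the tracking variable. -/

namespace Setup

variable {Ω Ξ : Type*} (S : Setup Ω Ξ)

/-- The average iterate. -/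
noncomputable def xBar (t : ℕ) (ω : Ω) : Vec S.p := avg (S.state ω t).x

/-- The average momentum. -/
noncomputable def zBar (t : ℕ) (ω : Ω) : Vec S.p := avg (S.state ω t).z

/-- The auxiliary point on which the averaged method is a gradient method. -/
noncomputable def dBar (t : ℕ) (ω : Ω) : Vec S.p :=
  S.xBar t ω - (S.etaHat * S.β / (1 - S.β)) • S.zBar t ω

/-- The average of the stochastic gradients of a round. -/
noncomputable def roundGrad (t : ℕ) (ω : Ω) : Stack S.n S.p := fun i =>
  (S.Q : ℝ)⁻¹ • ∑ ℓ ∈ Finset.range S.Q, S.stochGrad t ℓ i ω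

/-- The average of the gradient noise of a round. -/
noncomputable def roundNoise (t : ℕ) (ω : Ω) : Stack S.n S.p := fun i =>
  (S.Q : ℝ)⁻¹ • ∑ ℓ ∈ Finset.range S.Q,
    (S.stochGrad t ℓ i ω - gradient (S.f i) (S.localIter t ℓ i ω))

/-- The average deviation of the gradients at the local iterates from those at the average. -/
noncomputable def roundBias (t : ℕ) (ω : Ω) : Stack S.n S.p := fun i =>
  (S.Q : ℝ)⁻¹ • ∑ ℓ ∈ Finset.range S.Q,
    (gradient (S.f i) (S.localIter t ℓ i ω) - gradient (S.f i) (S.xBar t ω))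

/-- The momentum increment. -/
noncomputable def zInc (t : ℕ) (ω : Ω) : Stack S.n S.p := (S.state ω (t + 1)).z - (S.state ω t).z

variable {S}

theorem roundGrad_eq (hQ : 0 < S.Q) (t : ℕ) (ω : Ω) (i : Fin S.n) :
    S.roundGrad t ω i
      = gradient (S.f i) (S.xBar t ω) + S.roundBias t ω i + S.roundNoise t ω i := by
  have hQ' : (S.Q : ℝ) ≠ 0 := (Nat.cast_pos.2 hQ).ne'
  simp only [roundGrad, roundBias, roundNoise, Finset.sum_sub_distrib, Finset.sum_const,
    Finset.card_range, ← Nat.cast_smul_eq_nsmul ℝ, smul_sub, smul_smul, inv_mul_cancel₀ hQ',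
    one_smul]
  abel

theorem localIter_eq_sum (t : ℕ) (ω : Ω) (i : Fin S.n) (ℓ : ℕ) :
    S.localIter t ℓ i ω = (S.state ω t).x i
      - S.ηa • (∑ k ∈ Finset.range ℓ, S.stochGrad t k i ω + (ℓ : ℝ) • (S.state ω t).c i) := by
  induction ℓ with
  | zero => simp [localIter, localSteps]
  | succ ℓ ih =>
    have h : S.localIter t (ℓ + 1) i ω
      = S.localIter t ℓ i ω - S.ηa • (S.stochGrad t ℓ i ω + (S.state ω t).c i) := rfl
    rw [h, ih, Finset.sum_range_succ]
    push_cast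
    module

theorem localIter_sub (t : ℕ) (ω : Ω) (i : Fin S.n) (ℓ : ℕ) :
    S.localIter t ℓ i ω - (S.state ω t).x i = (-S.ηa) •
      ((ℓ : ℝ) • (gradient (S.f i) (S.xBar t ω) + (S.state ω t).c i)
        + ∑ k ∈ Finset.range ℓ, (gradient (S.f i) (S.localIter t k i ω)
          - gradient (S.f i) (S.xBar t ω))
        + ∑ k ∈ Finset.range ℓ, (S.stochGrad t k i ω
          - gradient (S.f i) (S.localIter t k i ω))) := by
  rw [localIter_eq_sum]
  simp only [Finset.sum_sub_distrib, Finset.sum_const, Finset.card_range,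
    ← Nat.cast_smul_eq_nsmul ℝ]
  module

/-- The correction `c` is added in each of the `Q` local steps and subtracted once in `r_t`, so
`r_t` is exactly the mean of the stochastic gradients of the round. -/
theorem state_z_succ (hQ : 0 < S.Q) (ha : 0 < S.ηa) (t : ℕ) (ω : Ω) :
    (S.state ω (t + 1)).z = S.β • (S.state ω t).z + (1 - S.β) • S.roundGrad t ω := by
  have hQ' : (S.Q : ℝ) ≠ 0 := (Nat.cast_pos.2 hQ).ne'
  funext i
  change S.β • (S.state ω t).z i + (1 - S.β) • ((1 / (S.ηa * S.Q)) •
    ((S.state ω t).x i - S.localIter t S.Q i ω) - (S.state ω t).c i) = _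
  have h : (1 / (S.ηa * S.Q)) • ((S.state ω t).x i - S.localIter t S.Q i ω) - (S.state ω t).c i
      = S.roundGrad t ω i := by
    rw [localIter_eq_sum, sub_sub_cancel, smul_smul, roundGrad, smul_add, smul_smul,
      show 1 / (S.ηa * S.Q) * S.ηa = (S.Q : ℝ)⁻¹ by field_simp, inv_mul_cancel₀ hQ', one_smul,
      add_sub_cancel_right]
  rw [h]
  rfl

theorem zInc_eq (hQ : 0 < S.Q) (ha : 0 < S.ηa) (t : ℕ) (ω : Ω) :
    S.zInc t ω = (1 - S.β) • (S.roundGrad t ω - (S.state ω t).z) := by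
  rw [zInc, state_z_succ hQ ha]
  module

/-- The tracking variable of round `t`. -/
noncomputable def track (S : Setup Ω Ξ) (t : ℕ) (ω : Ω) : Stack S.n S.p :=
  (S.state ω t).c + (S.state ω t).z + S.zInc t ω

theorem yVar_eq (t : ℕ) (ω : Ω) : S.yVar (S.samples t ω) (S.state ω t) = S.track t ω := by
  change (S.state ω (t + 1)).z + (S.state ω t).c = _
  rw [track, zInc]
  abel

theorem ylVar_eq (t : ℕ) (ω : Ω) : S.ylVar (S.samples t ω) (S.state ω t)
    = (S.state ω t).cPrev + (S.state ω t).z + S.zInc t ω := by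
  change (S.state ω (t + 1)).z + (S.state ω t).cPrev = _
  rw [zInc]
  abel

theorem etaHat_eq : S.Q * S.ηs * S.ηa = S.etaHat := by rw [etaHat]; ring

theorem state_c_succ (t : ℕ) (ω : Ω) :
    (S.state ω (t + 1)).c = (S.state ω t).c - S.track t ω
      + (1 + etaW S.W) • mix S.W (S.track t ω)
      - etaW S.W • ((S.state ω t).cPrev + (S.state ω t).z + S.zInc t ω) := by
  rw [← yVar_eq, ← ylVar_eq]; rfl

theorem state_x_succ (t : ℕ) (ω : Ω) : (S.state ω (t + 1)).x
    = (1 + etaW S.W) • mix S.W ((S.state ω t).x + (-S.etaHat) • S.track t ω)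
      - etaW S.W • ((S.state ω t).xl + (-S.etaHat) • S.track t ω) := by
  rw [← yVar_eq, neg_smul, ← sub_eq_add_neg, ← sub_eq_add_neg, ← etaHat_eq]; rfl

theorem state_xl_succ (t : ℕ) (ω : Ω) :
    (S.state ω (t + 1)).xl = (S.state ω t).x + (-S.etaHat) • S.track t ω := by
  rw [← yVar_eq, neg_smul, ← sub_eq_add_neg, ← etaHat_eq]; rfl

theorem state_cPrev_succ (t : ℕ) (ω : Ω) : (S.state ω (t + 1)).cPrev = (S.state ω t).c := rfl

/-- Since `y_t = z_{t+1} + c_t`, adding `z_{t+1}` to the update of `c` cancels `c_t - y_t`. What is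
left is accelerated gossip for `c + z`, with delayed copy `cPrev + z`, driven by the momentum
increment alone. -/
theorem state_cz_succ (t : ℕ) (ω : Ω) : (S.state ω (t + 1)).c + (S.state ω (t + 1)).z
    = (1 + etaW S.W) • mix S.W ((S.state ω t).c + (S.state ω t).z + S.zInc t ω)
      - etaW S.W • ((S.state ω t).cPrev + (S.state ω t).z + S.zInc t ω) := by
  have h : (S.state ω (t + 1)).z = (S.state ω t).z + S.zInc t ω := by rw [zInc]; abel
  rw [state_c_succ, h, track]
  abel

theorem state_cPrevz_succ (t : ℕ) (ω : Ω) : (S.state ω (t + 1)).cPrev + (S.state ω (t + 1)).z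
    = (S.state ω t).c + (S.state ω t).z + S.zInc t ω := by
  have h : (S.state ω (t + 1)).z = (S.state ω t).z + S.zInc t ω := by rw [zInc]; abel
  rw [state_cPrev_succ, h]
  abel

/-- Mixing preserves averages and the gossip weights `1+η_w` and `-η_w` sum to 1; hence `c̄ = 0`
persists, and the averages of `x` and of its delayed copy stay equal. -/
theorem avg_state (hN : S.NetworkAssumption) (t : ℕ) (ω : Ω) :
    avg (S.state ω t).c = 0 ∧ avg (S.state ω t).cPrev = 0 ∧
      avg (S.state ω t).x = avg (S.state ω t).xl := by
  induction t with
  | zero => exact ⟨avg_zero, avg_zero, rfl⟩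
  | succ t ih =>
    obtain ⟨h1, h2, h3⟩ := ih
    refine ⟨?_, h1, ?_⟩
    · rw [state_c_succ]
      simp only [avg_sub, avg_add, avg_smul, avg_mix hN.symmetric hN.stochastic, track, h1, h2]
      module
    · rw [state_x_succ, state_xl_succ]
      simp only [avg_sub, avg_add, avg_smul, avg_mix hN.symmetric hN.stochastic, h3]
      module

theorem zBar_succ (hQ : 0 < S.Q) (ha : 0 < S.ηa) (t : ℕ) (ω : Ω) :
    S.zBar (t + 1) ω = S.β • S.zBar t ω + (1 - S.β) • avg (S.roundGrad t ω) := by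
  rw [zBar, state_z_succ hQ ha, avg_add, avg_smul, avg_smul, zBar]

theorem xBar_succ (hN : S.NetworkAssumption) (t : ℕ) (ω : Ω) :
    S.xBar (t + 1) ω = S.xBar t ω - S.etaHat • S.zBar (t + 1) ω := by
  have h : avg (S.track t ω) = S.zBar (t + 1) ω := by
    rw [track, zInc]
    simp only [avg_add, avg_sub, (avg_state hN t ω).1, zBar]
    abel
  rw [xBar, state_x_succ]
  simp only [avg_sub, avg_add, avg_smul, avg_mix hN.symmetric hN.stochastic,
    ← (avg_state hN t ω).2.2, h, xBar]
  module

/-- With `q = η̂/(1-β)`, both contributions of `z̄_{t+1}` add up to `-q z̄_{t+1}`, and `q z̄_{t+1} =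
(q-η̂) z̄_t + η̂ ḡ_t`, where `ḡ_t` is the average of `roundGrad`. The first summand is the shift
already present in `d̄_t`. -/
theorem dBar_succ (hN : S.NetworkAssumption) (hQ : 0 < S.Q) (ha : 0 < S.ηa) (hβ : S.β < 1)
    (t : ℕ) (ω : Ω) : S.dBar (t + 1) ω = S.dBar t ω - S.etaHat • avg (S.roundGrad t ω) := by
  have hβ' : 1 - S.β ≠ 0 := (sub_pos.2 hβ).ne'
  rw [dBar, dBar, xBar_succ hN, zBar_succ hQ ha]
  have e1 : S.etaHat * S.β / (1 - S.β) = S.etaHat / (1 - S.β) - S.etaHat := by field_simp; ring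
  have e2 : S.etaHat / (1 - S.β) * (1 - S.β) = S.etaHat := by field_simp
  have e3 : S.etaHat / (1 - S.β) * S.β = S.etaHat / (1 - S.β) - S.etaHat := by field_simp; ring
  rw [e1]
  generalize S.etaHat / (1 - S.β) = q at e2 e3
  have : q • S.β • S.zBar t ω + q • (1 - S.β) • avg (S.roundGrad t ω)
      = (q - S.etaHat) • S.zBar t ω + S.etaHat • avg (S.roundGrad t ω) := by
    rw [smul_smul, smul_smul, e2, e3]
  have h : ∀ A : Vec S.p, S.xBar t ω - S.etaHat • A - (q - S.etaHat) • A = S.xBar t ω - q • A :=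
    fun A => by module
  rw [h, smul_add, this]
  module

theorem frobSq_proj_x_le (hN : S.NetworkAssumption) (hn : 0 < S.n) (hρ : rhoW S.W < 1)
    (t : ℕ) (ω : Ω) : frobSq (proj (S.state ω t).x)
      ≤ gossipBound (rhoW S.W) (2 / (1 - rhoW S.W)) (2 * frobSq (proj S.x₀))
        (fun s => S.etaHat ^ 2 * frobSq (proj (S.track s ω))) t := by
  have h := frobSq_proj_le_gossipBound (a := fun t => (S.state ω t).x)
    (b := fun t => (S.state ω t).xl) (v := fun t => (-S.etaHat) • S.track t ω) hN.symmetric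
    hN.stochastic hn hN.posSemidef hρ rfl (state_x_succ · ω) (state_xl_succ · ω) t
  have h0 : (S.state ω 0).x = S.x₀ := rfl
  simpa only [proj_smul, frobSq_smul, neg_sq, h0] using h

theorem frobSq_proj_cz_le (hN : S.NetworkAssumption) (hn : 0 < S.n) (hρ : rhoW S.W < 1)
    (t : ℕ) (ω : Ω) : frobSq (proj ((S.state ω t).c + (S.state ω t).z))
      ≤ gossipBound (rhoW S.W) (2 / (1 - rhoW S.W)) 0
        (fun s => frobSq (proj (S.zInc s ω))) t := by
  have h := frobSq_proj_le_gossipBound (a := fun t => (S.state ω t).c + (S.state ω t).z)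
    (b := fun t => (S.state ω t).cPrev + (S.state ω t).z) (v := fun t => S.zInc t ω) hN.symmetric
    hN.stochastic hn hN.posSemidef hρ rfl (state_cz_succ · ω) (state_cPrevz_succ · ω) t
  have h0 : frobSq (proj ((S.state ω 0).c + (S.state ω 0).z)) = 0 := by
    have : (S.state ω 0).c + (S.state ω 0).z = 0 := add_zero 0
    rw [this, proj_zero]
    simp [frobSq]
  simpa only [h0, mul_zero] using h

end Setup


section AdaptedStack

variable {Ω : Type*} {n p : ℕ} {m mΩ : MeasurableSpace Ω} {P : Measure Ω} {a : Ω → Stack n p}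

theorem AdaptedL2.avg (h : ∀ i, AdaptedL2 m P fun ω => a ω i) :
    AdaptedL2 m P fun ω => LMT.avg (a ω) := (AdaptedL2.sum fun i _ => h i).const_smul _

theorem AdaptedL2.proj (h : ∀ i, AdaptedL2 m P fun ω => a ω i) (i : Fin n) :
    AdaptedL2 m P fun ω => LMT.proj (a ω) i := (h i).sub (AdaptedL2.avg h)

theorem memLp_avg (h : ∀ i, MemLp (fun ω => a ω i) 2 P) : MemLp (fun ω => avg (a ω)) 2 P :=
  (memLp_finsetSum Finset.univ fun i _ => h i).const_smul ((n : ℝ)⁻¹)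

theorem memLp_proj (h : ∀ i, MemLp (fun ω => a ω i) 2 P) (i : Fin n) :
    MemLp (fun ω => proj (a ω) i) 2 P := (h i).sub (memLp_avg h)

theorem integrable_frobSq (h : ∀ i, MemLp (fun ω => a ω i) 2 P) :
    Integrable (fun ω => frobSq (a ω)) P :=
  integrable_finsetSum _ fun i _ => integrable_norm_sq (h i)

theorem integral_frobSq (h : ∀ i, MemLp (fun ω => a ω i) 2 P) :
    ∫ ω, frobSq (a ω) ∂P = ∑ i, secondMoment P fun ω => a ω i :=
  integral_finsetSum _ fun i _ => integrable_norm_sq (h i)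

theorem card_mul_secondMoment_avg_le (hn : 0 < n) (h : ∀ i, MemLp (fun ω => a ω i) 2 P) :
    n * secondMoment P (fun ω => avg (a ω)) ≤ ∑ i, secondMoment P fun ω => a ω i := by
  rw [← integral_frobSq h, secondMoment, ← integral_const_mul]
  exact integral_mono ((integrable_norm_sq (memLp_avg h)).const_mul _) (integrable_frobSq h)
    fun ω => card_mul_norm_avg_sq_le hn _

end AdaptedStack

/-! ### Moments of the iterates and drift of the local steps. -/

namespace Setup

set_option linter.unusedSectionVars false

variable {Ω Ξ : Type*} [mΩ : MeasurableSpace Ω] [MeasurableSpace Ξ] {S : Setup Ω Ξ}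
  {P : Measure Ω} [IsProbabilityMeasure P] {σ L μ : ℝ}

theorem Assumptions.n_pos (h : S.Assumptions P σ L μ) : 0 < S.n :=
  Fin.pos_iff_nonempty.2 h.network.connected.nonempty

theorem Assumptions.rho_lt_one (h : S.Assumptions P σ L μ) : rhoW S.W < 1 :=
  h.beta_ge.trans_lt h.beta_lt_one

theorem Assumptions.beta_pos (h : S.Assumptions P σ L μ) : 0 < S.β := rhoW_pos.trans_le h.beta_ge

theorem Assumptions.etaHat_pos (h : S.Assumptions P σ L μ) : 0 < S.etaHat :=
  mul_pos (mul_pos h.etaA_pos h.etaS_pos) (Nat.cast_pos.2 h.Q_pos)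

/-! ### Moments of the iterates -/

/-- The expected consensus error of the iterates. -/
noncomputable def mX (S : Setup Ω Ξ) (P : Measure Ω) (t : ℕ) : ℝ :=
  ∑ i, secondMoment P fun ω => proj (S.state ω t).x i

/-- The expected tracking error before the momentum update. -/
noncomputable def mH (S : Setup Ω Ξ) (P : Measure Ω) (t : ℕ) : ℝ :=
  ∑ i, secondMoment P fun ω => proj ((S.state ω t).c + (S.state ω t).z) i

/-- The expected deviation of the momentum from the local gradients. -/
noncomputable def mV (S : Setup Ω Ξ) (P : Measure Ω) (t : ℕ) : ℝ :=
  ∑ i, secondMoment P fun ω => (S.state ω t).z i - gradient (S.f i) (S.xBar t ω)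

/-- The second moment of the average momentum. -/
noncomputable def mZ (S : Setup Ω Ξ) (P : Measure Ω) (t : ℕ) : ℝ := secondMoment P (S.zBar t)

/-- The expected deviation of the local iterates of one agent from the average iterate. -/
noncomputable def drift (S : Setup Ω Ξ) (P : Measure Ω) (t : ℕ) (i : Fin S.n) : ℝ :=
  (S.Q : ℝ)⁻¹ * ∑ ℓ ∈ Finset.range S.Q,
    secondMoment P fun ω => S.localIter t ℓ i ω - S.xBar t ω

/-- The expected deviation of the local iterates from the average iterate. -/
noncomputable def mS (S : Setup Ω Ξ) (P : Measure Ω) (t : ℕ) : ℝ := ∑ i, S.drift P t i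

/-- The expected squared size of the momentum increments. -/
noncomputable def mG (S : Setup Ω Ξ) (P : Measure Ω) (t : ℕ) : ℝ :=
  ∑ i, secondMoment P fun ω => proj (S.zInc t ω) i

/-- The second moment of the gradient at the auxiliary point. -/
noncomputable def mM (S : Setup Ω Ξ) (P : Measure Ω) (t : ℕ) : ℝ :=
  secondMoment P fun ω => gradient S.obj (S.dBar t ω)

/-- The expected optimality gap at the auxiliary point. -/
noncomputable def mD (S : Setup Ω Ξ) (P : Measure Ω) (t : ℕ) : ℝ :=
  ∫ ω, (S.obj (S.dBar t ω) - S.fStar) ∂P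

theorem drift_nonneg (t : ℕ) (i : Fin S.n) : 0 ≤ S.drift P t i :=
  mul_nonneg (by positivity) (Finset.sum_nonneg fun _ _ => secondMoment_nonneg _)

section Moments

variable (h : S.Assumptions P σ L μ)

include h

theorem adaptedL2_xBar (t : ℕ) : AdaptedL2 (S.history t 0) P (S.xBar t) :=
  AdaptedL2.avg (adaptedL2_state h.oracle h.smooth t).1

theorem adaptedL2_zBar (t : ℕ) : AdaptedL2 (S.history t 0) P (S.zBar t) :=
  AdaptedL2.avg (adaptedL2_state h.oracle h.smooth t).2.2.1

theorem adaptedL2_dBar (t : ℕ) : AdaptedL2 (S.history t 0) P (S.dBar t) :=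
  (adaptedL2_xBar h t).sub ((adaptedL2_zBar h t).const_smul _)

theorem adaptedL2_gradient_xBar (t : ℕ) (i : Fin S.n) :
    AdaptedL2 (S.history t 0) P fun ω => gradient (S.f i) (S.xBar t ω) :=
  adaptedL2_gradient h.oracle h.smooth (adaptedL2_xBar h t)

theorem adaptedL2_gradient_obj {t : ℕ} {X : Ω → Vec S.p} (hX : AdaptedL2 (S.history t 0) P X) :
    AdaptedL2 (S.history t 0) P fun ω => gradient S.obj (X ω) :=
  hX.comp_lipschitz (lipschitz_gradient_obj h.smooth h.n_pos) (history_le h.oracle t 0)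

theorem adaptedL2_dev (t : ℕ) (i : Fin S.n) : AdaptedL2 (S.history t 0) P
    fun ω => (S.state ω t).z i - gradient (S.f i) (S.xBar t ω) :=
  ((adaptedL2_state h.oracle h.smooth t).2.2.1 i).sub (adaptedL2_gradient_xBar h t i)

theorem adaptedL2_proj_x (t : ℕ) (i : Fin S.n) :
    AdaptedL2 (S.history t 0) P fun ω => proj (S.state ω t).x i :=
  AdaptedL2.proj (adaptedL2_state h.oracle h.smooth t).1 i

theorem adaptedL2_cz (t : ℕ) (i : Fin S.n) :
    AdaptedL2 (S.history t 0) P fun ω => ((S.state ω t).c + (S.state ω t).z) i :=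
  ((adaptedL2_state h.oracle h.smooth t).2.2.2.1 i).add
    ((adaptedL2_state h.oracle h.smooth t).2.2.1 i)

theorem memLp_zInc (t : ℕ) (i : Fin S.n) : MemLp (fun ω => S.zInc t ω i) 2 P :=
  ((adaptedL2_state h.oracle h.smooth (t + 1)).2.2.1 i).2.sub
    ((adaptedL2_state h.oracle h.smooth t).2.2.1 i).2

theorem memLp_track (t : ℕ) (i : Fin S.n) : MemLp (fun ω => S.track t ω i) 2 P :=
  (adaptedL2_cz h t i).2.add (memLp_zInc h t i)

theorem memLp_localIter (t : ℕ) (i : Fin S.n) {ℓ : ℕ} (hℓ : ℓ < S.Q) :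
    MemLp (S.localIter t ℓ i) 2 P := (adaptedL2_localIter h.oracle h.smooth t i hℓ.le).2

theorem memLp_gradient_sub (t : ℕ) (i : Fin S.n) {ℓ : ℕ} (hℓ : ℓ < S.Q) :
    MemLp (fun ω => gradient (S.f i) (S.localIter t ℓ i ω) - gradient (S.f i) (S.xBar t ω)) 2 P :=
  (adaptedL2_gradient h.oracle h.smooth (adaptedL2_localIter h.oracle h.smooth t i hℓ.le)).2.sub
    (adaptedL2_gradient_xBar h t i).2

theorem secondMoment_gradient_sub_le (t : ℕ) (i : Fin S.n) {ℓ : ℕ} (hℓ : ℓ < S.Q) :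
    secondMoment P (fun ω => gradient (S.f i) (S.localIter t ℓ i ω)
      - gradient (S.f i) (S.xBar t ω))
      ≤ L ^ 2 * secondMoment P fun ω => S.localIter t ℓ i ω - S.xBar t ω :=
  secondMoment_mono (memLp_gradient_sub h t i hℓ)
    ((memLp_localIter h t i hℓ).sub (adaptedL2_xBar h t).2) fun _ => h.smooth.lipschitz i _ _

theorem memLp_roundBias (t : ℕ) (i : Fin S.n) : MemLp (fun ω => S.roundBias t ω i) 2 P :=
  (memLp_finsetSum _ fun _ hℓ => memLp_gradient_sub h t i
    (Finset.mem_range.1 hℓ)).const_smul ((S.Q : ℝ)⁻¹)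

theorem memLp_roundNoise (t : ℕ) (i : Fin S.n) : MemLp (fun ω => S.roundNoise t ω i) 2 P :=
  (memLp_finsetSum _ fun _ hℓ => memLp_noise h.oracle h.smooth t i
    (Finset.mem_range.1 hℓ)).const_smul ((S.Q : ℝ)⁻¹)

theorem secondMoment_roundBias_le (t : ℕ) (i : Fin S.n) :
    secondMoment P (fun ω => S.roundBias t ω i) ≤ L ^ 2 * S.drift P t i := by
  have hQ : (0 : ℝ) < S.Q := Nat.cast_pos.2 h.Q_pos
  simp only [roundBias]
  rw [secondMoment_smul]
  have h1 := secondMoment_sum_le (P := P) (Finset.range S.Q) (X := fun ℓ ω =>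
    gradient (S.f i) (S.localIter t ℓ i ω) - gradient (S.f i) (S.xBar t ω))
    fun ℓ hℓ => memLp_gradient_sub h t i (Finset.mem_range.1 hℓ)
  have h2 := Finset.sum_le_sum fun ℓ (hℓ : ℓ ∈ Finset.range S.Q) =>
    secondMoment_gradient_sub_le h t i (Finset.mem_range.1 hℓ)
  rw [← Finset.mul_sum] at h2
  rw [Finset.card_range] at h1
  calc _ ≤ ((S.Q : ℝ)⁻¹) ^ 2 * (S.Q * (L ^ 2 * ∑ ℓ ∈ Finset.range S.Q,
        secondMoment P fun ω => S.localIter t ℓ i ω - S.xBar t ω)) := by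
        gcongr
        exact h1.trans (by gcongr)
    _ = _ := by rw [drift]; field_simp

theorem secondMoment_roundNoise_le (t : ℕ) (i : Fin S.n) :
    secondMoment P (fun ω => S.roundNoise t ω i) ≤ σ ^ 2 / S.Q := by
  have hQ : (0 : ℝ) < S.Q := Nat.cast_pos.2 h.Q_pos
  simp only [roundNoise]
  rw [secondMoment_smul]
  have h1 := secondMoment_sum_noise_le h.oracle h.smooth t i le_rfl
  calc _ ≤ ((S.Q : ℝ)⁻¹) ^ 2 * (S.Q * σ ^ 2) := by gcongr; exact h1
    _ = _ := by field_simp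

theorem secondMoment_avg_roundNoise_le (t : ℕ) :
    secondMoment P (fun ω => avg (S.roundNoise t ω)) ≤ σ ^ 2 / (S.n * S.Q) := by
  have hQ : (0 : ℝ) < S.Q := Nat.cast_pos.2 h.Q_pos
  have hn : (0 : ℝ) < S.n := Nat.cast_pos.2 h.n_pos
  have e : ∀ ω, avg (S.roundNoise t ω) = ((S.n : ℝ)⁻¹ * (S.Q : ℝ)⁻¹) •
      ∑ i, ∑ k ∈ Finset.range S.Q, S.noise t k i ω := fun ω => by
    simp only [avg, roundNoise, ← Finset.smul_sum, smul_smul, noise]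
  simp only [e]
  rw [secondMoment_smul]
  have h1 := secondMoment_sum_sum_noise_le h.oracle h.smooth t
  calc _ ≤ ((S.n : ℝ)⁻¹ * (S.Q : ℝ)⁻¹) ^ 2 * (S.n * S.Q * σ ^ 2) := by gcongr
    _ = _ := by field_simp

theorem integral_inner_roundNoise {t : ℕ} {X : Ω → Vec S.p}
    (hX : AdaptedL2 (S.history t 0) P X) (i : Fin S.n) :
    ∫ ω, inner ℝ (X ω) (S.roundNoise t ω i) ∂P = 0 := by
  have e : ∀ ω, S.roundNoise t ω i
      = (S.Q : ℝ)⁻¹ • ∑ ℓ ∈ Finset.range S.Q, S.noise t ℓ i ω := fun _ => rfl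
  simp only [e, inner_smul_right, inner_sum]
  rw [integral_const_mul, integral_finsetSum _ fun ℓ hℓ => integrable_inner hX.2
    (memLp_noise h.oracle h.smooth t i (Finset.mem_range.1 hℓ)), Finset.sum_eq_zero, mul_zero]
  exact fun ℓ hℓ => integral_inner_noise h.oracle h.smooth t i (Finset.mem_range.1 hℓ)
    (hX.mono (history_mono_step t ℓ.zero_le))

theorem integral_inner_avg_roundNoise {t : ℕ} {X : Ω → Vec S.p}
    (hX : AdaptedL2 (S.history t 0) P X) :
    ∫ ω, inner ℝ (X ω) (avg (S.roundNoise t ω)) ∂P = 0 := by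
  simp only [avg, inner_smul_right, inner_sum]
  rw [integral_const_mul, integral_finsetSum _ fun i _ => integrable_inner hX.2
    (memLp_roundNoise h t i), Finset.sum_eq_zero, mul_zero]
  exact fun i _ => integral_inner_roundNoise h hX i

/-! ### One-round estimates -/

/-- As `c̄ = 0`, the direction is `(∇f_i(x̄) - z_i) + (Π(c+z))_i + z̄`. Each summand is controlled
by its own recursion, so heterogeneity of the local gradients never appears by itself. -/
theorem secondMoment_gradient_add_c_le (t : ℕ) (i : Fin S.n) :
    secondMoment P (fun ω => gradient (S.f i) (S.xBar t ω) + (S.state ω t).c i)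
      ≤ 3 * (secondMoment P (fun ω => (S.state ω t).z i - gradient (S.f i) (S.xBar t ω))
        + secondMoment P (fun ω => proj ((S.state ω t).c + (S.state ω t).z) i) + S.mZ P t) := by
  have e : (fun ω => gradient (S.f i) (S.xBar t ω) + (S.state ω t).c i)
      = fun ω => (gradient (S.f i) (S.xBar t ω) - (S.state ω t).z i)
        + proj ((S.state ω t).c + (S.state ω t).z) i + S.zBar t ω := by
    funext ω
    simp only [proj, avg_add, (avg_state h.network t ω).1, zBar, Pi.add_apply]
    abel
  rw [e, secondMoment_sub_comm (fun ω => (S.state ω t).z i)]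
  exact secondMoment_add_le_three ((adaptedL2_gradient_xBar h t i).2.sub
    ((adaptedL2_state h.oracle h.smooth t).2.2.1 i).2)
    (AdaptedL2.proj (adaptedL2_cz h t) i).2 (adaptedL2_zBar h t).2

theorem secondMoment_sum_gradient_sub_le (t : ℕ) (i : Fin S.n) {ℓ : ℕ} (hℓ : ℓ < S.Q) :
    secondMoment P (fun ω => ∑ k ∈ Finset.range ℓ,
      (gradient (S.f i) (S.localIter t k i ω) - gradient (S.f i) (S.xBar t ω)))
      ≤ S.Q ^ 2 * (L ^ 2 * S.drift P t i) := by
  have hQ : (0 : ℝ) < S.Q := Nat.cast_pos.2 h.Q_pos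
  have hk : ∀ k ∈ Finset.range ℓ, k < S.Q := fun k hk => (Finset.mem_range.1 hk).trans hℓ
  refine (secondMoment_sum_le (P := P) (Finset.range ℓ) fun k hk' =>
    memLp_gradient_sub h t i (hk k hk')).trans ?_
  have h2 := Finset.sum_le_sum fun k (hk' : k ∈ Finset.range ℓ) =>
    secondMoment_gradient_sub_le h t i (hk k hk')
  rw [← Finset.mul_sum] at h2
  have h3 : ∑ k ∈ Finset.range ℓ, secondMoment P (fun ω => S.localIter t k i ω - S.xBar t ω)
      ≤ S.Q * S.drift P t i := by
    rw [drift, mul_inv_cancel_left₀ hQ.ne']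
    exact Finset.sum_le_sum_of_subset_of_nonneg (Finset.range_mono hℓ.le)
      fun k _ _ => secondMoment_nonneg _
  have hlt' : (ℓ : ℝ) ≤ S.Q := Nat.cast_le.2 hℓ.le
  rw [Finset.card_range]
  have h4 := h2.trans (mul_le_mul_of_nonneg_left h3 (sq_nonneg L))
  have h5 := mul_nonneg hQ.le (drift_nonneg (S := S) (P := P) t i)
  refine (mul_le_mul hlt' h4 (Finset.sum_nonneg fun _ _ => secondMoment_nonneg _)
    hQ.le).trans (le_of_eq ?_)
  ring

theorem secondMoment_localIter_sub_x_le (t : ℕ) (i : Fin S.n) {ℓ : ℕ} (hℓ : ℓ < S.Q) :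
    secondMoment P (fun ω => S.localIter t ℓ i ω - (S.state ω t).x i)
      ≤ S.ηa ^ 2 * (3 * (S.Q ^ 2 * secondMoment P (fun ω =>
          gradient (S.f i) (S.xBar t ω) + (S.state ω t).c i)
        + S.Q ^ 2 * (L ^ 2 * S.drift P t i) + S.Q * σ ^ 2)) := by
  have hlt' : (ℓ : ℝ) ≤ S.Q := Nat.cast_le.2 hℓ.le
  have hk : ∀ k ∈ Finset.range ℓ, k < S.Q := fun k hk => (Finset.mem_range.1 hk).trans hℓ
  have hM : MemLp (fun ω => gradient (S.f i) (S.xBar t ω) + (S.state ω t).c i) 2 P :=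
    (adaptedL2_gradient_xBar h t i).2.add ((adaptedL2_state h.oracle h.smooth t).2.2.2.1 i).2
  have hA := hM.const_smul (ℓ : ℝ)
  have hB := memLp_finsetSum (Finset.range ℓ) fun k hk' => memLp_gradient_sub h t i (hk k hk')
  have hC := memLp_finsetSum (Finset.range ℓ) fun k hk' =>
    memLp_noise h.oracle h.smooth t i (hk k hk')
  have h1 := secondMoment_add_le_three hA hB hC
  have h2 := secondMoment_smul (P := P) (ℓ : ℝ)
    fun ω => gradient (S.f i) (S.xBar t ω) + (S.state ω t).c i
  simp only [localIter_sub]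
  rw [secondMoment_smul, neg_sq]
  refine mul_le_mul_of_nonneg_left (h1.trans ?_) (sq_nonneg _)
  refine mul_le_mul_of_nonneg_left (add_le_add (add_le_add ?_
    (secondMoment_sum_gradient_sub_le h t i hℓ)) ?_) (by norm_num)
  · refine (le_of_eq h2).trans (mul_le_mul_of_nonneg_right ?_ (secondMoment_nonneg _))
    exact pow_le_pow_left₀ (Nat.cast_nonneg _) hlt' 2
  · exact (secondMoment_sum_noise_le h.oracle h.smooth t i hℓ.le).trans
      (mul_le_mul_of_nonneg_right hlt' (sq_nonneg _))

/-- The local gradients depend on the drift itself, which therefore reappears on the right with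
factor `6(η_a Q L)² ≤ 6/130`. Absorbing it divides by `124/130`, which turns 2, 18 and 6 into at
most 21/10, 19 and 7. -/
theorem drift_le (ha : (S.ηa * S.Q * L) ^ 2 ≤ 1 / 130) (t : ℕ) (i : Fin S.n) :
    L ^ 2 * S.drift P t i
      ≤ 21 / 10 * (L ^ 2 * secondMoment P fun ω => proj (S.state ω t).x i)
        + 19 * (S.ηa * S.Q * L) ^ 2 *
          (secondMoment P (fun ω => (S.state ω t).z i - gradient (S.f i) (S.xBar t ω))
            + secondMoment P (fun ω => proj ((S.state ω t).c + (S.state ω t).z) i) + S.mZ P t)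
        + 7 * (S.ηa * S.Q * L) ^ 2 * (σ ^ 2 / S.Q) := by
  have hQ : (0 : ℝ) < S.Q := Nat.cast_pos.2 h.Q_pos
  have hMle := secondMoment_gradient_add_c_le h t i
  have hstep : ∀ ℓ ∈ Finset.range S.Q,
      secondMoment P (fun ω => S.localIter t ℓ i ω - S.xBar t ω)
      ≤ 2 * secondMoment P (fun ω => proj (S.state ω t).x i)
        + 2 * (S.ηa ^ 2 * (3 * (S.Q ^ 2 * secondMoment P (fun ω =>
          gradient (S.f i) (S.xBar t ω) + (S.state ω t).c i)
        + S.Q ^ 2 * (L ^ 2 * S.drift P t i) + S.Q * σ ^ 2))) := fun ℓ hℓ => by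
    have hlt := Finset.mem_range.1 hℓ
    have h2 := secondMoment_add_le_two (adaptedL2_proj_x h t i).2
      ((memLp_localIter h t i hlt).sub ((adaptedL2_state h.oracle h.smooth t).1 i).2)
    have h3 : (fun ω => S.localIter t ℓ i ω - S.xBar t ω) = fun ω => proj (S.state ω t).x i +
        (S.localIter t ℓ i ω - (S.state ω t).x i) := by
      funext ω
      simp only [proj, xBar]
      abel
    rw [h3]
    exact h2.trans (by gcongr; exact secondMoment_localIter_sub_x_le h t i hlt)
  have hsum := Finset.sum_le_sum hstep
  rw [Finset.sum_const, Finset.card_range, nsmul_eq_mul] at hsum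
  have hd : ∑ ℓ ∈ Finset.range S.Q, secondMoment P (fun ω => S.localIter t ℓ i ω - S.xBar t ω)
      = S.Q * S.drift P t i := by rw [drift, mul_inv_cancel_left₀ hQ.ne']
  rw [hd] at hsum
  have hv0 := secondMoment_nonneg (P := P)
    fun ω => (S.state ω t).z i - gradient (S.f i) (S.xBar t ω)
  have hw0 := secondMoment_nonneg (P := P) fun ω => proj ((S.state ω t).c + (S.state ω t).z) i
  have hz0 : 0 ≤ S.mZ P t := secondMoment_nonneg _
  have hp0 := secondMoment_nonneg (P := P) fun ω => proj (S.state ω t).x i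
  have hd0 := drift_nonneg (S := S) (P := P) t i
  generalize secondMoment P (fun ω => gradient (S.f i) (S.xBar t ω) + (S.state ω t).c i) = M at *
  generalize secondMoment P (fun ω => (S.state ω t).z i - gradient (S.f i) (S.xBar t ω)) = v at *
  generalize secondMoment P (fun ω => proj ((S.state ω t).c + (S.state ω t).z) i) = w at *
  generalize secondMoment P (fun ω => proj (S.state ω t).x i) = px at *
  generalize S.mZ P t = z at *
  generalize S.drift P t i = d at *
  obtain ⟨a, haa⟩ : ∃ a, a = (S.ηa * S.Q * L) ^ 2 := ⟨_, rfl⟩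
  rw [← haa] at ha ⊢
  have ha0 : 0 ≤ a := haa ▸ sq_nonneg _
  have hD0 : 0 ≤ L ^ 2 * d := mul_nonneg (sq_nonneg _) hd0
  have hP0 : 0 ≤ L ^ 2 * px := mul_nonneg (sq_nonneg _) hp0
  have hmain : L ^ 2 * d ≤ 2 * (L ^ 2 * px) + 6 * a * M + 6 * a * (L ^ 2 * d)
      + 6 * a * (σ ^ 2 / S.Q) := by
    refine le_of_mul_le_mul_right ?_ hQ
    have h1 := mul_le_mul_of_nonneg_left hsum (sq_nonneg L)
    refine le_trans (le_of_eq ?_) (h1.trans (le_of_eq ?_))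
    · ring
    · rw [haa]; field_simp; ring
  have hs0 : 0 ≤ a * (σ ^ 2 / S.Q) := by positivity
  have hm0 : 0 ≤ a * (v + w + z) := by positivity
  have h1 : a * M ≤ a * (3 * (v + w + z)) := mul_le_mul_of_nonneg_left hMle ha0
  have h2 : a * (L ^ 2 * d) ≤ 1 / 130 * (L ^ 2 * d) := mul_le_mul_of_nonneg_right ha hD0
  linarith

theorem mS_le (ha : (S.ηa * S.Q * L) ^ 2 ≤ 1 / 130) (t : ℕ) :
    L ^ 2 * S.mS P t ≤ 21 / 10 * (L ^ 2 * S.mX P t)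
      + 19 * (S.ηa * S.Q * L) ^ 2 * (S.mV P t + S.mH P t + S.n * S.mZ P t)
      + 7 * (S.ηa * S.Q * L) ^ 2 * (S.n * (σ ^ 2 / S.Q)) := by
  have h1 := Finset.sum_le_sum fun i (_ : i ∈ Finset.univ) => drift_le h ha t i
  simp only [Finset.sum_add_distrib, ← Finset.mul_sum, Finset.sum_const, Finset.card_univ,
    Fintype.card_fin, nsmul_eq_mul] at h1
  exact h1.trans (le_of_eq (by simp only [mX, mV, mH]))

end Moments

end Setup


/-! ### One-round inequalities for the momentum and the objective. -/

namespace Setup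

set_option linter.unusedSectionVars false

variable {Ω Ξ : Type*} [mΩ : MeasurableSpace Ω] [MeasurableSpace Ξ] {S : Setup Ω Ξ}
  {P : Measure Ω} [IsProbabilityMeasure P] {σ L μ : ℝ}

section Moments

variable (h : S.Assumptions P σ L μ)

include h

/-- The objective lies between `f^*` and the quadratic upper bound given by the descent lemma at the
origin. -/
theorem integrable_obj {X : Ω → Vec S.p} (hX : MemLp X 2 P) :
    Integrable (fun ω => S.obj (X ω)) P := by
  have hd := differentiable_obj h.smooth
  have hlip := lipschitz_gradient_obj h.smooth h.n_pos
  have hb : Integrable (fun ω => |S.fStar| + (|S.obj 0| + ‖gradient S.obj 0‖ * ‖X ω‖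
      + L / 2 * ‖X ω‖ ^ 2)) P :=
    (integrable_const _).add (((integrable_const _).add
      ((hX.integrable one_le_two).norm.const_mul _)).add ((integrable_norm_sq hX).const_mul _))
  refine hb.mono' (hd.continuous.comp_aestronglyMeasurable hX.1)
    (Filter.Eventually.of_forall fun ω => ?_)
  have h1 := fStar_le h.smooth (X ω)
  have h2 := descent_lemma hd hlip 0 (X ω)
  have h3 := real_inner_le_norm (gradient S.obj 0) (X ω)
  rw [zero_add] at h2
  have h4 := neg_abs_le S.fStar
  have h5 := le_abs_self (S.obj 0)
  have h6 := abs_nonneg S.fStar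
  have h7 := abs_nonneg (S.obj 0)
  have h8 : 0 ≤ L / 2 * ‖X ω‖ ^ 2 := mul_nonneg (by linarith [h.L_pos]) (sq_nonneg _)
  have h9 : 0 ≤ ‖gradient S.obj 0‖ * ‖X ω‖ := by positivity
  rw [Real.norm_eq_abs, abs_le]
  constructor <;> linarith

theorem memLp_roundGrad (t : ℕ) (i : Fin S.n) : MemLp (fun ω => S.roundGrad t ω i) 2 P :=
  (memLp_finsetSum _ fun _ hℓ => (adaptedL2_stochGrad h.oracle h.smooth t i
    (Finset.mem_range.1 hℓ)).2).const_smul ((S.Q : ℝ)⁻¹)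

/-- The deviation `∇f_i(x̄_t) - z_i` is known when the round starts, hence orthogonal to the noise
of the round; only the bias is separated by a crude factor 2. -/
theorem secondMoment_zInc_le (t : ℕ) (i : Fin S.n) :
    secondMoment P (fun ω => S.zInc t ω i)
      ≤ 2 * (1 - S.β) ^ 2 * (secondMoment P (fun ω => (S.state ω t).z i
        - gradient (S.f i) (S.xBar t ω)) + σ ^ 2 / S.Q + L ^ 2 * S.drift P t i) := by
  have e : ∀ ω, S.zInc t ω i = (1 - S.β) • (((gradient (S.f i) (S.xBar t ω) - (S.state ω t).z i)
      + S.roundNoise t ω i) + S.roundBias t ω i) := fun ω => by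
    rw [zInc_eq h.Q_pos h.etaA_pos, Pi.smul_apply, Pi.sub_apply, roundGrad_eq h.Q_pos]
    congr 1
    abel
  have hU : AdaptedL2 (S.history t 0) P
      fun ω => gradient (S.f i) (S.xBar t ω) - (S.state ω t).z i :=
    (adaptedL2_gradient_xBar h t i).sub ((adaptedL2_state h.oracle h.smooth t).2.2.1 i)
  simp only [e]
  rw [secondMoment_smul, secondMoment_sub_comm (fun ω => (S.state ω t).z i)]
  have h1 := secondMoment_add_of_orthogonal hU.2 (memLp_roundNoise h t i)
    (integral_inner_roundNoise h hU i)
  have h2 := secondMoment_add_le_two (hU.2.add (memLp_roundNoise h t i)) (memLp_roundBias h t i)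
  have h3 := secondMoment_roundNoise_le h t i
  have h4 := secondMoment_roundBias_le h t i
  have h1' : secondMoment P ((fun ω => gradient (S.f i) (S.xBar t ω) - (S.state ω t).z i)
      + fun ω => S.roundNoise t ω i) = _ := h1
  simp only [Pi.add_apply] at h2
  rw [h1'] at h2
  calc _ ≤ (1 - S.β) ^ 2 * (2 * (secondMoment P (fun ω => gradient (S.f i) (S.xBar t ω)
        - (S.state ω t).z i) + σ ^ 2 / S.Q) + 2 * (L ^ 2 * S.drift P t i)) := by
        gcongr
        linarith
    _ = _ := by ring

/-- The momentum increments. -/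
theorem mG_le (t : ℕ) : S.mG P t
    ≤ 2 * (1 - S.β) ^ 2 * (S.mV P t + S.n * (σ ^ 2 / S.Q) + L ^ 2 * S.mS P t) := by
  have h1 := Finset.sum_le_sum fun i (_ : i ∈ Finset.univ) => secondMoment_zInc_le h t i
  simp only [← Finset.mul_sum, Finset.sum_add_distrib, Finset.sum_const, Finset.card_univ,
    Fintype.card_fin, nsmul_eq_mul] at h1
  refine le_trans ?_ h1
  rw [mG, ← integral_frobSq (memLp_proj (memLp_zInc h t)), ← integral_frobSq (memLp_zInc h t)]
  exact integral_mono (integrable_frobSq (memLp_proj (memLp_zInc h t)))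
    (integrable_frobSq (memLp_zInc h t)) fun ω => frobSq_proj_le h.n_pos _

/-- Young's inequality with parameter `δ = 1-β` separates the old deviation plus noise (orthogonal)
from the bias plus the change of gradient: `(1+δ)β² ≤ β`, while the remainder pays `1 + 1/δ`. The
change of gradient is at most `Lη̂‖z̄_{t+1}‖`. -/
theorem secondMoment_dev_succ_le (t : ℕ) (i : Fin S.n) :
    secondMoment P (fun ω => (S.state ω (t + 1)).z i - gradient (S.f i) (S.xBar (t + 1) ω))
      ≤ S.β * secondMoment P (fun ω => (S.state ω t).z i - gradient (S.f i) (S.xBar t ω))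
        + 2 * (1 - S.β) ^ 2 * (σ ^ 2 / S.Q) + 4 * (1 - S.β) * (L ^ 2 * S.drift P t i)
        + 4 * (L ^ 2 * S.etaHat ^ 2) / (1 - S.β) * S.mZ P (t + 1) := by
  have hβ0 := h.beta_pos
  have hβ1 : 0 < 1 - S.β := sub_pos.2 h.beta_lt_one
  have hU := adaptedL2_dev h t i
  have hN := memLp_roundNoise h t i
  have hB := memLp_roundBias h t i
  have hz' := (adaptedL2_zBar h (t + 1)).2
  have hgd : MemLp (fun ω => gradient (S.f i) (S.xBar t ω)
      - gradient (S.f i) (S.xBar (t + 1) ω)) 2 P :=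
    (adaptedL2_gradient_xBar h t i).2.sub (adaptedL2_gradient_xBar h (t + 1) i).2
  have e : (fun ω => (S.state ω (t + 1)).z i - gradient (S.f i) (S.xBar (t + 1) ω))
      = fun ω => (S.β • ((S.state ω t).z i - gradient (S.f i) (S.xBar t ω))
        + (1 - S.β) • S.roundNoise t ω i) + ((1 - S.β) • S.roundBias t ω i
        + (gradient (S.f i) (S.xBar t ω) - gradient (S.f i) (S.xBar (t + 1) ω))) := by
    funext ω
    rw [state_z_succ h.Q_pos h.etaA_pos, Pi.add_apply, Pi.smul_apply, Pi.smul_apply,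
      roundGrad_eq h.Q_pos]
    module
  have h1 : secondMoment P (fun ω => S.β • ((S.state ω t).z i - gradient (S.f i) (S.xBar t ω))
        + (1 - S.β) • S.roundNoise t ω i) = S.β ^ 2 * secondMoment P (fun ω => (S.state ω t).z i
        - gradient (S.f i) (S.xBar t ω)) + (1 - S.β) ^ 2 *
          secondMoment P (fun ω => S.roundNoise t ω i) := by
    rw [← secondMoment_smul, ← secondMoment_smul]
    refine secondMoment_add_of_orthogonal (hU.2.const_smul S.β) (hN.const_smul (1 - S.β)) ?_
    simp only [inner_smul_right]
    rw [integral_const_mul, integral_inner_roundNoise h (hU.const_smul S.β) i, mul_zero]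
  have h2 : secondMoment P (fun ω => (1 - S.β) • S.roundBias t ω i
        + (gradient (S.f i) (S.xBar t ω) - gradient (S.f i) (S.xBar (t + 1) ω)))
      ≤ 2 * ((1 - S.β) ^ 2 * (L ^ 2 * S.drift P t i))
        + 2 * (L ^ 2 * (S.etaHat ^ 2 * S.mZ P (t + 1))) := by
    refine (secondMoment_add_le_two (hB.const_smul (1 - S.β)) hgd).trans (add_le_add ?_ ?_)
    · have := secondMoment_smul (P := P) (1 - S.β) fun ω => S.roundBias t ω i
      refine mul_le_mul_of_nonneg_left ((le_of_eq this).trans ?_) zero_le_two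
      exact mul_le_mul_of_nonneg_left (secondMoment_roundBias_le h t i) (sq_nonneg _)
    · refine mul_le_mul_of_nonneg_left ?_ zero_le_two
      refine (secondMoment_mono hgd (hz'.const_smul S.etaHat) fun ω => ?_).trans
        (mul_le_mul_of_nonneg_left (le_of_eq (secondMoment_smul _ _)) (sq_nonneg L))
      have := h.smooth.lipschitz i (S.xBar t ω) (S.xBar (t + 1) ω)
      rwa [xBar_succ h.network, sub_sub_cancel, ← xBar_succ h.network] at this
  have h3 := secondMoment_add_le ((hU.2.const_smul S.β).add (hN.const_smul (1 - S.β)))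
    ((hB.const_smul (1 - S.β)).add hgd) hβ1
  rw [e]
  refine h3.trans ?_
  have h1' := le_of_eq h1
  have hv0 := secondMoment_nonneg (P := P)
    fun ω => (S.state ω t).z i - gradient (S.f i) (S.xBar t ω)
  have hd0 := drift_nonneg (S := S) (P := P) t i
  have hz0 : 0 ≤ S.mZ P (t + 1) := secondMoment_nonneg _
  have hs := secondMoment_roundNoise_le h t i
  have hs0 := secondMoment_nonneg (P := P) fun ω => S.roundNoise t ω i
  refine (add_le_add (mul_le_mul_of_nonneg_left h1' (by linarith))
    (mul_le_mul_of_nonneg_left h2 (by positivity))).trans ?_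
  generalize secondMoment P (fun ω => (S.state ω t).z i - gradient (S.f i) (S.xBar t ω)) = v at *
  generalize secondMoment P (fun ω => S.roundNoise t ω i) = s at *
  generalize S.mZ P (t + 1) = z at *
  generalize S.drift P t i = d at *
  obtain ⟨δ, hδ⟩ : ∃ δ, δ = 1 - S.β := ⟨_, rfl⟩
  have hβ : S.β = 1 - δ := by linarith
  rw [← hδ] at hβ1 ⊢
  rw [hβ] at hβ0 ⊢
  have i1 : (1 + δ) * (1 - δ) ^ 2 * v ≤ (1 - δ) * v := by
    refine mul_le_mul_of_nonneg_right ?_ hv0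
    nlinarith [mul_pos hβ0 (pow_pos hβ1 2)]
  have i2 : (1 + δ) * δ ^ 2 * s ≤ 2 * δ ^ 2 * (σ ^ 2 / S.Q) := by
    refine mul_le_mul ?_ hs hs0 (by positivity)
    exact mul_le_mul_of_nonneg_right (by linarith) (sq_nonneg _)
  have i3 : (1 + 1 / δ) * (2 * (δ ^ 2 * (L ^ 2 * d))) ≤ 4 * δ * (L ^ 2 * d) := by
    have : (1 + 1 / δ) * (2 * (δ ^ 2 * (L ^ 2 * d))) = 2 * (1 + δ) * δ * (L ^ 2 * d) := by
      field_simp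
      ring
    rw [this]
    have : 0 ≤ δ * (L ^ 2 * d) := by positivity
    nlinarith
  have i4 : (1 + 1 / δ) * (2 * (L ^ 2 * (S.etaHat ^ 2 * z)))
      ≤ 4 * (L ^ 2 * S.etaHat ^ 2) / δ * z := by
    have : (1 + 1 / δ) * (2 * (L ^ 2 * (S.etaHat ^ 2 * z)))
        = 2 * (1 + δ) * ((L ^ 2 * S.etaHat ^ 2) / δ * z) := by field_simp; ring
    rw [this, show 4 * (L ^ 2 * S.etaHat ^ 2) / δ * z
      = 4 * ((L ^ 2 * S.etaHat ^ 2) / δ * z) by ring]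
    have : 0 ≤ (L ^ 2 * S.etaHat ^ 2) / δ * z := by positivity
    exact mul_le_mul_of_nonneg_right (by linarith) this
  linarith

/-- The deviation of the momentum from the local gradients. -/
theorem mV_succ_le (t : ℕ) : S.mV P (t + 1) ≤ S.β * S.mV P t
    + 2 * (1 - S.β) ^ 2 * (S.n * (σ ^ 2 / S.Q)) + 4 * (1 - S.β) * (L ^ 2 * S.mS P t)
    + 4 * (L ^ 2 * S.etaHat ^ 2) / (1 - S.β) * (S.n * S.mZ P (t + 1)) := by
  have h1 := Finset.sum_le_sum fun i (_ : i ∈ Finset.univ) => secondMoment_dev_succ_le h t i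
  simp only [← Finset.mul_sum, Finset.sum_add_distrib, Finset.sum_const, Finset.card_univ,
    Fintype.card_fin, nsmul_eq_mul] at h1
  refine h1.trans (le_of_eq ?_)
  simp only [mV, mS]

/-- The bias of the average update direction with respect to the auxiliary point. -/
theorem avg_roundGrad_eq (t : ℕ) (ω : Ω) : avg (S.roundGrad t ω)
    = (gradient S.obj (S.dBar t ω) + avg (S.roundNoise t ω))
      + ((gradient S.obj (S.xBar t ω) - gradient S.obj (S.dBar t ω))
        + avg (S.roundBias t ω)) := by
  have e : S.roundGrad t ω = (fun i => gradient (S.f i) (S.xBar t ω)) + S.roundBias t ω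
      + S.roundNoise t ω := funext fun i => roundGrad_eq h.Q_pos t ω i
  rw [e, avg_add, avg_add, ← gradient_obj h.smooth]
  abel

theorem memLp_avgBias (t : ℕ) : MemLp (fun ω =>
    (gradient S.obj (S.xBar t ω) - gradient S.obj (S.dBar t ω)) + avg (S.roundBias t ω)) 2 P :=
  ((adaptedL2_gradient_obj h (adaptedL2_xBar h t)).2.sub
    (adaptedL2_gradient_obj h (adaptedL2_dBar h t)).2).add (memLp_avg (memLp_roundBias h t))

/-- The distance from `d̄` to `x̄` is `η̂β/(1-β)‖z̄‖`, where `β ≤ 1` is dropped; the mean of the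
biases is bounded by Jensen. -/
theorem secondMoment_avgBias_le (t : ℕ) : secondMoment P (fun ω =>
    (gradient S.obj (S.xBar t ω) - gradient S.obj (S.dBar t ω)) + avg (S.roundBias t ω))
    ≤ 2 * ((S.etaHat * L / (1 - S.β)) ^ 2 * S.mZ P t + L ^ 2 * S.mS P t / S.n) := by
  have hβ0 := h.beta_pos
  have hβ1 : 0 < 1 - S.β := sub_pos.2 h.beta_lt_one
  have hn : (0 : ℝ) < S.n := Nat.cast_pos.2 h.n_pos
  have hη := h.etaHat_pos
  have hL := h.L_pos
  have h1 : MemLp (fun ω => gradient S.obj (S.xBar t ω) - gradient S.obj (S.dBar t ω)) 2 P :=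
    (adaptedL2_gradient_obj h (adaptedL2_xBar h t)).2.sub
      (adaptedL2_gradient_obj h (adaptedL2_dBar h t)).2
  refine (secondMoment_add_le_two h1 (memLp_avg (memLp_roundBias h t))).trans ?_
  rw [mul_add]
  refine add_le_add (mul_le_mul_of_nonneg_left ?_ zero_le_two)
    (mul_le_mul_of_nonneg_left ?_ zero_le_two)
  · refine secondMoment_mono h1 (adaptedL2_zBar h t).2 fun ω => ?_
    refine (lipschitz_gradient_obj h.smooth h.n_pos _ _).trans ?_
    rw [dBar, sub_sub_cancel, norm_smul, Real.norm_eq_abs, abs_of_nonneg (by positivity),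
      ← mul_assoc]
    refine mul_le_mul_of_nonneg_right ?_ (norm_nonneg _)
    rw [mul_div_assoc', mul_comm L]
    refine div_le_div_of_nonneg_right ?_ hβ1.le
    nlinarith [mul_pos hη hL, h.beta_lt_one]
  · rw [le_div_iff₀ hn, mul_comm]
    refine (card_mul_secondMoment_avg_le h.n_pos (memLp_roundBias h t)).trans ?_
    rw [mS, Finset.mul_sum]
    exact Finset.sum_le_sum fun i _ => secondMoment_roundBias_le h t i

/-- The second moment of the average momentum. -/
theorem mZ_succ_le (t : ℕ) : S.mZ P (t + 1) ≤ S.β * S.mZ P t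
    + 2 * (1 - S.β) ^ 2 * (σ ^ 2 / (S.n * S.Q)) + 4 * (1 - S.β) * S.mM P t
    + 8 * (1 - S.β) * ((S.etaHat * L / (1 - S.β)) ^ 2 * S.mZ P t + L ^ 2 * S.mS P t / S.n) := by
  have hβ0 := h.beta_pos
  have hβ1 : 0 < 1 - S.β := sub_pos.2 h.beta_lt_one
  have hz := adaptedL2_zBar h t
  have hN := memLp_avg (memLp_roundNoise h t)
  have hg := adaptedL2_gradient_obj h (adaptedL2_dBar h t)
  have hE := memLp_avgBias h t
  have e : S.zBar (t + 1) = fun ω => (S.β • S.zBar t ω + (1 - S.β) • avg (S.roundNoise t ω))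
      + (1 - S.β) • (gradient S.obj (S.dBar t ω)
        + ((gradient S.obj (S.xBar t ω) - gradient S.obj (S.dBar t ω))
        + avg (S.roundBias t ω))) := by
    funext ω
    rw [zBar_succ h.Q_pos h.etaA_pos, avg_roundGrad_eq h]
    module
  have h1 : secondMoment P (fun ω => S.β • S.zBar t ω + (1 - S.β) • avg (S.roundNoise t ω))
      = S.β ^ 2 * S.mZ P t + (1 - S.β) ^ 2 * secondMoment P (fun ω => avg (S.roundNoise t ω)) := by
    rw [mZ, ← secondMoment_smul, ← secondMoment_smul]
    refine secondMoment_add_of_orthogonal (hz.2.const_smul S.β) (hN.const_smul (1 - S.β)) ?_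
    simp only [inner_smul_right]
    rw [integral_const_mul, integral_inner_avg_roundNoise h (hz.const_smul S.β), mul_zero]
  have h2 := secondMoment_add_le_two hg.2 hE
  have h3 := secondMoment_add_le ((hz.2.const_smul S.β).add (hN.const_smul (1 - S.β)))
    -- Young's parameter is again `1-β`, so that the factor on `‖z̄_t‖²` falls from `(1+δ)β²` to
    -- `β`.
    ((hg.2.add hE).const_smul (1 - S.β)) hβ1
  have h4 := secondMoment_smul (P := P) (1 - S.β) fun ω => gradient S.obj (S.dBar t ω)
    + ((gradient S.obj (S.xBar t ω) - gradient S.obj (S.dBar t ω)) + avg (S.roundBias t ω))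
  have h5 := secondMoment_avgBias_le h t
  rw [mZ, e]
  refine h3.trans ?_
  refine (add_le_add (mul_le_mul_of_nonneg_left (le_of_eq h1) (by linarith))
    (mul_le_mul_of_nonneg_left ((le_of_eq h4).trans (mul_le_mul_of_nonneg_left (h2.trans
      (add_le_add_right (mul_le_mul_of_nonneg_left h5 zero_le_two) _)) (sq_nonneg _)))
      (by positivity))).trans ?_
  have hz0 : 0 ≤ S.mZ P t := secondMoment_nonneg _
  have hM0 : 0 ≤ secondMoment P fun ω => gradient S.obj (S.dBar t ω) := secondMoment_nonneg _
  have hs := secondMoment_avg_roundNoise_le h t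
  have hs0 := secondMoment_nonneg (P := P) fun ω => avg (S.roundNoise t ω)
  have hE0 : 0 ≤ (S.etaHat * L / (1 - S.β)) ^ 2 * S.mZ P t + L ^ 2 * S.mS P t / S.n := by
    linarith [secondMoment_nonneg (P := P) fun ω => (gradient S.obj (S.xBar t ω)
      - gradient S.obj (S.dBar t ω)) + avg (S.roundBias t ω)]
  rw [mM]
  generalize (S.etaHat * L / (1 - S.β)) ^ 2 * S.mZ P t + L ^ 2 * S.mS P t / S.n = E at *
  generalize S.mZ P t = z at *
  generalize secondMoment P (fun ω => gradient S.obj (S.dBar t ω)) = M at *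
  generalize secondMoment P (fun ω => avg (S.roundNoise t ω)) = s at *
  obtain ⟨δ, hδ⟩ : ∃ δ, δ = 1 - S.β := ⟨_, rfl⟩
  have hβ : S.β = 1 - δ := by linarith
  rw [← hδ] at hβ1 ⊢
  rw [hβ] at hβ0 ⊢
  have i1 : (1 + δ) * (1 - δ) ^ 2 * z ≤ (1 - δ) * z := by
    refine mul_le_mul_of_nonneg_right ?_ hz0
    nlinarith [mul_pos hβ0 (pow_pos hβ1 2)]
  have i2 : (1 + δ) * δ ^ 2 * s ≤ 2 * δ ^ 2 * (σ ^ 2 / (S.n * S.Q)) := by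
    refine mul_le_mul ?_ hs hs0 (by positivity)
    exact mul_le_mul_of_nonneg_right (by linarith) (sq_nonneg _)
  have i3 : (1 + 1 / δ) * (δ ^ 2 * (2 * M + 2 * (2 * E))) ≤ 4 * δ * M + 8 * δ * E := by
    have : (1 + 1 / δ) * (δ ^ 2 * (2 * M + 2 * (2 * E))) = (1 + δ) * δ * (2 * M + 2 * (2 * E)) := by
      field_simp
      ring
    rw [this]
    have : 0 ≤ δ * (2 * M + 2 * (2 * E)) := by positivity
    nlinarith
  linarith

/-- The expected decrease of the objective at the auxiliary point. -/
theorem mD_succ_le (t : ℕ) : S.mD P (t + 1) ≤ S.mD P t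
    - S.etaHat * (1 / 2 - L * S.etaHat) * S.mM P t
    + S.etaHat * (1 + 2 * (L * S.etaHat)) *
      ((S.etaHat * L / (1 - S.β)) ^ 2 * S.mZ P t + L ^ 2 * S.mS P t / S.n)
    + L * S.etaHat ^ 2 * (σ ^ 2 / (S.n * S.Q)) := by
  have hη := h.etaHat_pos
  have hL := h.L_pos
  have hN := memLp_avg (memLp_roundNoise h t)
  have hg := adaptedL2_gradient_obj h (adaptedL2_dBar h t)
  have hE := memLp_avgBias h t
  have hr := memLp_avg (memLp_roundGrad h t)
  have hf := integrable_obj h (adaptedL2_dBar h t).2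
  have hf' := integrable_obj h (adaptedL2_dBar h (t + 1)).2
  have i1 := integrable_inner hg.2 hr
  have i2 := integrable_norm_sq hr
  have h0 : S.mD P (t + 1) ≤ S.mD P t
      - S.etaHat * ∫ ω, inner ℝ (gradient S.obj (S.dBar t ω)) (avg (S.roundGrad t ω)) ∂P
      + L / 2 * S.etaHat ^ 2 * secondMoment P fun ω => avg (S.roundGrad t ω) := by
    have k1 : Integrable (fun ω => S.obj (S.dBar t ω) - S.fStar) P := hf.sub (integrable_const _)
    have k2 : Integrable (fun ω => S.obj (S.dBar t ω) - S.fStar - S.etaHat *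
      inner ℝ (gradient S.obj (S.dBar t ω)) (avg (S.roundGrad t ω))) P := k1.sub (i1.const_mul _)
    rw [mD, mD, secondMoment, ← integral_const_mul, ← integral_const_mul,
      ← integral_sub k1 (i1.const_mul _), ← integral_add k2 (i2.const_mul _)]
    refine integral_mono (hf'.sub (integrable_const _)) (k2.add (i2.const_mul _)) fun ω => ?_
    have := descent_lemma (differentiable_obj h.smooth) (lipschitz_gradient_obj h.smooth h.n_pos)
      (S.dBar t ω) (-(S.etaHat • avg (S.roundGrad t ω)))
    rw [← sub_eq_add_neg, ← dBar_succ h.network h.Q_pos h.etaA_pos h.beta_lt_one, inner_neg_right,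
      inner_smul_right, norm_neg, norm_smul, mul_pow, Real.norm_eq_abs, sq_abs] at this
    simp only
    linarith
  have e : (fun ω => avg (S.roundGrad t ω)) = fun ω => (gradient S.obj (S.dBar t ω)
      + avg (S.roundNoise t ω)) + ((gradient S.obj (S.xBar t ω) - gradient S.obj (S.dBar t ω))
        + avg (S.roundBias t ω)) := funext fun ω => avg_roundGrad_eq h t ω
  have h1 := secondMoment_add_of_orthogonal hg.2 hN (integral_inner_avg_roundNoise h hg)
  have h2 := secondMoment_add_le_two (hg.2.add hN) hE
  have h3 := secondMoment_avgBias_le h t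
  have h4 := secondMoment_avg_roundNoise_le h t
  have h2' : secondMoment P (fun ω => avg (S.roundGrad t ω)) ≤ 2 * (S.mM P t
      + σ ^ 2 / (S.n * S.Q)) + 4 * ((S.etaHat * L / (1 - S.β)) ^ 2 * S.mZ P t
        + L ^ 2 * S.mS P t / S.n) := by
    rw [e]
    refine h2.trans ?_
    have h1' : secondMoment P ((fun ω => gradient S.obj (S.dBar t ω))
        + fun ω => avg (S.roundNoise t ω)) = _ := h1
    rw [h1']
    change 2 * (S.mM P t + _) + _ ≤ _
    linarith
  have h5 : S.mM P t / 2 - ((S.etaHat * L / (1 - S.β)) ^ 2 * S.mZ P t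
      + L ^ 2 * S.mS P t / S.n)
      ≤ ∫ ω, inner ℝ (gradient S.obj (S.dBar t ω)) (avg (S.roundGrad t ω)) ∂P := by
    have e' : ∀ ω, inner ℝ (gradient S.obj (S.dBar t ω)) (avg (S.roundGrad t ω))
        = ‖gradient S.obj (S.dBar t ω)‖ ^ 2
          + inner ℝ (gradient S.obj (S.dBar t ω)) (avg (S.roundNoise t ω))
          + inner ℝ (gradient S.obj (S.dBar t ω)) ((gradient S.obj (S.xBar t ω)
            - gradient S.obj (S.dBar t ω)) + avg (S.roundBias t ω)) := fun ω => by
      rw [avg_roundGrad_eq h, inner_add_right, inner_add_right, real_inner_self_eq_norm_sq]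
    have j1 := integrable_norm_sq hg.2
    have j2 := integrable_inner hg.2 hN
    have j3 := integrable_inner hg.2 hE
    have j12 : Integrable (fun ω => ‖gradient S.obj (S.dBar t ω)‖ ^ 2
      + inner ℝ (gradient S.obj (S.dBar t ω)) (avg (S.roundNoise t ω))) P := j1.add j2
    -- Half of `‖∇f(d̄)‖²` is given up to absorb the bias through `⟨g,E⟩ ≥ -(‖g‖²+‖E‖²)/2`; the
    -- noise term integrates to zero.
    have k : -(1 / 2 * S.mM P t + 1 / 2 * secondMoment P (fun ω => (gradient S.obj (S.xBar t ω)
            - gradient S.obj (S.dBar t ω)) + avg (S.roundBias t ω)))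
        ≤ ∫ ω, inner ℝ (gradient S.obj (S.dBar t ω)) ((gradient S.obj (S.xBar t ω)
            - gradient S.obj (S.dBar t ω)) + avg (S.roundBias t ω)) ∂P := by
      rw [mM, secondMoment, secondMoment, ← integral_const_mul, ← integral_const_mul,
        ← integral_add (j1.const_mul _) ((integrable_norm_sq hE).const_mul _), ← integral_neg]
      refine integral_mono ((j1.const_mul _).add ((integrable_norm_sq hE).const_mul _)).neg j3
        fun ω => ?_
      have := norm_add_sq_real (gradient S.obj (S.dBar t ω)) ((gradient S.obj (S.xBar t ω)
            - gradient S.obj (S.dBar t ω)) + avg (S.roundBias t ω))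
      have h0 := sq_nonneg ‖gradient S.obj (S.dBar t ω) + ((gradient S.obj (S.xBar t ω)
            - gradient S.obj (S.dBar t ω)) + avg (S.roundBias t ω))‖
      simp only
      linarith
    simp only [e']
    rw [integral_add j12 j3, integral_add j1 j2, integral_inner_avg_roundNoise h hg, add_zero]
    change _ ≤ S.mM P t + _
    linarith
  refine h0.trans ?_
  have h6 := mul_le_mul_of_nonneg_left h5 hη.le
  have h7 := mul_le_mul_of_nonneg_left h2' (show 0 ≤ L / 2 * S.etaHat ^ 2 by positivity)
  linarith

end Moments

end Setup


/-! ### Scalar Lyapunov analysis. -/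

/-- The network part of the Lyapunov functions. -/
def netEnergy (k a x Y V Z : ℝ) : ℝ := k * x + 9 * a * k * Y + 135 * a * V + 5 * a * Z

/-- One-round contraction of the network part of the Lyapunov functions. -/
theorem netEnergy_step {k δ γ a e s sn x Y V Z M S G x' Y' V' Z' : ℝ}
    (hk1 : k ≤ 1) (hδ : 0 < δ) (hδ1 : δ ≤ 1) (hδγ : δ ≤ γ) (hkγ : δ ≤ k * γ)
    (ha : 0 ≤ a) (ha1 : a ≤ 1 / 397350) (he : 0 ≤ e) (he1 : 210 * e ≤ a)
    (hs : 0 ≤ s) (hsn : sn ≤ s) (hx : 0 ≤ x) (hY : 0 ≤ Y) (hV : 0 ≤ V)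
    (hZ : 0 ≤ Z) (hM : 0 ≤ M) (hS : 0 ≤ S) (hG : 0 ≤ G)
    (hSle : S ≤ 21 / 10 * x + 19 * a * (V + Y + Z) + 7 * a * s)
    (hGle : G ≤ 2 * δ ^ 2 * (V + s + S))
    (hZ' : Z' ≤ (1 - δ) * Z + 2 * δ ^ 2 * sn + 4 * δ * M + 8 * δ * (e * Z + S))
    (hV' : V' ≤ (1 - δ) * V + 2 * δ ^ 2 * s + 4 * δ * S + 4 * δ * e * Z')
    (hY' : Y' ≤ (1 - γ) * Y + 2 / γ * G)
    (hx' : x' ≤ (1 - γ) * x + 4 * δ ^ 2 * e / γ * (Y + G)) :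
    netEnergy k a x' Y' V' Z' ≤ (1 - 7 / 10 * δ) * netEnergy k a x Y V Z
      - 29 / 100 * (δ * x) - 26 / 10 * (a * δ * Y) + 21 * (a * δ * M) + 320 * (a * δ * s) := by
  have hγ : 0 < γ := hδ.trans_le hδγ
  have hk : 0 < k := (pos_iff_pos_of_mul_pos (hδ.trans_le hkγ)).2 hγ
  have hkδ : k * δ ≤ δ := mul_le_of_le_one_left hδ.le hk1
  have hδ2 : δ ^ 2 ≤ δ := by
    rw [sq]
    exact mul_le_of_le_one_left hδ.le hδ1
  -- The gossip bound divides by the gap `γ`; the increments carry `δ²`, and `δ ≤ γ` leaves one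
  -- factor `δ`.
  have hkd : k * (δ ^ 2 / γ) ≤ δ := by
    rw [mul_div_assoc', div_le_iff₀ hγ]
    calc k * δ ^ 2 ≤ 1 * δ ^ 2 := by gcongr
      _ = δ * δ := by ring
      _ ≤ δ * γ := by gcongr
  have hGle2 : G ≤ 2 * (V + s + S) := by
    have h1 : 2 * δ ^ 2 * (V + s + S) ≤ 2 * 1 * (V + s + S) := by
      gcongr
      exact hδ2.trans hδ1
    linarith
  -- The available decay `kγx ≥ δx` is divided: 7/10 becomes the contraction and 3/10 is kept to
  -- absorb the drift terms. The same split is used for `Y`.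
  have hx1 : k * x' ≤ k * x - 7 / 10 * δ * (k * x) - 3 / 10 * (δ * x) + 4 * δ * e * (Y + G) := by
    have h1 := mul_le_mul_of_nonneg_left hx' hk.le
    have h2 : k * (4 * δ ^ 2 * e / γ * (Y + G)) = 4 * (k * (δ ^ 2 / γ)) * (e * (Y + G)) := by ring
    have h3 : 4 * (k * (δ ^ 2 / γ)) * (e * (Y + G)) ≤ 4 * δ * (e * (Y + G)) := by gcongr
    have h4 := mul_le_mul_of_nonneg_right hkγ hx
    have h5 := mul_le_mul_of_nonneg_right hkδ hx
    linarith
  have hY1 : k * Y' ≤ k * Y - 7 / 10 * δ * (k * Y) - 3 / 10 * (δ * Y) + 4 * δ * (V + s + S) := by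
    have h1 := mul_le_mul_of_nonneg_left hY' hk.le
    have h2 : k * (2 / γ * G) ≤ k * (2 / γ * (2 * δ ^ 2 * (V + s + S))) := by gcongr
    have h2' : k * (2 / γ * (2 * δ ^ 2 * (V + s + S)))
        = 4 * (k * (δ ^ 2 / γ)) * (V + s + S) := by ring
    have h3 : 4 * (k * (δ ^ 2 / γ)) * (V + s + S) ≤ 4 * δ * (V + s + S) := by gcongr
    have h4 := mul_le_mul_of_nonneg_right hkγ hY
    have h5 := mul_le_mul_of_nonneg_right hkδ hY
    linarith
  have he2 : e ≤ 1 / 80000000 := by linarith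
  have hZ1 : Z' ≤ 2 * Z + 2 * s + 4 * M + 8 * S := by
    have h1 : δ ^ 2 * sn ≤ 1 * s := by
      calc δ ^ 2 * sn ≤ δ ^ 2 * s := by gcongr
        _ ≤ 1 * s := by gcongr; exact hδ2.trans hδ1
    have h2 : δ * M ≤ 1 * M := by gcongr
    have h3 : δ * (e * Z + S) ≤ 1 * (e * Z + S) := by gcongr
    have h4 : e * Z ≤ 1 / 80000000 * Z := by gcongr
    have h5 : 0 ≤ δ * Z := by positivity
    linarith
  have haδ : 0 ≤ a * δ := by positivity
  have hV1 : a * V' ≤ a * V - a * δ * V + 2 * (a * δ * s) + 4 * (a * δ * S)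
      + 1 / 1000 * (a * δ * (Z + s + M + S)) := by
    have h1 := mul_le_mul_of_nonneg_left hV' ha
    have h2 : a * (4 * δ * e * Z') ≤ 1 / 1000 * (a * δ * (Z + s + M + S)) := by
      have : a * (4 * δ * e * Z') ≤ a * (4 * δ * e * (2 * Z + 2 * s + 4 * M + 8 * S)) := by gcongr
      refine this.trans ?_
      have h3 : e * (2 * Z + 2 * s + 4 * M + 8 * S) ≤ 1 / 4000 * (Z + s + M + S) := by
        have : e * (2 * Z + 2 * s + 4 * M + 8 * S)
          ≤ 1 / 80000000 * (2 * Z + 2 * s + 4 * M + 8 * S) := by gcongr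
        linarith
      have h5 := mul_le_mul_of_nonneg_left h3 haδ
      linarith
    have h4 : a * (δ ^ 2 * s) ≤ a * (δ * s) := by gcongr
    linarith
  have hZ2 : a * Z' ≤ a * Z - a * δ * Z + 2 * (a * δ * s) + 4 * (a * δ * M) + 8 * (a * δ * S)
      + 1 / 1000 * (a * δ * Z) := by
    have h1 := mul_le_mul_of_nonneg_left hZ' ha
    have h2 : a * (δ ^ 2 * sn) ≤ a * (δ * s) := by
      refine mul_le_mul_of_nonneg_left ?_ ha
      calc δ ^ 2 * sn ≤ δ ^ 2 * s := by gcongr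
        _ ≤ δ * s := by gcongr
    have h3 : a * δ * (e * Z) ≤ a * δ * (1 / 80000000 * Z) := by gcongr
    have h4 : 0 ≤ a * δ * Z := by positivity
    linarith
  have hx2 : δ * e * (Y + G) ≤ 1 / 210 * (a * δ * Y) + 2 / 210 * (a * δ * (V + s + S)) := by
    have h1 : δ * e * (Y + G) ≤ δ * e * (Y + 2 * (V + s + S)) := by gcongr
    have h2 : δ * (210 * e) * (Y + 2 * (V + s + S)) ≤ δ * a * (Y + 2 * (V + s + S)) := by gcongr
    linarith
  have hY2 := mul_le_mul_of_nonneg_left hY1 ha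
  have hS2 := mul_le_mul_of_nonneg_left hSle haδ
  have h1 : a * δ * (a * (V + Y + Z)) ≤ 1 / 397350 * (a * δ * (V + Y + Z)) := by
    have : a * (a * δ * (V + Y + Z)) ≤ 1 / 397350 * (a * δ * (V + Y + Z)) := by gcongr
    linarith
  have h2 : a * δ * (a * s) ≤ 1 / 397350 * (a * δ * s) := by
    have : a * (a * δ * s) ≤ 1 / 397350 * (a * δ * s) := by gcongr
    linarith
  have h3 : a * δ * x ≤ 1 / 397350 * (δ * x) := by
    have : a * (δ * x) ≤ 1 / 397350 * (δ * x) := by gcongr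
    linarith
  have p1 : 0 ≤ a * δ * Y := by positivity
  have p2 : 0 ≤ a * δ * V := by positivity
  have p3 : 0 ≤ a * δ * Z := by positivity
  have p4 : 0 ≤ a * δ * s := by positivity
  have p5 : 0 ≤ a * δ * M := by positivity
  have p6 : 0 ≤ δ * x := by positivity
  -- The weights are fixed by these balances: `Y` receives `4δV`, and `9·4 = 36` is below the spare
  -- decay `135·3/10` of `V`; `M` enters with `5·4`, hence 21; `s` enters with `9·4 + 135·2 + 5·2 =
  -- 316`, hence 320. All contributions through `S` are of order `1/397350` or are taken from the
  -- reserved 3/10.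
  simp only [netEnergy]
  linarith

/-- One-round decrease of the Lyapunov function with the objective. -/
theorem lyapunov_step {δ γ η L μ a e s sn D M x Y V Z S h h' D' : ℝ}
    (hδ : 0 < δ) (hδ1 : δ ≤ 1) (hη : 0 < η) (hμ : 0 < μ) (hμL : μ ≤ L) (hηL : L * η ≤ δ / 9000)
    (ha : 0 ≤ a) (ha1 : a ≤ 1 / 397350) (he1 : 210 * e ≤ a)
    (hs : 0 ≤ s) (hx : 0 ≤ x) (hY : 0 ≤ Y) (hV : 0 ≤ V)
    (hZ : 0 ≤ Z) (hM : 0 ≤ M) (hS : 0 ≤ S) (he : 0 ≤ e) (hγ : 0 < γ)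
    (hSle : S ≤ 21 / 10 * x + 19 * a * (V + Y + Z) + 7 * a * s)
    (hD' : D' ≤ D - η * (1 / 2 - L * η) * M + η * (1 + 2 * (L * η)) * (e * Z + S)
      + L * η ^ 2 * sn)
    (hPL : 2 * μ * D ≤ M) (hh : h = netEnergy (δ / γ) a x Y V Z)
    (hh' : h' ≤ (1 - 7 / 10 * δ) * h - 29 / 100 * (δ * x) - 26 / 10 * (a * δ * Y)
      + 21 * (a * δ * M) + 320 * (a * δ * s)) :
    D' + 9 * (η / δ) * h' ≤ (1 - 2 / 3 * (η * μ)) * (D + 9 * (η / δ) * h)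
      + (L * η ^ 2 * sn + 2900 * (a * η * s)) := by
  have hh0 : 135 * (a * V) + 5 * (a * Z) ≤ h := by
    rw [hh, netEnergy]
    have : 0 ≤ δ / γ * x + 9 * a * (δ / γ) * Y := by positivity
    linarith
  have hh00 : 0 ≤ h := le_trans (by positivity) hh0
  have hLη : L * η ≤ 1 / 9000 := by linarith
  have hLη0 : 0 ≤ L * η := mul_nonneg (hμ.le.trans hμL) hη.le
  -- The weight `9η/δ` turns the reserve `(29/100)δx` into `2.61 ηx`, more than the `(21/10)ηx`
  -- (times 101/100) that the drift brings into the descent inequality; the reserve for `Y` works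
  -- likewise.
  have h1 : 9 * (η / δ) * h' ≤ 9 * (η / δ) * h - 63 / 10 * (η * h) - 261 / 100 * (η * x)
      - 234 / 10 * (a * η * Y) + 189 * (a * η * M) + 2880 * (a * η * s) := by
    have := mul_le_mul_of_nonneg_left hh' (show 0 ≤ 9 * (η / δ) by positivity)
    refine this.trans (le_of_eq ?_)
    field_simp
    ring
  have h2 : η * (1 + 2 * (L * η)) * (e * Z + S) ≤ 101 / 100 * (η * (e * Z + S)) := by
    have p : 0 ≤ η * (e * Z + S) := by positivity
    have := mul_le_mul_of_nonneg_right hLη p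
    linarith
  have h3 : η * S ≤ η * (21 / 10 * x + 19 * a * (V + Y + Z) + 7 * a * s) := by gcongr
  have h4 : η * (210 * e) * Z ≤ η * a * Z := by gcongr
  have h5 : η * (1 / 2 - L * η) * M ≥ 49 / 100 * (η * M) := by
    have p : 0 ≤ η * M := by positivity
    have := mul_le_mul_of_nonneg_right hLη p
    linarith
  have h6 : a * η * M ≤ 1 / 397350 * (η * M) := by
    have : a * (η * M) ≤ 1 / 397350 * (η * M) := by gcongr
    linarith
  have h7 : η * (2 * μ * D) ≤ η * M := by gcongr
  -- The network part must contract at the slower rate `(2/3)ημ`. This costs a negligible part of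
  -- `(63/10)ηh`, and the rest absorbs the `V` and `Z` terms of the drift.
  have h8 : η * μ * (η / δ) ≤ 1 / 9000 * η := by
    rw [mul_div_assoc', div_le_iff₀ hδ]
    have : μ * η ≤ δ / 9000 := (mul_le_mul_of_nonneg_right hμL hη.le).trans hηL
    have := mul_le_mul_of_nonneg_left this hη.le
    linarith
  have h9 : η * μ * (η / δ) * h ≤ 1 / 9000 * η * h := by gcongr
  have h10 := mul_le_mul_of_nonneg_left hh0 hη.le
  have p0 : 0 ≤ η * h := by positivity
  have p1 : 0 ≤ a * η * Y := by positivity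
  have p2 : 0 ≤ a * η * V := by positivity
  have p3 : 0 ≤ a * η * Z := by positivity
  have p4 : 0 ≤ a * η * s := by positivity
  have p5 : 0 ≤ η * M := by positivity
  have p6 : 0 ≤ η * x := by positivity
  linarith

/-- Solving a linear recursion with a constant perturbation. -/
theorem le_of_linear_recursion {r c : ℝ} {u : ℕ → ℝ} (hr : 0 < r) (hr1 : r ≤ 1) (hc : 0 ≤ c)
    (h : ∀ t, u (t + 1) ≤ (1 - r) * u t + c) (t : ℕ) : u t ≤ (1 - r) ^ t * u 0 + c / r := by
  induction t with
  | zero => simp; positivity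
  | succ t ih =>
    have h1 := mul_le_mul_of_nonneg_left ih (sub_nonneg.2 hr1)
    have h2 : (1 - r) * (c / r) + c = c / r := by field_simp; ring
    have := h t
    rw [pow_succ]
    linarith

/-- Solving a linear recursion that is driven by a slowly decaying sequence. -/
theorem le_of_driven_recursion {q r θ A c B : ℝ} {u w : ℕ → ℝ} (hq1 : q ≤ 1) (hr1 : r ≤ 1)
    (hA : 0 ≤ A) (hB : 0 ≤ B) (hθ : 0 ≤ θ) (hqr : θ + r ≤ q)
    (hw : ∀ t, w t ≤ (1 - r) ^ t * A + c) {b : ℝ} (hb : θ * c + b ≤ q * B)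
    (h : ∀ t, u (t + 1) ≤ (1 - q) * u t + θ * w t + b) (t : ℕ) :
    u t ≤ (1 - q) ^ t * u 0 + (1 - r) ^ t * A + B := by
  induction t with
  | zero => simp only [pow_zero, one_mul]; linarith
  | succ t ih =>
    have h1 := mul_le_mul_of_nonneg_left ih (sub_nonneg.2 hq1)
    have h2 := mul_le_mul_of_nonneg_left (hw t) hθ
    have h3 : 0 ≤ (1 - r) ^ t * A := mul_nonneg (pow_nonneg (sub_nonneg.2 hr1) _) hA
    -- The condition `θ + r ≤ q` makes `(1-q) + θ ≤ 1-r`, so the driven sequence follows the slow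
    -- mode with constant `A` itself.
    have h4 := mul_le_mul_of_nonneg_right hqr h3
    have := h t
    rw [pow_succ, pow_succ]
    linarith

/-- The convergence bound that follows from the one-round inequalities. -/
theorem convergence_of_recursions {δ γ η L μ a e s sn : ℝ} {D M x Y V Z S G : ℕ → ℝ}
    (hδ : 0 < δ) (hδ1 : δ ≤ 1) (hδγ : δ ≤ γ) (hη : 0 < η) (hμ : 0 < μ) (hμL : μ ≤ L)
    (hηL : L * η ≤ δ / 9000) (ha : 0 ≤ a) (ha1 : a ≤ 1 / 397350) (he : 0 ≤ e) (he1 : 210 * e ≤ a)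
    (hsn0 : 0 ≤ sn) (hsn : sn ≤ s) (hx : ∀ t, 0 ≤ x t) (hY : ∀ t, 0 ≤ Y t) (hV : ∀ t, 0 ≤ V t)
    (hZ : ∀ t, 0 ≤ Z t) (hM : ∀ t, 0 ≤ M t) (hS : ∀ t, 0 ≤ S t) (hG : ∀ t, 0 ≤ G t)
    (hD : ∀ t, 0 ≤ D t)
    (hSle : ∀ t, S t ≤ 21 / 10 * x t + 19 * a * (V t + Y t + Z t) + 7 * a * s)
    (hGle : ∀ t, G t ≤ 2 * δ ^ 2 * (V t + s + S t))
    (hZ' : ∀ t, Z (t + 1) ≤ (1 - δ) * Z t + 2 * δ ^ 2 * sn + 4 * δ * M t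
      + 8 * δ * (e * Z t + S t))
    (hV' : ∀ t, V (t + 1) ≤ (1 - δ) * V t + 2 * δ ^ 2 * s + 4 * δ * S t + 4 * δ * e * Z (t + 1))
    (hY' : ∀ t, Y (t + 1) ≤ (1 - γ) * Y t + 2 / γ * G t)
    (hx' : ∀ t, x (t + 1) ≤ (1 - γ) * x t + 4 * δ ^ 2 * e / γ * (Y t + G t))
    (hD' : ∀ t, D (t + 1) ≤ D t - η * (1 / 2 - L * η) * M t
      + η * (1 + 2 * (L * η)) * (e * Z t + S t) + L * η ^ 2 * sn)
    (hPL : ∀ t, 2 * μ * D t ≤ M t) (hsm : ∀ t, M t ≤ 2 * L * D t) (t : ℕ) :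
    2 * D t + (2 * e * Z t + x t) / (2 * L)
      ≤ (1 - 7 / 10 * δ) ^ t * (netEnergy 1 a (x 0) (Y 0) (V 0) (Z 0) / (2 * L))
        + 3 * ((1 - 2 / 3 * (η * μ)) ^ t *
          (D 0 + 9 * (η / δ) * netEnergy (δ / γ) a (x 0) (Y 0) (V 0) (Z 0)))
        + 4 * (L * η * sn / μ) + 10000 * (a * s / μ) := by
  have hγ : 0 < γ := hδ.trans_le hδγ
  have hL : 0 < L := hμ.trans_le hμL
  have hs : 0 ≤ s := hsn0.trans hsn
  have hημ : η * μ ≤ δ / 9000 := by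
    rw [mul_comm]
    exact (mul_le_mul_of_nonneg_right hμL hη.le).trans hηL
  have hημ0 : 0 < η * μ := mul_pos hη hμ
  set r := 2 / 3 * (η * μ) with hr
  have hr0 : 0 < r := by positivity
  have hr1 : r ≤ 1 := by linarith
  have hnet : ∀ k, 0 ≤ k → ∀ t, 0 ≤ netEnergy k a (x t) (Y t) (V t) (Z t) := fun k hk t => by
    have := hx t; have := hY t; have := hV t; have := hZ t
    rw [netEnergy]; positivity
  have hstep : ∀ k, k ≤ 1 → δ ≤ k * γ → ∀ t, _ := fun k hk1 hkγ t =>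
    netEnergy_step hk1 hδ hδ1 hδγ hkγ ha ha1 he he1 hs hsn (hx t) (hY t) (hV t) (hZ t) (hM t)
      (hS t) (hG t) (hSle t) (hGle t) (hZ' t) (hV' t) (hY' t) (hx' t)
  set Λ : ℕ → ℝ := fun t => D t + 9 * (η / δ) * netEnergy (δ / γ) a (x t) (Y t) (V t) (Z t) with hΛ
  have hΛD : ∀ t, D t ≤ Λ t := fun t => by
    have := hnet (δ / γ) (by positivity) t
    have : 0 ≤ 9 * (η / δ) * netEnergy (δ / γ) a (x t) (Y t) (V t) (Z t) := by positivity
    simp only [hΛ]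
    linarith
  have hΛ0 : 0 ≤ Λ 0 := (hD 0).trans (hΛD 0)
  set c := L * η ^ 2 * sn + 2900 * (a * η * s) with hc
  have hc0 : 0 ≤ c := by positivity
  have hΛt := le_of_linear_recursion (u := Λ) hr0 hr1 hc0 fun t =>
    lyapunov_step hδ hδ1 hη hμ hμL hηL ha ha1 he1 hs (hx t) (hY t) (hV t) (hZ t) (hM t) (hS t) he hγ
      (hSle t) (hD' t) (hPL t) rfl (hstep (δ / γ) ((div_le_one hγ).2 hδγ) (by field_simp; rfl) t)
  -- The stationary level of the first Lyapunov function; division by `r = (2/3)ημ` gives 3/2 and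
  -- `2900·3/2`.
  have hcr : c / r = 3 / 2 * (L * η * sn / μ) + 4350 * (a * s / μ) := by
    rw [hc, hr]; field_simp; ring
  set Pn : ℕ → ℝ := fun t => netEnergy 1 a (x t) (Y t) (V t) (Z t) / (2 * L) with hPn
  have hμL' : a * s / L ≤ a * s / μ := by gcongr
  have q1 : 0 ≤ L * η * sn / μ := by positivity
  have q2 : 0 ≤ a * s / μ := by positivity
  have hB : 21 * a * (c / r) + 160 * (a * s / L)
      ≤ 7 / 10 * (1 / 100 * (c / r) + 230 * (a * s / μ)) := by
    have h1 : a * (c / r) ≤ 1 / 397350 * (c / r) := by gcongr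
    have h2 : 0 ≤ c / r := by positivity
    linarith
  -- With `k = 1` the energy is driven by `M ≤ 2L·D ≤ 2L·Λ`, so after division by `2L` the coupling
  -- is `21aδ`. Both it and `r` are far below `(7/10)δ`. The `B` chosen uses `160 ≤ (7/10)·230`.
  have hPt := le_of_driven_recursion (u := Pn) (w := Λ) (q := 7 / 10 * δ) (r := r)
    (θ := 21 * a * δ) (A := Λ 0) (c := c / r) (B := 1 / 100 * (c / r) + 230 * (a * s / μ))
    (b := 160 * (a * s / L) * δ)
    (by linarith) hr1 hΛ0 (by positivity) (by positivity) (by nlinarith) hΛt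
    (by nlinarith) (fun t => by
      have h1 := hstep 1 le_rfl (by rwa [one_mul]) t
      have h2 : M t ≤ 2 * L * Λ t := (hsm t).trans (by have := hΛD t; gcongr)
      have h3 : a * δ * M t ≤ a * δ * (2 * L * Λ t) := by gcongr
      have h4 : 0 ≤ δ * x t := mul_nonneg hδ.le (hx t)
      have h5 : 0 ≤ a * δ * Y t := mul_nonneg (by positivity) (hY t)
      simp only [hPn]
      rw [div_le_iff₀ (by positivity)]
      have h6 : ((1 - 7 / 10 * δ) * (netEnergy 1 a (x t) (Y t) (V t) (Z t) / (2 * L))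
          + 21 * a * δ * Λ t + 160 * (a * s / L) * δ) * (2 * L)
          = (1 - 7 / 10 * δ) * netEnergy 1 a (x t) (Y t) (V t) (Z t)
            + 21 * (a * δ * (2 * L * Λ t)) + 320 * (a * δ * s) := by field_simp; ring
      rw [h6]
      linarith) t
  have h1 : (2 * e * Z t + x t) / (2 * L) ≤ Pn t := by
    simp only [hPn]
    refine div_le_div_of_nonneg_right ?_ (by positivity)
    have h2 := hY t
    have h3 := hV t
    have h4 : 210 * e * Z t ≤ a * Z t := mul_le_mul_of_nonneg_right he1 (hZ t)
    have h5 : 0 ≤ e * Z t := mul_nonneg he (hZ t)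
    have h6 : 0 ≤ 9 * a * 1 * Y t + 135 * a * V t := by positivity
    rw [netEnergy]
    linarith
  have h2 := hΛt t
  have h3 := hΛD t
  rw [hcr] at h2 hPt
  have h4 : 0 ≤ (1 - r) ^ t * Λ 0 := mul_nonneg (pow_nonneg (sub_nonneg.2 hr1) _) hΛ0
  -- Twice the bound for `Λ` plus the bound for `Pn` gives the factor 3 on the slow mode; the noise
  -- constants are `2.01·3/2 ≤ 4` and `2.01·4350 + 230 ≤ 10000`.
  linarith


/-- The root in `η_w` is at most 1, so `η_w ≥ 1/2`. Through this the factor `c₀ρ̃_w` of the stated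
initial terms dominates the smaller numerical factors that the proof produces. -/
theorem half_le_rhoW {n : ℕ} {W : Matrix (Fin n) (Fin n) ℝ} : 1 / 2 ≤ rhoW W := by
  rw [rhoW]
  refine Real.le_sqrt_of_sq_le ?_
  have h1 : Real.sqrt (1 - specNorm W ^ 2) ≤ 1 := by
    rw [Real.sqrt_le_one]
    linarith [sq_nonneg (specNorm W)]
  have h2 := Real.sqrt_nonneg (1 - specNorm W ^ 2)
  rw [etaW, le_div_iff₀ (by positivity)]
  nlinarith

/-! ### Majorants of the network errors, step sizes and the gap at the agents. -/

namespace Setup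

set_option linter.unusedSectionVars false

variable {Ω Ξ : Type*} [mΩ : MeasurableSpace Ω] [MeasurableSpace Ξ] {S : Setup Ω Ξ}
  {P : Measure Ω} [IsProbabilityMeasure P] {σ L μ : ℝ}

/-- The recursive bound for the expected tracking error. -/
noncomputable def trackBound (S : Setup Ω Ξ) (P : Measure Ω) : ℕ → ℝ :=
  gossipBound (rhoW S.W) (2 / (1 - rhoW S.W)) 0 (S.mG P)

/-- The recursive bound for the expected consensus error. -/
noncomputable def consensusBound (S : Setup Ω Ξ) (P : Measure Ω) : ℕ → ℝ :=
  gossipBound (rhoW S.W) (2 / (1 - rhoW S.W)) (2 * frobSq (proj S.x₀))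
    fun t => S.etaHat ^ 2 * ∫ ω, frobSq (proj (S.track t ω)) ∂P

theorem mX_nonneg (t : ℕ) : 0 ≤ S.mX P t := Finset.sum_nonneg fun _ _ => secondMoment_nonneg _

theorem mH_nonneg (t : ℕ) : 0 ≤ S.mH P t := Finset.sum_nonneg fun _ _ => secondMoment_nonneg _

theorem mV_nonneg (t : ℕ) : 0 ≤ S.mV P t := Finset.sum_nonneg fun _ _ => secondMoment_nonneg _

theorem mG_nonneg (t : ℕ) : 0 ≤ S.mG P t := Finset.sum_nonneg fun _ _ => secondMoment_nonneg _

theorem mS_nonneg (t : ℕ) : 0 ≤ S.mS P t := Finset.sum_nonneg fun i _ => drift_nonneg t i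

theorem mZ_nonneg (t : ℕ) : 0 ≤ S.mZ P t := secondMoment_nonneg _

theorem mM_nonneg (t : ℕ) : 0 ≤ S.mM P t := secondMoment_nonneg _

section Rates

variable (h : S.Assumptions P σ L μ)

include h

theorem memLp_proj_zInc (t : ℕ) (i : Fin S.n) : MemLp (fun ω => proj (S.zInc t ω) i) 2 P :=
  memLp_proj (memLp_zInc h t) i

/-- Gossip contracts the energy, not the error itself, so the Lyapunov analysis runs on a majorant
that satisfies the one-step recursion exactly. The pathwise bound is integrated term by term. -/
theorem mH_le (t : ℕ) : S.mH P t ≤ S.trackBound P t := by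
  have hi : ∀ t, Integrable (fun ω => frobSq (proj (S.zInc t ω))) P := fun t =>
    integrable_frobSq (memLp_proj_zInc h t)
  have hcz : ∀ i, MemLp (fun ω => proj ((S.state ω t).c + (S.state ω t).z) i) 2 P :=
    memLp_proj fun i => (adaptedL2_cz h t i).2
  have e : S.mG P = fun t => ∫ ω, frobSq (proj (S.zInc t ω)) ∂P :=
    funext fun t => (integral_frobSq (memLp_proj_zInc h t)).symm
  rw [mH, ← integral_frobSq hcz, trackBound, e, ← integral_gossipBound hi]
  exact integral_mono (integrable_frobSq hcz) (integrable_gossipBound hi t) fun ω =>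
    frobSq_proj_cz_le h.network h.n_pos h.rho_lt_one t ω

theorem mX_le (t : ℕ) : S.mX P t ≤ S.consensusBound P t := by
  have hi : ∀ t, Integrable (fun ω => S.etaHat ^ 2 * frobSq (proj (S.track t ω))) P := fun t =>
    (integrable_frobSq (memLp_proj (memLp_track h t))).const_mul _
  have hx : ∀ i, MemLp (fun ω => proj (S.state ω t).x i) 2 P :=
    fun i => (adaptedL2_proj_x h t i).2
  have e := integral_gossipBound (ρ := rhoW S.W) (c := 2 / (1 - rhoW S.W))
    (A₀ := 2 * frobSq (proj S.x₀)) hi t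
  simp only [integral_const_mul] at e
  rw [mX, ← integral_frobSq hx, consensusBound, ← e]
  exact integral_mono (integrable_frobSq hx) (integrable_gossipBound hi t) fun ω =>
    frobSq_proj_x_le h.network h.n_pos h.rho_lt_one t ω

theorem integral_frobSq_proj_track_le (t : ℕ) :
    ∫ ω, frobSq (proj (S.track t ω)) ∂P ≤ 2 * S.mH P t + 2 * S.mG P t := by
  have hcz : ∀ i, MemLp (fun ω => proj ((S.state ω t).c + (S.state ω t).z) i) 2 P :=
    memLp_proj fun i => (adaptedL2_cz h t i).2
  have h1 := integrable_frobSq hcz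
  have h2 := integrable_frobSq (memLp_proj_zInc h t)
  rw [mH, mG, ← integral_frobSq hcz, ← integral_frobSq (memLp_proj_zInc h t),
    ← integral_const_mul, ← integral_const_mul, ← integral_add (h1.const_mul 2) (h2.const_mul 2)]
  refine integral_mono (integrable_frobSq (memLp_proj (memLp_track h t)))
    ((h1.const_mul 2).add (h2.const_mul 2)) fun ω => ?_
  simp only [track, proj_add (_ + _) (S.zInc t ω)]
  exact frobSq_add_le _ _

theorem trackBound_nonneg (t : ℕ) : 0 ≤ S.trackBound P t :=
  (mH_nonneg t).trans (mH_le h t)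

theorem consensusBound_nonneg (t : ℕ) : 0 ≤ S.consensusBound P t :=
  (mX_nonneg t).trans (mX_le h t)

theorem consensusBound_succ_le (t : ℕ) : S.consensusBound P (t + 1)
    ≤ rhoW S.W * S.consensusBound P t
      + 4 * S.etaHat ^ 2 / (1 - rhoW S.W) * (S.trackBound P t + S.mG P t) := by
  have h1 := integral_frobSq_proj_track_le h t
  have h2 := mH_le h t
  have hγ : 0 < 1 - rhoW S.W := sub_pos.2 h.rho_lt_one
  have h3 : S.consensusBound P (t + 1) = rhoW S.W * S.consensusBound P t
    + 2 / (1 - rhoW S.W) * (S.etaHat ^ 2 * ∫ ω, frobSq (proj (S.track t ω)) ∂P) := rfl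
  rw [h3]
  have h4 : 2 / (1 - rhoW S.W) * (S.etaHat ^ 2 * ∫ ω, frobSq (proj (S.track t ω)) ∂P)
      ≤ 2 / (1 - rhoW S.W) * (S.etaHat ^ 2 * (2 * S.trackBound P t + 2 * S.mG P t)) := by
    gcongr
    linarith
  refine (add_le_add_right h4 _).trans (le_of_eq ?_)
  ring

/-! ### Consequences of the step size conditions -/

/-- `397350 = 15²·2·(1+63·14)`. -/
theorem sq_step_le : (S.ηa * S.Q * L) ^ 2 ≤ 1 / 397350 := by
  have hQ : (0 : ℝ) < S.Q := Nat.cast_pos.2 h.Q_pos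
  have hL := h.L_pos
  have hs : (0 : ℝ) ≤ 2 * (1 + 63 * c0) := by norm_num [c0]
  have hs' : 0 < Real.sqrt (2 * (1 + 63 * c0)) := Real.sqrt_pos.2 (by norm_num [c0])
  have h1 := h.etaA_le_L
  rw [le_div_iff₀ (by positivity)] at h1
  have h2 : S.ηa * S.Q * L * (15 * Real.sqrt (2 * (1 + 63 * c0))) ≤ 1 := by linarith
  have h3 := pow_le_pow_left₀ (by have := h.etaA_pos; positivity) h2 2
  rw [mul_pow, mul_pow 15, Real.sq_sqrt hs] at h3
  norm_num [c0] at h3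
  linarith

theorem etaS_sq_le : 210 * S.ηs ^ 2 ≤ (1 - S.β) ^ 2 := by
  have hs' : 0 < Real.sqrt (15 * c0) := Real.sqrt_pos.2 (by norm_num [c0])
  have h1 := h.etaS_le
  rw [le_div_iff₀ hs'] at h1
  have h3 := pow_le_pow_left₀ (by have := h.etaS_pos; positivity) h1 2
  rw [mul_pow, Real.sq_sqrt (by norm_num [c0])] at h3
  norm_num [c0] at h3
  linarith

theorem sq_etaHat_le : 210 * (S.etaHat * L / (1 - S.β)) ^ 2 ≤ (S.ηa * S.Q * L) ^ 2 := by
  have hβ1 : 0 < 1 - S.β := sub_pos.2 h.beta_lt_one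
  have h1 := etaS_sq_le h
  rw [div_pow, mul_div_assoc', div_le_iff₀ (by positivity)]
  have h2 := mul_le_mul_of_nonneg_left h1 (sq_nonneg (S.ηa * S.Q * L))
  refine le_trans (le_of_eq ?_) h2
  rw [etaHat]
  ring

/-- The two step size conditions combine to `(η̂L/(1-β))² ≤ 1/(210·397350)`, and this product
exceeds `9000²`. -/
theorem L_mul_etaHat_le : L * S.etaHat ≤ (1 - S.β) / 9000 := by
  have hβ1 : 0 < 1 - S.β := sub_pos.2 h.beta_lt_one
  have h1 := sq_etaHat_le h
  have h2 := sq_step_le h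
  have h3 : S.etaHat * L / (1 - S.β) ≤ 1 / 9000 := by
    refine le_of_sq_le_sq ?_ (by norm_num)
    norm_num
    linarith
  rw [div_le_iff₀ hβ1] at h3
  linarith

theorem etaHat_mul_mu_le_one : S.etaHat * μ ≤ 1 := by
  have hQ : (0 : ℝ) < S.Q := Nat.cast_pos.2 h.Q_pos
  have hμ := h.mu_pos
  have hβ1 : 0 < 1 - S.β := sub_pos.2 h.beta_lt_one
  have hs' : 1 ≤ Real.sqrt (2 * (1 + 63 * c0)) := by
    rw [Real.one_le_sqrt]; norm_num [c0]
  have h1 := h.etaA_le_mu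
  rw [le_div_iff₀ (by positivity)] at h1
  have ha := h.etaA_pos
  have h2 : S.ηa * S.Q * μ ≤ 1 := by
    have : S.ηa * S.Q * μ * 1 ≤ S.ηa * S.Q * μ * (15 * Real.sqrt (2 * (1 + 63 * c0))) := by
      gcongr
      linarith
    linarith
  have h3 : S.ηs ≤ 1 := by
    have := etaS_sq_le h
    have hb := h.beta_pos
    nlinarith [h.etaS_pos]
  have h4 : S.ηa * S.Q * μ * S.ηs ≤ 1 * 1 :=
    mul_le_mul h2 h3 h.etaS_pos.le zero_le_one
  rw [etaHat]
  linarith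

/-! ### The objective -/

theorem mD_nonneg (t : ℕ) : 0 ≤ S.mD P t :=
  integral_nonneg fun _ => sub_nonneg.2 (fStar_le h.smooth _)

theorem mM_le (t : ℕ) : S.mM P t ≤ 2 * L * S.mD P t := by
  have h1 := integrable_norm_sq (adaptedL2_gradient_obj h (adaptedL2_dBar h t)).2
  have h2 : Integrable (fun ω => S.obj (S.dBar t ω) - S.fStar) P :=
    (integrable_obj h (adaptedL2_dBar h t).2).sub (integrable_const _)
  rw [mM, mD, secondMoment, ← integral_const_mul]
  exact integral_mono h1 (h2.const_mul _) fun _ =>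
    norm_gradient_obj_sq_le h.smooth h.L_pos h.n_pos _

theorem mD_le (t : ℕ) : 2 * μ * S.mD P t ≤ S.mM P t := by
  have h1 := integrable_norm_sq (adaptedL2_gradient_obj h (adaptedL2_dBar h t)).2
  have h2 : Integrable (fun ω => S.obj (S.dBar t ω) - S.fStar) P :=
    (integrable_obj h (adaptedL2_dBar h t).2).sub (integrable_const _)
  rw [mM, mD, secondMoment, ← integral_const_mul]
  exact integral_mono (h2.const_mul _) h1 fun _ => h.pl _

/-- PL and smoothness give `2μ(f-f^*) ≤ ‖∇f‖² ≤ 2L(f-f^*)`, which for `L < μ` leaves only `f = f^*`.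
-/
theorem obj_eq_fStar_of_lt (hμ : L < μ) (x : Vec S.p) : S.obj x = S.fStar := by
  have h1 := norm_gradient_obj_sq_le h.smooth h.L_pos h.n_pos x
  have h2 := h.pl x
  have h3 := fStar_le h.smooth x
  nlinarith

theorem integrable_obj_iter (t : ℕ) (i : Fin S.n) :
    Integrable (fun ω => S.obj (S.iter t i ω)) P :=
  integrable_obj h ((adaptedL2_state h.oracle h.smooth t).1 i).2

/-- Descent lemma from `d̄` to `x̄`. The linear term is split by Young so that `‖∇f(d̄)‖²/(2L) ≤
f(d̄) - f^*` costs one more copy of the gap. -/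
theorem obj_xBar_le (t : ℕ) (ω : Ω) : S.obj (S.xBar t ω) - S.fStar
    ≤ 2 * (S.obj (S.dBar t ω) - S.fStar)
      + (S.etaHat * L / (1 - S.β)) ^ 2 / L * ‖S.zBar t ω‖ ^ 2 := by
  have hL := h.L_pos
  have hβ0 := h.beta_pos
  have hβ1 : 0 < 1 - S.β := sub_pos.2 h.beta_lt_one
  have hη := h.etaHat_pos
  set v := (S.etaHat * S.β / (1 - S.β)) • S.zBar t ω with hv
  have e : S.xBar t ω = S.dBar t ω + v := by rw [dBar, hv, sub_add_cancel]
  have h1 := descent_lemma (differentiable_obj h.smooth)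
    (lipschitz_gradient_obj h.smooth h.n_pos) (S.dBar t ω) v
  have h2 := norm_gradient_obj_sq_le h.smooth hL h.n_pos (S.dBar t ω)
  have h3 : inner ℝ (gradient S.obj (S.dBar t ω)) v
      ≤ ‖gradient S.obj (S.dBar t ω)‖ ^ 2 / (2 * L) + L / 2 * ‖v‖ ^ 2 := by
    refine (real_inner_le_norm _ _).trans ?_
    rw [← sub_nonneg]
    have : ‖gradient S.obj (S.dBar t ω)‖ ^ 2 / (2 * L) + L / 2 * ‖v‖ ^ 2
        - ‖gradient S.obj (S.dBar t ω)‖ * ‖v‖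
        = (‖gradient S.obj (S.dBar t ω)‖ - L * ‖v‖) ^ 2 / (2 * L) := by field_simp; ring
    rw [this]
    positivity
  have h4 : ‖gradient S.obj (S.dBar t ω)‖ ^ 2 / (2 * L) ≤ S.obj (S.dBar t ω) - S.fStar := by
    rw [div_le_iff₀ (by positivity)]
    linarith
  have h5 : L * ‖v‖ ^ 2 ≤ (S.etaHat * L / (1 - S.β)) ^ 2 / L * ‖S.zBar t ω‖ ^ 2 := by
    rw [hv, norm_smul, mul_pow, Real.norm_eq_abs, sq_abs, ← mul_assoc]
    refine mul_le_mul_of_nonneg_right ?_ (sq_nonneg _)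
    have : (S.etaHat * L / (1 - S.β)) ^ 2 / L = L * (S.etaHat / (1 - S.β)) ^ 2 := by field_simp
    rw [this]
    have h6 : S.etaHat * S.β ≤ S.etaHat := mul_le_of_le_one_right hη.le h.beta_lt_one.le
    gcongr
  rw [e]
  linarith

theorem gap_le (t : ℕ) : S.gap P t ≤ 2 * S.mD P t
    + (2 * (S.etaHat * L / (1 - S.β)) ^ 2 * S.mZ P t
      + L ^ 2 * S.consensusBound P t / S.n) / (2 * L) := by
  have hL := h.L_pos
  have hn : (0 : ℝ) < S.n := Nat.cast_pos.2 h.n_pos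
  have hx : ∀ i, MemLp (fun ω => proj (S.state ω t).x i) 2 P :=
    fun i => (adaptedL2_proj_x h t i).2
  have i1 : ∀ i, Integrable (fun ω => S.obj (S.iter t i ω) - S.fStar) P := fun i =>
    (integrable_obj_iter h t i).sub (integrable_const _)
  have i2 : Integrable (fun ω => S.obj (S.dBar t ω) - S.fStar) P :=
    (integrable_obj h (adaptedL2_dBar h t).2).sub (integrable_const _)
  have i3 := integrable_norm_sq (adaptedL2_zBar h t).2
  have i4 := integrable_frobSq hx
  have h1 : S.gap P t ≤ 2 * S.mD P t + (S.etaHat * L / (1 - S.β)) ^ 2 / L * S.mZ P t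
      + L / 2 * (S.n : ℝ)⁻¹ * S.mX P t := by
    have i12 : Integrable (fun ω => 2 * (S.obj (S.dBar t ω) - S.fStar)
        + (S.etaHat * L / (1 - S.β)) ^ 2 / L * ‖S.zBar t ω‖ ^ 2) P :=
      (i2.const_mul _).add (i3.const_mul _)
    rw [gap, ← integral_finsetSum _ fun i _ => i1 i, mD, mZ, mX, ← integral_frobSq hx, secondMoment,
      ← integral_const_mul, ← integral_const_mul, ← integral_const_mul, ← integral_const_mul,
      ← integral_add (i2.const_mul _) (i3.const_mul _), ← integral_add i12 (i4.const_mul _)]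
    refine integral_mono ((integrable_finsetSum _ fun i _ => i1 i).const_mul _)
      (i12.add (i4.const_mul _)) fun ω => ?_
    have h2 := avg_obj_le h.smooth h.n_pos (S.state ω t).x
    have h3 := obj_xBar_le h t ω
    have h4 : (S.n : ℝ)⁻¹ * ∑ i, (S.obj (S.iter t i ω) - S.fStar)
        = (S.n : ℝ)⁻¹ * ∑ i, S.obj ((S.state ω t).x i) - S.fStar := by
      rw [Finset.sum_sub_distrib, Finset.sum_const, Finset.card_univ, Fintype.card_fin,
        nsmul_eq_mul, mul_sub, inv_mul_cancel_left₀ hn.ne']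
      rfl
    simp only
    rw [h4]
    change _ ≤ S.obj (S.xBar t ω) + _ at h2
    linarith
  refine h1.trans ?_
  have h2 := mX_le h t
  have h3 : L / 2 * (S.n : ℝ)⁻¹ * S.mX P t ≤ L / 2 * (S.n : ℝ)⁻¹ * S.consensusBound P t := by
    gcongr
  refine (add_le_add_right h3 _).trans (le_of_eq ?_)
  field_simp
  ring

end Rates

end Setup


/-! ### Initial values and final bounds. -/

namespace Setup

set_option linter.unusedSectionVars false

variable {Ω Ξ : Type*} [mΩ : MeasurableSpace Ω] [MeasurableSpace Ξ] {S : Setup Ω Ξ}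
  {P : Measure Ω} [IsProbabilityMeasure P] {σ L μ : ℝ}

/-! ### Initial values -/

theorem mZ_zero : S.mZ P 0 = 0 := by
  have e : S.zBar 0 = fun _ => (0 : Vec S.p) := funext fun _ => avg_zero
  simp [mZ, e, secondMoment]

theorem mV_zero : S.mV P 0 = frobSq S.gradF0 := by
  have e : ∀ (ω : Ω) (i : Fin S.n), (S.state ω 0).z i - gradient (S.f i) (S.xBar 0 ω)
      = -S.gradF0 i := fun ω i => zero_sub _
  simp [mV, e, secondMoment, frobSq]

theorem mD_zero : S.mD P 0 = S.DeltaF := by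
  have e : ∀ ω : Ω, S.dBar 0 ω = avg S.x₀ := fun ω => by
    have : S.zBar 0 ω = (0 : Vec S.p) := avg_zero
    rw [dBar, this, smul_zero, sub_zero]
    rfl
  simp [mD, e, DeltaF]

theorem integral_frobSq_yVar_nonneg :
    0 ≤ ∫ ω, frobSq (proj (S.yVar (S.samples 0 ω) S.init)) ∂P :=
  integral_nonneg fun _ => frobSq_nonneg _

theorem H0_eq : S.H0 P = 14 * rhoW S.W * frobSq (proj S.x₀)
    + S.ηa ^ 2 * S.Q ^ 2 *
      (14 * rhoW S.W * ∫ ω, frobSq (proj (S.yVar (S.samples 0 ω) S.init)) ∂P)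
    + 448 * S.ηa ^ 2 * S.Q ^ 2 * frobSq S.gradF0 := by
  have e1 : avg S.init.z = 0 := avg_zero
  have e2 : frobSq (S.init.z - S.gradF0) = frobSq S.gradF0 := by
    simp [frobSq, init]
  rw [H0, e1, e2, Rx0, Ry0, c0]
  norm_num

theorem L0_eq : S.L0 P L = S.DeltaF
    + 154 * S.etaHat * L ^ 2 / (S.n * (1 - rhoW S.W)) * (rhoW S.W * frobSq (proj S.x₀))
    + 294 * S.etaHat * S.ηa ^ 2 * S.Q ^ 2 * L ^ 2 / (S.n * (1 - rhoW S.W)) *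
      (rhoW S.W * ∫ ω, frobSq (proj (S.yVar (S.samples 0 ω) S.init)) ∂P)
    + 5298 * S.etaHat * S.ηa ^ 2 * S.Q ^ 2 * L ^ 2 / (S.n * (1 - S.β)) * frobSq S.gradF0 := by
  have e1 : avg S.init.z = 0 := avg_zero
  have e2 : frobSq (S.init.z - S.gradF0) = frobSq S.gradF0 := by
    simp [frobSq, init]
  rw [L0, e1, e2, Rx0, Ry0, c0, DeltaF]
  norm_num
  ring

theorem H0_nonneg : 0 ≤ S.H0 P := by
  have h1 := half_le_rhoW (W := S.W)
  have h2 := integral_frobSq_yVar_nonneg (S := S) (P := P)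
  have h3 := frobSq_nonneg (proj S.x₀)
  have h4 := frobSq_nonneg S.gradF0
  rw [H0_eq]
  generalize ∫ ω, frobSq (proj (S.yVar (S.samples 0 ω) S.init)) ∂P = K at h2 ⊢
  generalize frobSq (proj S.x₀) = F at h3 ⊢
  generalize frobSq S.gradF0 = v at h4 ⊢
  positivity

section Bounds

variable (h : S.Assumptions P σ L μ)

include h

theorem DeltaF_nonneg : 0 ≤ S.DeltaF := sub_nonneg.2 (fStar_le h.smooth _)

/-- The tracking majorant starts at 0 because `c_0 = z_0 = 0`, and `z̄_0 = 0`; it remains to compare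
`2 ≤ 14ρ̃_w` and `135 ≤ 32·14`. -/
theorem netEnergy_zero_le_H0 :
    netEnergy 1 ((S.ηa * S.Q * L) ^ 2) (L ^ 2 * (2 * frobSq (proj S.x₀)) / S.n) 0
      (frobSq S.gradF0 / S.n) 0 / (2 * L) ≤ L * S.H0 P / (2 * S.n) := by
  have hn : (0 : ℝ) < S.n := Nat.cast_pos.2 h.n_pos
  have hL := h.L_pos
  have h1 := half_le_rhoW (W := S.W)
  have h2 := integral_frobSq_yVar_nonneg (S := S) (P := P)
  have h3 := frobSq_nonneg (proj S.x₀)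
  have h4 := frobSq_nonneg S.gradF0
  have e : netEnergy 1 ((S.ηa * S.Q * L) ^ 2) (L ^ 2 * (2 * frobSq (proj S.x₀)) / S.n) 0
      (frobSq S.gradF0 / S.n) 0 / (2 * L)
      = L * (2 * frobSq (proj S.x₀) + 135 * (S.ηa ^ 2 * S.Q ^ 2 * frobSq S.gradF0))
        / (2 * S.n) := by
    rw [netEnergy]
    field_simp
    ring
  rw [e, H0_eq]
  generalize ∫ ω, frobSq (proj (S.yVar (S.samples 0 ω) S.init)) ∂P = K at h2 ⊢
  generalize frobSq (proj S.x₀) = F at h3 ⊢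
  generalize frobSq S.gradF0 = v at h4 ⊢
  have h5 : 1 / 2 * F ≤ rhoW S.W * F := by gcongr
  have h6 : 0 ≤ S.ηa ^ 2 * S.Q ^ 2 *
      (14 * rhoW S.W * K) := by positivity
  have h7 : 0 ≤ S.ηa ^ 2 * S.Q ^ 2 * v := by positivity
  refine div_le_div_of_nonneg_right (mul_le_mul_of_nonneg_left ?_ hL.le) (by positivity)
  linarith

/-- The comparison is `9·2 ≤ 11·14·ρ̃_w` for the consensus term and `9·135 ≤ 6·(1+63·14)` for the
gradient term. -/
theorem netEnergy_zero_le_L0 :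
    S.DeltaF + 9 * (S.etaHat / (1 - S.β)) * netEnergy ((1 - S.β) / (1 - rhoW S.W))
      ((S.ηa * S.Q * L) ^ 2) (L ^ 2 * (2 * frobSq (proj S.x₀)) / S.n) 0
      (frobSq S.gradF0 / S.n) 0 ≤ S.L0 P L := by
  have hn : (0 : ℝ) < S.n := Nat.cast_pos.2 h.n_pos
  have hγ : 0 < 1 - rhoW S.W := sub_pos.2 h.rho_lt_one
  have hδ : 0 < 1 - S.β := sub_pos.2 h.beta_lt_one
  have hη := h.etaHat_pos
  have hL := h.L_pos
  have h1 := half_le_rhoW (W := S.W)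
  have h2 := integral_frobSq_yVar_nonneg (S := S) (P := P)
  have h3 := frobSq_nonneg (proj S.x₀)
  have h4 := frobSq_nonneg S.gradF0
  have e : 9 * (S.etaHat / (1 - S.β)) * netEnergy ((1 - S.β) / (1 - rhoW S.W))
      ((S.ηa * S.Q * L) ^ 2) (L ^ 2 * (2 * frobSq (proj S.x₀)) / S.n) 0
      (frobSq S.gradF0 / S.n) 0
      = 154 * S.etaHat * L ^ 2 / (S.n * (1 - rhoW S.W)) * (18 / 154 * frobSq (proj S.x₀))
        + 1215 * S.etaHat * S.ηa ^ 2 * S.Q ^ 2 * L ^ 2 / (S.n * (1 - S.β))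
          * frobSq S.gradF0 := by
    rw [netEnergy]
    field_simp
    ring
  rw [e, L0_eq]
  generalize ∫ ω, frobSq (proj (S.yVar (S.samples 0 ω) S.init)) ∂P = K at h2 ⊢
  generalize frobSq (proj S.x₀) = F at h3 ⊢
  generalize frobSq S.gradF0 = v at h4 ⊢
  have h5 : 154 * S.etaHat * L ^ 2 / (S.n * (1 - rhoW S.W)) * (18 / 154 * F)
      ≤ 154 * S.etaHat * L ^ 2 / (S.n * (1 - rhoW S.W)) * (rhoW S.W * F) := by
    gcongr
    linarith
  have h6 : 0 ≤ 294 * S.etaHat * S.ηa ^ 2 * S.Q ^ 2 * L ^ 2 / (S.n * (1 - rhoW S.W)) *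
      (rhoW S.W * K) := by positivity
  have h7 : 1215 * S.etaHat * S.ηa ^ 2 * S.Q ^ 2 * L ^ 2 / (S.n * (1 - S.β)) * v
      ≤ 5298 * S.etaHat * S.ηa ^ 2 * S.Q ^ 2 * L ^ 2 / (S.n * (1 - S.β)) * v := by
    gcongr
    norm_num
  linarith

theorem L0_nonneg : 0 ≤ S.L0 P L := by
  have hn : (0 : ℝ) < S.n := Nat.cast_pos.2 h.n_pos
  have hγ : 0 < 1 - rhoW S.W := sub_pos.2 h.rho_lt_one
  have hδ : 0 < 1 - S.β := sub_pos.2 h.beta_lt_one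
  have hη := h.etaHat_pos
  have h1 := half_le_rhoW (W := S.W)
  have h2 := integral_frobSq_yVar_nonneg (S := S) (P := P)
  have h3 := frobSq_nonneg (proj S.x₀)
  have h4 := frobSq_nonneg S.gradF0
  have h5 := DeltaF_nonneg h
  rw [L0_eq]
  generalize ∫ ω, frobSq (proj (S.yVar (S.samples 0 ω) S.init)) ∂P = K at h2 ⊢
  generalize frobSq (proj S.x₀) = F at h3 ⊢
  generalize frobSq S.gradF0 = v at h4 ⊢
  positivity

/-! ### Convergence -/

theorem gap_le_of_mu_le (hμL : μ ≤ L) (t : ℕ) : S.gap P t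
    ≤ (1 - 7 / 10 * (1 - S.β)) ^ t * (L * S.H0 P / (2 * S.n))
      + 3 * ((1 - 2 / 3 * (S.etaHat * μ)) ^ t * S.L0 P L)
      + 4 * (L * S.etaHat * (σ ^ 2 / (S.n * S.Q)) / μ)
      + 10000 * ((S.ηa * S.Q * L) ^ 2 * (σ ^ 2 / S.Q) / μ) := by
  have hn : (0 : ℝ) < S.n := Nat.cast_pos.2 h.n_pos
  have hn1 : (1 : ℝ) ≤ S.n := Nat.one_le_cast.2 h.n_pos
  have hQ : (0 : ℝ) < S.Q := Nat.cast_pos.2 h.Q_pos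
  have hγ : 0 < 1 - rhoW S.W := sub_pos.2 h.rho_lt_one
  have hδ : 0 < 1 - S.β := sub_pos.2 h.beta_lt_one
  have hβ := h.beta_pos
  have hη := h.etaHat_pos
  have hL := h.L_pos
  have hμ := h.mu_pos
  have ha1 := sq_step_le h
  have hηL := L_mul_etaHat_le h
  -- Network quantities are taken per agent. The parameters `a` and `e` are the squared relative
  -- lengths of a local round and of the shift between `x̄` and `d̄`; `s` and `sn` are the variances
  -- before and after averaging over agents.
  have key := convergence_of_recursions (δ := 1 - S.β) (γ := 1 - rhoW S.W) (η := S.etaHat)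
    (L := L) (μ := μ) (a := (S.ηa * S.Q * L) ^ 2) (e := (S.etaHat * L / (1 - S.β)) ^ 2)
    (s := σ ^ 2 / S.Q) (sn := σ ^ 2 / (S.n * S.Q)) (D := S.mD P) (M := S.mM P)
    (x := fun t => L ^ 2 * S.consensusBound P t / S.n) (Y := fun t => S.trackBound P t / S.n)
    (V := fun t => S.mV P t / S.n) (Z := S.mZ P) (S := fun t => L ^ 2 * S.mS P t / S.n)
    (G := fun t => S.mG P t / S.n)
    hδ (by linarith) (by linarith [h.beta_ge]) hη hμ hμL hηL (sq_nonneg _) ha1 (sq_nonneg _)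
    (sq_etaHat_le h) (by positivity)
    (by
      gcongr
      exact le_mul_of_one_le_left hQ.le hn1)
    (fun t => by have := consensusBound_nonneg h t; positivity)
    (fun t => by have := trackBound_nonneg h t; positivity)
    (fun t => by have := mV_nonneg (S := S) (P := P) t; positivity)
    mZ_nonneg mM_nonneg
    (fun t => by have := mS_nonneg (S := S) (P := P) t; positivity)
    (fun t => by have := mG_nonneg (S := S) (P := P) t; positivity)
    (mD_nonneg h)
    (fun t => by
      have h1 := mS_le h (by linarith) t
      have h2 := mX_le h t
      have h3 := mH_le h t
      rw [div_le_iff₀ hn]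
      refine h1.trans ?_
      have e : (21 / 10 * (L ^ 2 * S.consensusBound P t / S.n)
          + 19 * (S.ηa * S.Q * L) ^ 2 * (S.mV P t / S.n + S.trackBound P t / S.n + S.mZ P t)
          + 7 * (S.ηa * S.Q * L) ^ 2 * (σ ^ 2 / S.Q)) * S.n
          = 21 / 10 * (L ^ 2 * S.consensusBound P t)
          + 19 * (S.ηa * S.Q * L) ^ 2 * (S.mV P t + S.trackBound P t + S.n * S.mZ P t)
          + 7 * (S.ηa * S.Q * L) ^ 2 * (S.n * (σ ^ 2 / S.Q)) := by
        field_simp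
      rw [e]
      gcongr)
    (fun t => by
      rw [div_le_iff₀ hn]
      refine (mG_le h t).trans (le_of_eq ?_)
      field_simp)
    (fun t => by
      refine (mZ_succ_le h t).trans (le_of_eq ?_)
      ring)
    (fun t => by
      rw [div_le_iff₀ hn]
      refine (mV_succ_le h t).trans (le_of_eq ?_)
      field_simp
      ring)
    (fun t => by
      rw [div_le_iff₀ hn]
      refine le_of_eq ?_
      have e : S.trackBound P (t + 1)
        = rhoW S.W * S.trackBound P t + 2 / (1 - rhoW S.W) * S.mG P t := rfl
      rw [e]
      field_simp
      ring)
    (fun t => by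
      rw [div_le_iff₀ hn]
      have h1 := mul_le_mul_of_nonneg_left (consensusBound_succ_le h t) (sq_nonneg L)
      refine h1.trans (le_of_eq ?_)
      field_simp
      ring)
    (mD_succ_le h) (mD_le h) (mM_le h) t
  refine (gap_le h t).trans (key.trans ?_)
  have e1 : S.consensusBound P 0 = 2 * frobSq (proj S.x₀) := rfl
  have e2 : S.trackBound P 0 = 0 := rfl
  rw [e1, e2, mZ_zero, mV_zero, mD_zero, zero_div]
  have h1 : 0 ≤ 1 - 2 / 3 * (S.etaHat * μ) := by linarith [etaHat_mul_mu_le_one h]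
  have h2 : 0 ≤ 1 - 7 / 10 * (1 - S.β) := by linarith
  gcongr ?_ * ?_ + 3 * (?_ * ?_) + _ + _
  · exact netEnergy_zero_le_H0 h
  · exact netEnergy_zero_le_L0 h

theorem gap_eq_zero_of_lt (hLμ : L < μ) (t : ℕ) : S.gap P t = 0 := by
  simp [gap, obj_eq_fStar_of_lt h hLμ]

/-- The weaker rate `η̂μ/3` keeps the factor nonnegative even when `μ > L`, where the gap vanishes
and only nonnegativity of the right side is needed. -/
theorem gap_le_convergence (t : ℕ) : S.gap P t
    ≤ (1 - 7 / 10 * (1 - S.β)) ^ t * (L * S.H0 P / (2 * S.n))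
      + 3 * ((1 - S.etaHat * μ / 3) ^ t * S.L0 P L)
      + 4 * (L * S.etaHat * (σ ^ 2 / (S.n * S.Q)) / μ)
      + 10000 * ((S.ηa * S.Q * L) ^ 2 * (σ ^ 2 / S.Q) / μ) := by
  have hη := h.etaHat_pos
  have hL := h.L_pos
  have hμ := h.mu_pos
  have h0 : 0 < S.etaHat * μ := mul_pos hη hμ
  have h1 := etaHat_mul_mu_le_one h
  have h2 := L0_nonneg h
  rcases le_or_gt μ L with hμL | hLμ
  · refine (gap_le_of_mu_le h hμL t).trans ?_
    have h3 : 0 ≤ 1 - 2 / 3 * (S.etaHat * μ) := by linarith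
    gcongr ?_ + 3 * (?_ ^ t * _) + _ + _
    · exact le_rfl
    · linarith
  · have h4 : 0 ≤ 1 - S.etaHat * μ / 3 := by linarith
    have h5 : 0 ≤ 1 - 7 / 10 * (1 - S.β) := by linarith [h.beta_pos]
    have h6 := H0_nonneg (S := S) (P := P)
    rw [gap_eq_zero_of_lt h hLμ]
    positivity

/-- Only constants are relaxed: `1 - (7/10)(1-β) ≤ (4+β)/5` and `10000 ≤ 520·(1+63·14)`; the term
with 220 is nonnegative slack. -/
theorem gap_le_explicit (t : ℕ) : S.gap P t
    ≤ ((4 + S.β) / 5) ^ t * (L * S.H0 P / (2 * S.n))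
      + 3 * (1 - S.etaHat * μ / 3) ^ t * S.L0 P L
      + 4 * S.etaHat * L * σ ^ 2 / (S.n * μ * S.Q)
      + 220 * S.etaHat ^ 2 * L ^ 2 * σ ^ 2 / (S.n * μ * S.Q * (1 - S.β))
      + 520 * (1 + 63 * c0) * S.ηa ^ 2 * S.Q * L ^ 2 * σ ^ 2 / μ := by
  have hn : (0 : ℝ) < S.n := Nat.cast_pos.2 h.n_pos
  have hQ : (0 : ℝ) < S.Q := Nat.cast_pos.2 h.Q_pos
  have hδ : 0 < 1 - S.β := sub_pos.2 h.beta_lt_one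
  have hL := h.L_pos
  have hμ := h.mu_pos
  have hβ := h.beta_pos
  have hH := H0_nonneg (S := S) (P := P)
  have h0 : 0 ≤ 1 - 7 / 10 * (1 - S.β) := by linarith
  have h1 : (1 - 7 / 10 * (1 - S.β)) ^ t * (L * S.H0 P / (2 * S.n))
      ≤ ((4 + S.β) / 5) ^ t * (L * S.H0 P / (2 * S.n)) := by
    gcongr ?_ ^ t * _
    all_goals linarith
  have h2 : 0 ≤ 220 * S.etaHat ^ 2 * L ^ 2 * σ ^ 2 / (S.n * μ * S.Q * (1 - S.β)) := by positivity
  have h3 : 4 * (L * S.etaHat * (σ ^ 2 / (S.n * S.Q)) / μ)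
      = 4 * S.etaHat * L * σ ^ 2 / (S.n * μ * S.Q) := by field_simp
  have h4 : 10000 * ((S.ηa * S.Q * L) ^ 2 * (σ ^ 2 / S.Q) / μ)
      ≤ 520 * (1 + 63 * c0) * S.ηa ^ 2 * S.Q * L ^ 2 * σ ^ 2 / μ := by
    have e : 10000 * ((S.ηa * S.Q * L) ^ 2 * (σ ^ 2 / S.Q) / μ)
      = 10000 * (S.ηa ^ 2 * S.Q * L ^ 2 * σ ^ 2 / μ) := by field_simp
    have e' : 520 * (1 + 63 * c0) * S.ηa ^ 2 * S.Q * L ^ 2 * σ ^ 2 / μ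
      = 459160 * (S.ηa ^ 2 * S.Q * L ^ 2 * σ ^ 2 / μ) := by rw [c0]; ring
    have : 0 ≤ S.ηa ^ 2 * S.Q * L ^ 2 * σ ^ 2 / μ := by positivity
    rw [e, e']
    linarith
  have h5 := gap_le_convergence h t
  linarith

/-- The bound on the initial value of the Lyapunov function of the network errors. -/
theorem H0_le : S.H0 P ≤ 2 * c0 * rhoW S.W * frobSq (proj S.x₀)
    + (2 * frobSq S.gradF0 + 8 * (1 - S.β) * S.n * σ ^ 2 / S.Q
      + S.n * L * (1 - S.β) * S.DeltaF) / L ^ 2 := by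
  have hn : (0 : ℝ) < S.n := Nat.cast_pos.2 h.n_pos
  have hQ : (0 : ℝ) < S.Q := Nat.cast_pos.2 h.Q_pos
  have hδ : 0 < 1 - S.β := sub_pos.2 h.beta_lt_one
  have hβ := h.beta_pos
  have hL := h.L_pos
  have hρ := half_le_rhoW (W := S.W)
  have hρ1 := h.rho_lt_one
  have hF := frobSq_nonneg (proj S.x₀)
  have hv := frobSq_nonneg S.gradF0
  have hΔ := DeltaF_nonneg h
  have ha1 := sq_step_le h
  -- At `t = 0` the majorants are their initial values by definition; in particular the tracking
  -- error before the first momentum update vanishes, so `y_0` is controlled by the first increment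
  -- alone.
  have hX : S.mX P 0 ≤ 2 * frobSq (proj S.x₀) := mX_le h 0
  have hH : S.mH P 0 ≤ 0 := mH_le h 0
  have hS := mS_le h (by linarith) 0
  have hG := mG_le h 0
  have hS0 := mS_nonneg (S := S) (P := P) 0
  have hK : ∫ ω, frobSq (proj (S.yVar (S.samples 0 ω) S.init)) ∂P
      ≤ 2 * S.mH P 0 + 2 * S.mG P 0 := by
    refine le_trans (le_of_eq ?_) (integral_frobSq_proj_track_le h 0)
    simp only [← yVar_eq]
    rfl
  have hK0 := integral_frobSq_yVar_nonneg (S := S) (P := P)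
  rw [mZ_zero, mV_zero, mul_zero, add_zero] at hS
  rw [mV_zero] at hG
  rw [H0_eq]
  generalize ∫ ω, frobSq (proj (S.yVar (S.samples 0 ω) S.init)) ∂P = K at hK hK0 ⊢
  generalize frobSq S.gradF0 = v at hv hS hG ⊢
  generalize frobSq (proj S.x₀) = F at hF hX ⊢
  obtain ⟨a, ha⟩ : ∃ a, a = (S.ηa * S.Q * L) ^ 2 := ⟨_, rfl⟩
  have ha0 : 0 ≤ a := ha ▸ sq_nonneg _
  obtain ⟨N, hN⟩ : ∃ N, N = S.n * (σ ^ 2 / S.Q) := ⟨_, rfl⟩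
  have hN0 : 0 ≤ N := by rw [hN]; positivity
  rw [← ha] at ha1 hS
  rw [← hN] at hS hG
  have hδ2 : (1 - S.β) ^ 2 ≤ 1 - S.β := by nlinarith
  have hSle : L ^ 2 * S.mS P 0 ≤ 21 / 5 * (L ^ 2 * F) + v + N := by
    have h1 : a * (v + S.mH P 0) ≤ 1 / 397350 * v := by
      have : a * (v + S.mH P 0) ≤ a * v := by gcongr; linarith
      have : a * v ≤ 1 / 397350 * v := by gcongr
      linarith
    have h2 : a * N ≤ 1 / 397350 * N := by gcongr
    have h3 : L ^ 2 * S.mX P 0 ≤ L ^ 2 * (2 * F) := by gcongr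
    linarith
  have hKle : K ≤ 4 * (1 - S.β) * (21 / 5 * (L ^ 2 * F) + 2 * v + 2 * N) := by
    have h1 : (1 - S.β) ^ 2 * (v + N + L ^ 2 * S.mS P 0)
        ≤ (1 - S.β) * (21 / 5 * (L ^ 2 * F) + 2 * v + 2 * N) :=
      mul_le_mul hδ2 (by linarith) (by positivity) hδ.le
    linarith
  have hKa : a * K ≤ 1 / 397350 * (17 * (L ^ 2 * F) + 8 * v + 8 * ((1 - S.β) * N)) := by
    have h1 : (1 - S.β) * (L ^ 2 * F) ≤ 1 * (L ^ 2 * F) := by gcongr; linarith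
    have h2 : (1 - S.β) * v ≤ 1 * v := by gcongr; linarith
    have h3 : 0 ≤ L ^ 2 * F := by positivity
    calc a * K ≤ 1 / 397350 * K := by gcongr
      _ ≤ _ := by linarith
  have hρK : rhoW S.W * (a * K) ≤ 1 * (a * K) := by gcongr
  have hρF : 1 / 2 * (L ^ 2 * F) ≤ rhoW S.W * (L ^ 2 * F) := by gcongr
  have hav : a * v ≤ 1 / 397350 * v := by gcongr
  have hδN : 0 ≤ (1 - S.β) * N := by positivity
  have hLF : 0 ≤ L ^ 2 * F := by positivity
  have hlast : 0 ≤ S.n * L * (1 - S.β) * S.DeltaF := by positivity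
  -- Moving the `x₀` term to the left leaves `-14ρ̃_w L²‖Πx_0‖²`, at most `-7L²‖Πx_0‖²`, which
  -- swallows the consensus error hidden in `E‖Πy_0‖²`.
  rw [← sub_le_iff_le_add', le_div_iff₀ (by positivity), c0]
  have e : 8 * (1 - S.β) * S.n * σ ^ 2 / S.Q = 8 * ((1 - S.β) * N) := by rw [hN]; ring
  have e' : (14 * rhoW S.W * F + S.ηa ^ 2 * S.Q ^ 2 * (14 * rhoW S.W * K)
      + 448 * S.ηa ^ 2 * S.Q ^ 2 * v - 2 * 14 * rhoW S.W * F) * L ^ 2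
      = 14 * (rhoW S.W * (a * K)) + 448 * (a * v) - 14 * (rhoW S.W * (L ^ 2 * F)) := by
    rw [ha]; ring
  rw [e, e']
  linarith

end Bounds

/-! ### The rate for a fixed horizon -/

/-- With `s = √(1-λ²) ≥ √(1-λ)` and `ρ̃_w² = 1/(1+s)`, the claim reduces to `(1 - 2s/7)²(1+s) ≥ 1`,
that is `s(21 - 24s + 4s²) ≥ 0` on `[0,1]`. -/
theorem sqrt_one_sub_specNorm_le {n : ℕ} {W : Matrix (Fin n) (Fin n) ℝ} (hρ : rhoW W < 1) :
    Real.sqrt (1 - specNorm W) / 5 ≤ 7 / 10 * (1 - rhoW W) := by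
  have hl : 0 ≤ specNorm W := norm_nonneg _
  set s := Real.sqrt (1 - specNorm W ^ 2) with hs
  have hs0 : 0 ≤ s := Real.sqrt_nonneg _
  have hs1 : s ≤ 1 := Real.sqrt_le_one.2 (by linarith [sq_nonneg (specNorm W)])
  have hls : Real.sqrt (1 - specNorm W) ≤ s := by
    rcases le_or_gt (specNorm W) 1 with h1 | h1
    · exact Real.sqrt_le_sqrt (by nlinarith)
    · rw [Real.sqrt_eq_zero_of_nonpos (by linarith)]
      exact hs0
  have hρ0 : 0 ≤ rhoW W := Real.sqrt_nonneg _
  have hρ2 : rhoW W ^ 2 = 1 / (1 + s) := Real.sq_sqrt (by rw [etaW]; positivity)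
  rw [eq_div_iff (by positivity)] at hρ2
  have : s / 5 ≤ 7 / 10 * (1 - rhoW W) := by
    by_contra hc
    have h1 : 1 - 2 / 7 * s < rhoW W := by linarith
    have h2 : (1 - 2 / 7 * s) ^ 2 < rhoW W ^ 2 := pow_lt_pow_left₀ h1 (by linarith) two_ne_zero
    have h3 := mul_lt_mul_of_pos_right h2 (show 0 < 1 + s by positivity)
    rw [hρ2] at h3
    nlinarith [mul_nonneg hs0 (sub_nonneg.2 hs1),
      mul_nonneg (mul_nonneg hs0 hs0) (sub_nonneg.2 hs1)]
  linarith

theorem one_sub_pow_le_exp {r : ℝ} (hr : r ≤ 1) (T : ℕ) : (1 - r) ^ T ≤ Real.exp (-(T * r)) := by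
  have h1 : 1 - r ≤ Real.exp (-r) := by linarith [Real.add_one_le_exp (-r)]
  refine (pow_le_pow_left₀ (sub_nonneg.2 hr) h1 T).trans (le_of_eq ?_)
  rw [← Real.exp_nat_mul]
  ring_nf

/-- The step sizes give `η_a Q ≤ a/(μT)` and `η̂ ≤ ab/(μT)`. It starts from `gap_le_convergence`,
since the relaxed factor `(4+β)/5` would be too slow for the exponent `T√(1-λ)/5` as `λ → 1`. -/
theorem gap_le_rate {a b : ℝ} (ha : 0 < a) (hb : 0 < b) (h : S.Assumptions P σ L μ) {T : ℕ}
    (hT : 1 ≤ T) (hβ : S.β = rhoW S.W) (hηa : S.ηa ≤ a / (S.Q * μ * T))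
    (hηs : S.ηs ≤ b * (1 - rhoW S.W)) :
    S.gap P T ≤ (4 * (a * b) + 10000 * a ^ 2 + 3) * ((L / μ) * σ ^ 2 / (S.n * μ * S.Q * T)
      + (L / μ) ^ 2 * σ ^ 2 / (μ * S.Q * T ^ 2)
      + L * (S.H0 P / S.n) * Real.exp (-(T * Real.sqrt (1 - specNorm S.W) / 5))
      + S.L0 P L * Real.exp (-(T * S.etaHat * μ / 3))) := by
  have hn : (0 : ℝ) < S.n := Nat.cast_pos.2 h.n_pos
  have hQ : (0 : ℝ) < S.Q := Nat.cast_pos.2 h.Q_pos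
  have hT0 : (0 : ℝ) < T := Nat.cast_pos.2 hT
  have hη := h.etaHat_pos
  have hL := h.L_pos
  have hμ := h.mu_pos
  have hηa0 := h.etaA_pos
  have hβ0 := h.beta_pos
  have hβ1 := h.beta_lt_one
  have hH := H0_nonneg (S := S) (P := P)
  have hL0 := L0_nonneg h
  set A := (L / μ) * σ ^ 2 / (S.n * μ * S.Q * T) with hA
  set B := (L / μ) ^ 2 * σ ^ 2 / (μ * S.Q * T ^ 2) with hB
  set E := L * (S.H0 P / S.n) * Real.exp (-(T * Real.sqrt (1 - specNorm S.W) / 5)) with hE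
  set F := S.L0 P L * Real.exp (-(T * S.etaHat * μ / 3)) with hF
  have hA0 : 0 ≤ A := by positivity
  have hB0 : 0 ≤ B := by positivity
  have hE0 : 0 ≤ E := by positivity
  have hF0 : 0 ≤ F := by positivity
  have hmul : S.ηa * S.Q ≤ a / (μ * T) := by
    rw [le_div_iff₀ (by positivity)] at hηa ⊢
    linarith
  have hetaHat : S.etaHat ≤ a / (μ * T) * b := by
    have h1 : S.ηs ≤ b := hηs.trans (mul_le_of_le_one_right hb.le (by linarith))
    calc S.etaHat = S.ηa * S.Q * S.ηs := by rw [etaHat]; ring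
      _ ≤ a / (μ * T) * b := mul_le_mul hmul h1 h.etaS_pos.le (by positivity)
  have t1 : (1 - 7 / 10 * (1 - S.β)) ^ T * (L * S.H0 P / (2 * S.n)) ≤ E := by
    have h1 := one_sub_pow_le_exp (r := 7 / 10 * (1 - S.β)) (by linarith) T
    have h2 : Real.exp (-(T * (7 / 10 * (1 - S.β))))
        ≤ Real.exp (-(T * Real.sqrt (1 - specNorm S.W) / 5)) := by
      rw [Real.exp_le_exp, neg_le_neg_iff, hβ, mul_div_assoc]
      exact mul_le_mul_of_nonneg_left (sqrt_one_sub_specNorm_le h.rho_lt_one) hT0.le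
    have h3 : L * S.H0 P / (2 * S.n) ≤ L * (S.H0 P / S.n) := by
      rw [← mul_div_assoc]
      gcongr
      linarith
    rw [hE, mul_comm (L * _)]
    exact mul_le_mul (h1.trans h2) h3 (by positivity) (Real.exp_pos _).le
  have t2 : (1 - S.etaHat * μ / 3) ^ T * S.L0 P L ≤ F := by
    have h1 := one_sub_pow_le_exp (r := S.etaHat * μ / 3)
      (by linarith [etaHat_mul_mu_le_one h]) T
    rw [hF, mul_comm (S.L0 P L)]
    refine mul_le_mul_of_nonneg_right (h1.trans (le_of_eq ?_)) hL0
    ring_nf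
  have t3 : L * S.etaHat * (σ ^ 2 / (S.n * S.Q)) / μ ≤ a * b * A := by
    calc L * S.etaHat * (σ ^ 2 / (S.n * S.Q)) / μ
        ≤ L * (a / (μ * T) * b) * (σ ^ 2 / (S.n * S.Q)) / μ := by gcongr
      _ = a * b * A := by rw [hA]; field_simp
  have t4 : (S.ηa * S.Q * L) ^ 2 * (σ ^ 2 / S.Q) / μ ≤ a ^ 2 * B := by
    calc (S.ηa * S.Q * L) ^ 2 * (σ ^ 2 / S.Q) / μ
        ≤ (a / (μ * T) * L) ^ 2 * (σ ^ 2 / S.Q) / μ := by gcongr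
      _ = a ^ 2 * B := by rw [hB]; field_simp
  have h5 := gap_le_convergence h T
  have p1 : 0 ≤ a * b * (B + E + F) := by positivity
  have p2 : 0 ≤ a ^ 2 * (A + E + F) := by positivity
  linarith

end Setup

end LMT

theorem theorem2 :
    -- The bound with explicit constants, for every round `t`.
    (∀ (Ω Ξ : Type*) [MeasurableSpace Ω] [MeasurableSpace Ξ]
        (P : Measure Ω) [IsProbabilityMeasure P] (S : LMT.Setup Ω Ξ) (σ L μ : ℝ),
      S.Assumptions P σ L μ →
        (∀ t i, Integrable (fun ω => S.obj (S.iter t i ω)) P) ∧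
        (∀ t : ℕ,
          S.gap P t ≤
            ((4 + S.β) / 5) ^ t * (L * S.H0 P / (2 * S.n))
              + 3 * (1 - S.etaHat * μ / 3) ^ t * S.L0 P L
              + 4 * S.etaHat * L * σ ^ 2 / (S.n * μ * S.Q)
              + 220 * S.etaHat ^ 2 * L ^ 2 * σ ^ 2 / (S.n * μ * S.Q * (1 - S.β))
              + 520 * (1 + 63 * LMT.c0) * S.ηa ^ 2 * S.Q * L ^ 2 * σ ^ 2 / μ) ∧
        S.H0 P ≤
          2 * LMT.c0 * LMT.rhoW S.W * LMT.frobSq (LMT.proj S.x₀)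
            + (2 * LMT.frobSq S.gradF0
                + 8 * (1 - S.β) * S.n * σ ^ 2 / S.Q
                + S.n * L * (1 - S.β) * S.DeltaF) / L ^ 2) ∧
    -- The rate for `β = ρ̃_w`, `η_a = O(1 / (Q μ T))`, `η_s = O(1 - ρ̃_w)`: the constant `C`
    -- depends only on the constants `a`, `b` hidden in these two orders.
    (∀ a b : ℝ, 0 < a → 0 < b → ∃ C : ℝ, 0 < C ∧
      ∀ (Ω Ξ : Type*) [MeasurableSpace Ω] [MeasurableSpace Ξ]
        (P : Measure Ω) [IsProbabilityMeasure P] (S : LMT.Setup Ω Ξ) (σ L μ : ℝ) (T : ℕ),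
      S.Assumptions P σ L μ → 1 ≤ T →
      S.β = LMT.rhoW S.W → S.ηa ≤ a / (S.Q * μ * T) → S.ηs ≤ b * (1 - LMT.rhoW S.W) →
        S.gap P T ≤
          C * ((L / μ) * σ ^ 2 / (S.n * μ * S.Q * T)
            + (L / μ) ^ 2 * σ ^ 2 / (μ * S.Q * T ^ 2)
            + L * (S.H0 P / S.n) * Real.exp (-(T * Real.sqrt (1 - LMT.specNorm S.W) / 5))
            + S.L0 P L * Real.exp (-(T * S.etaHat * μ / 3)))) := by
  -- The constant `C` adds up the coefficients of the two variance terms, `4ab` and `10000a²`, and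
  -- the factor 3 of the slow exponential.
  refine ⟨fun Ω Ξ _ _ P _ S σ L μ h => ⟨LMT.Setup.integrable_obj_iter h,
    LMT.Setup.gap_le_explicit h, LMT.Setup.H0_le h⟩, fun a b ha hb =>
    ⟨4 * (a * b) + 10000 * a ^ 2 + 3, by positivity, fun Ω Ξ _ _ P _ S σ L μ T h hT hβ hηa hηs =>
      LMT.Setup.gap_le_rate ha hb h hT hβ hηa hηs⟩⟩
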